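/- Let $k$ be a field and let $H$ be a finite-dimensional ribbon Hopf algebra over $k$, with comultiplication $\Delta(x)=x_{(1)}\otimes x_{(2)}$, counit $\varepsilon$, antipode $S$, centre $Z(H)$, $R$-matrix $R\in H\otimes H$ (invertible, with $R\Delta(x)=\sigma\Delta(x)R$ for all $x \in H$, where $\sigma$ is the flip, $(\mathrm{id}\otimes\Delta)(R)=R_{13}R_{12}$, $(\Delta\otimes\mathrm{id})(R)=R_{13}R_{23}$) and twist $\theta\in H$ (invertible and central, with $S(\theta)=\theta$ and $\Delta(\theta)=(\theta\otimes\theta)R_{21}R$). Let $\lambda\in H^*$ be a non-zero right integral for $H^*$, that is, $\lambda(x_{(1)})x_{(2)}=\lambda(x)1$ for all $x\in H$, and let $\nu:H\to k$ be the distinguished grouplike element of $H^*$, that is, the algebra morphism such that $\Lambda x=\nu(x)\Lambda$ for all $x\in H$ and all left integrals $\Lambda$ for $H$ (the elements $\Lambda \in H$ with $x\Lambda=\varepsilon(x)\Lambda$ for all $x$). For $f\in H^*$ and $x\in H$ put $x\leftharpoonup f=f(x_{(1)})x_{(2)}$, and let $h_\nu=(\mathrm{id}\otimes\nu)(R)$,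 $T(z)=(S(z)\leftharpoonup\nu)\,h_\nu$ for $z \in H$, $$L(H)=\{z\in H : (x\leftharpoonup\nu)z=zx \text{ for all } x\in H\},$$ $$N(H)=\{z\in L(H) : \lambda(za)=0 \text{ for all } a\in Z(H)\},$$ $$V_2(H)=\{X\in H\otimes H : X\triangleleft h=\varepsilon(h)X \text{ for all } h\in H\},\quad (x\otimes y)\triangleleft h=S(h_{(1)})xh_{(2)}\otimes S(h_{(3)})yh_{(4)}.$$ Let $\mathcal C=\mathrm{rep}_H$ be the ribbon category of finite-dimensional left $H$-modules: the dual $X^*$ carries $(hf)(x)=f(S(h)x)$, the braiding is $c_{X,Y}(x\otimes y)=\sigma(R\cdot(x\otimes y))$, and the twist is the action of $\theta$. Let $(A,i)$ be the coend of $(X,Y)\mapsto X^*\otimes Y$, realized as $A=H^*$ with the coadjoint action $(h\triangleright f)(x)=f(S(h_{(1)})xh_{(2)})$ and $i_X(l\otimes m)=(x\mapsto l(xm))$. Let $\Delta_A$, $m_A$, $S_A$ and $\Theta_\pm:A\to\mathbb 1$ be the morphisms determined by $$\Delta_A i_X=(i_X\otimes i_X)(\mathrm{id}_{X^*}\otimes\mathrm{coev}_X\otimes\mathrm{id}_X),$$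 $$m_A(i_X\otimes i_Y)=\Bigl(X^*\otimes X\otimes Y^*\otimes Y\xrightarrow{\ \mathrm{id}\otimes c_{X,Y^*\otimes Y}\ }X^*\otimes Y^*\otimes Y\otimes X\simeq(Y\otimes X)^*\otimes(Y\otimes X)\xrightarrow{\ i_{Y\otimes X}\ }A\Bigr),$$ $$S_A i_X=\Bigl(X^*\otimes X\xrightarrow{\ c_{X^*,X}\ }X\otimes X^*\xrightarrow{\ \mathrm{id}\otimes\theta_{X^*}\ }X\otimes X^*\simeq X^{**}\otimes X^*\xrightarrow{\ i_{X^*}\ }A\Bigr),$$ $$\Theta_\pm i_X=\mathrm{ev}_X(\mathrm{id}_{X^*}\otimes\theta_X^{\pm1}),$$ where $X\simeq X^{**}$ corresponds to the right evaluation $\mathrm{ev}_X\,c_{X,X^*}(\theta_X\otimes\mathrm{id}_{X^*})$. Let $\Gamma_l=(\mathrm{id}_A\otimes m_A)(\Delta_A\otimes\mathrm{id}_A)$. A morphism $f:X\to Y$ is negligible if the quantum trace of $gf$ vanishes for all $g:Y\to X$. Let $\mathcal I(\mathcal C)$ be the set of all $\alpha\in\mathrm{Hom}_{\mathcal C}(\mathbb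 1,A)$ such that $S_A\alpha-\alpha$ and $\Gamma_l(\alpha\otimes\alpha)-\alpha\otimes\alpha$ are negligible, and let $\mathcal I(\mathcal C)^{\mathrm{norm}}$ be the set of those $\alpha \in \mathcal I(\mathcal C)$ with $\Theta_+\alpha\ne0$ and $\Theta_-\alpha\neq 0$. For $z\in H$ let $\phi_z:k\to H^*$ be the linear map $\alpha\mapsto\alpha\,\lambda(z\,\cdot)$. Let $\mathcal I(H)$ (resp. $\mathcal I(H)^{\mathrm{norm}}$) be the set of all $z\in H$ such that $\phi_z$ is a morphism of $\mathcal C$ belonging to $\mathcal I(\mathcal C)$ (resp. $\mathcal I(\mathcal C)^{\mathrm{norm}}$). **Theorem.** The set $\mathcal I(H)$ consists exactly of the elements $z\in L(H)$ such that (a) $T(z)-z\in N(H)$, which for $z \in L(H)$ is equivalent to $\lambda(T(z)a)=\lambda(za)$ for all $a\in Z(H)$; and (b) $\sum_i\lambda(zx_{i(1)})\,\lambda(zx_{i(2)}y_i)=\sum_i\lambda(zx_i)\,\lambda(zy_i)$ for all $X=\sum_i x_i\otimes y_i\in V_2(H)$. In particular, every $z\in L(H)$ such that $T(z)=z$ and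 $\lambda(zx_{(1)})\,zx_{(2)}=\lambda(zx)\,z$ for all $x\in H$ belongs to $\mathcal I(H)$. Moreover, an element $z\in\mathcal I(H)$ belongs to $\mathcal I(H)^{\mathrm{norm}}$ if and only if $\lambda(z\theta)\neq0$ and $\lambda(z\theta^{-1})\neq0$. -/

import Mathlib

open CategoryTheory MonoidalCategory TensorProduct Opposite

universe u

/-- A quasitriangular Hopf algebra: a Hopf algebra `H` with an invertible `R ∈ H ⊗ H` such that
`R Δ(x) = σΔ(x) R`, `(id ⊗ Δ)(R) = R₁₃ R₁₂` and `(Δ ⊗ id)(R) = R₁₃ R₂₃`. -/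
class QuasitriangularHopfAlgebra (k H : Type u) [Field k] [Ring H] [HopfAlgebra k H] where
  R : (H ⊗[k] H)ˣ
  R_comul : ∀ x : H, (R : H ⊗[k] H) * Coalgebra.comul (R := k) x =
    TensorProduct.comm k H H (Coalgebra.comul (R := k) x) * (R : H ⊗[k] H)
  id_comul_R : (Coalgebra.comul (R := k) (A := H)).lTensor H (R : H ⊗[k] H) =
    Algebra.TensorProduct.map (AlgHom.id k H) Algebra.TensorProduct.includeRight (R : H ⊗[k] H) *
    Algebra.TensorProduct.map (AlgHom.id k H) Algebra.TensorProduct.includeLeft (R : H ⊗[k] H)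
  comul_id_R : TensorProduct.assoc k H H H
      ((Coalgebra.comul (R := k) (A := H)).rTensor H (R : H ⊗[k] H)) =
    Algebra.TensorProduct.map (AlgHom.id k H) Algebra.TensorProduct.includeRight (R : H ⊗[k] H) *
    Algebra.TensorProduct.includeRight (R : H ⊗[k] H)

/-- A ribbon Hopf algebra: a quasitriangular Hopf algebra with an invertible central element `θ`
such that `S(θ) = θ` and `Δ(θ) = (θ ⊗ θ) R₂₁ R`. -/
class RibbonHopfAlgebra (k H : Type u) [Field k] [Ring H] [HopfAlgebra k H] extends
    QuasitriangularHopfAlgebra k H where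
  θ : Hˣ
  θ_central : ∀ x : H, (θ : H) * x = x * θ
  antipode_θ : HopfAlgebra.antipode k (θ : H) = θ
  comul_θ : Coalgebra.comul (R := k) (θ : H) =
    ((θ : H) ⊗ₜ[k] (θ : H)) * TensorProduct.comm k H H (R : H ⊗[k] H) * (R : H ⊗[k] H)

/-! ### Ribbon categories, negligible morphisms, coends and Kirby elements -/

section RibbonCategories

universe v w

open ExactPairing

/-- A ribbon category: a braided category with duals `X ↦ Xᘁ` (with `η_ X Xᘁ : 𝟙_ ⟶ X ⊗ Xᘁ` and
`ε_ X Xᘁ : Xᘁ ⊗ X ⟶ 𝟙_`), endowed with a twist. -/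
class RibbonCategory (C : Type w) [Category.{v} C] [MonoidalCategory C] [BraidedCategory C]
    [RightRigidCategory C] where
  twist (X : C) : X ≅ X
  twist_naturality {X Y : C} (f : X ⟶ Y) : f ≫ (twist Y).hom = (twist X).hom ≫ f
  twist_dual (X : C) : η_ X Xᘁ ≫ (twist X).hom ▷ Xᘁ = η_ X Xᘁ ≫ X ◁ (twist Xᘁ).hom
  twist_tensor (X Y : C) : (twist (X ⊗ Y)).hom =
    ((twist X).hom ⊗ₘ (twist Y).hom) ≫ (β_ X Y).hom ≫ (β_ Y X).hom

namespace RibbonCategory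

variable {C : Type w} [Category.{v} C] [MonoidalCategory C]

/-- The morphism `P ⟶ Qᘁ` adjoint to a pairing `P ⊗ Q ⟶ 𝟙_`. -/
def adjoint [RightRigidCategory C] {P Q : C} (f : P ⊗ Q ⟶ 𝟙_ C) : P ⟶ Qᘁ :=
  tensorRightHomEquiv P Q Qᘁ (𝟙_ C) f ≫ (λ_ Qᘁ).hom

theorem adjoint_eval [RightRigidCategory C] {P Q : C} (f : P ⊗ Q ⟶ 𝟙_ C) :
    adjoint f ▷ Q ≫ ε_ Q Qᘁ = f := by
  have h := (tensorRightHomEquiv P Q Qᘁ (𝟙_ C)).symm_apply_apply f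
  conv_rhs => rw [← h]
  rw [adjoint]
  generalize tensorRightHomEquiv P Q Qᘁ (𝟙_ C) f = g
  simp [tensorRightHomEquiv, unitors_inv_equal]

/-- The morphism `Xᘁ ⊗ Yᘁ ⊗ Y ⊗ X ⟶ Xᘁ ⊗ X ⟶ 𝟙_`. -/
def dualTensorPairing [RightRigidCategory C] (X Y : C) : (Xᘁ ⊗ Yᘁ) ⊗ (Y ⊗ X) ⟶ 𝟙_ C :=
  (α_ Xᘁ Yᘁ (Y ⊗ X)).hom ≫ Xᘁ ◁ (α_ Yᘁ Y X).inv ≫ Xᘁ ◁ (ε_ Y Yᘁ ▷ X) ≫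
    Xᘁ ◁ (λ_ X).hom ≫ ε_ X Xᘁ

/-- The canonical isomorphism `Xᘁ ⊗ Yᘁ ⟶ (Y ⊗ X)ᘁ`, adjoint to `dualTensorPairing`. -/
def dualTensor [RightRigidCategory C] (X Y : C) : Xᘁ ⊗ Yᘁ ⟶ (Y ⊗ X)ᘁ :=
  adjoint (dualTensorPairing X Y)

variable (C) in
/-- The bifunctor `(X, Y) ↦ Xᘁ ⊗ Y`, `(f, g) ↦ fᘁ ⊗ g`. -/
def dualTensorFunctor [RightRigidCategory C] : Cᵒᵖ ⥤ C ⥤ C where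
  obj X := tensorLeft (X.unop)ᘁ
  map f := (curriedTensor C).map (rightAdjointMate f.unop)
  map_id X := by simp [tensorLeft]
  map_comp f g := by simp [comp_rightAdjointMate]

variable [BraidedCategory C] [RightRigidCategory C] [RibbonCategory C]

/-- The right evaluation `X ⊗ Xᘁ ⟶ 𝟙_`. -/
def evTilde (X : C) : X ⊗ Xᘁ ⟶ 𝟙_ C :=
  (twist X).hom ▷ Xᘁ ≫ (β_ X Xᘁ).hom ≫ ε_ X Xᘁ

/-- The canonical isomorphism `X ⟶ Xᘁᘁ`, adjoint to the right evaluation. -/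
def bidual (X : C) : X ⟶ (Xᘁ)ᘁ := adjoint (evTilde X)

/-- The quantum trace of an endomorphism. -/
def qTrace {X : C} (f : X ⟶ X) : 𝟙_ C ⟶ 𝟙_ C := η_ X Xᘁ ≫ f ▷ Xᘁ ≫ evTilde X

/-- Negligible morphisms. -/
def Negligible [Preadditive C] {X Y : C} (f : X ⟶ Y) : Prop :=
  ∀ g : Y ⟶ X, qTrace (f ≫ g) = 0

variable (C) in
/-- A coend `(A, i)` of the bifunctor `(X, Y) ↦ Xᘁ ⊗ Y`. -/
structure DualCoend where
  cowedge : Limits.Cowedge (dualTensorFunctor C)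
  isColimit : Limits.IsColimit cowedge

namespace DualCoend

/-- The object underlying the coend. -/
abbrev A (D : DualCoend C) : C := D.cowedge.pt

/-- The universal dinatural transformation. -/
def i (D : DualCoend C) (X : C) : Xᘁ ⊗ X ⟶ D.A := D.cowedge.π X

end DualCoend

/-- `Xᘁ ⊗ coev_X ⊗ X`. -/
def comulAux (X : C) : Xᘁ ⊗ X ⟶ (Xᘁ ⊗ X) ⊗ (Xᘁ ⊗ X) :=
  Xᘁ ◁ (λ_ X).inv ≫ Xᘁ ◁ (η_ X Xᘁ ▷ X) ≫ Xᘁ ◁ (α_ X Xᘁ X).hom ≫ (α_ Xᘁ X (Xᘁ ⊗ X)).inv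

/-- The braiding of `X` with `Yᘁ ⊗ Y`, followed by the isomorphism `Xᘁ ⊗ Yᘁ ⟶ (Y ⊗ X)ᘁ`. -/
def mulAux (X Y : C) : (Xᘁ ⊗ X) ⊗ (Yᘁ ⊗ Y) ⟶ (Y ⊗ X)ᘁ ⊗ (Y ⊗ X) :=
  (α_ Xᘁ X (Yᘁ ⊗ Y)).hom ≫ Xᘁ ◁ (β_ X (Yᘁ ⊗ Y)).hom ≫ Xᘁ ◁ (α_ Yᘁ Y X).hom ≫
    (α_ Xᘁ Yᘁ (Y ⊗ X)).inv ≫ dualTensor X Y ▷ (Y ⊗ X)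

/-- The braiding of `Xᘁ` with `X`, followed by the twist of `Xᘁ` and the isomorphism `X ⟶ Xᘁᘁ`. -/
def antipodeAux (X : C) : Xᘁ ⊗ X ⟶ (Xᘁ)ᘁ ⊗ Xᘁ :=
  (β_ Xᘁ X).hom ≫ X ◁ (twist Xᘁ).hom ≫ bidual X ▷ Xᘁ

variable (C) in
/-- A coend `(A, i)` together with the structural morphisms that its universal property gives:
the comultiplication `Δ_A`, multiplication `m_A` and antipode `S_A` of the categorical Hopf algebra
`A`, and the morphisms `Θ_± : A ⟶ 𝟙_`. Each is the unique morphism with the stated property. -/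
structure CoendHopfData extends DualCoend C where
  comul : toDualCoend.A ⟶ toDualCoend.A ⊗ toDualCoend.A
  i_comul (X : C) : toDualCoend.i X ≫ comul =
    comulAux X ≫ (toDualCoend.i X ⊗ₘ toDualCoend.i X)
  mul : toDualCoend.A ⊗ toDualCoend.A ⟶ toDualCoend.A
  i_mul (X Y : C) : (toDualCoend.i X ⊗ₘ toDualCoend.i Y) ≫ mul =
    mulAux X Y ≫ toDualCoend.i (Y ⊗ X)
  antipode : toDualCoend.A ⟶ toDualCoend.A
  i_antipode (X : C) : toDualCoend.i X ≫ antipode = antipodeAux X ≫ toDualCoend.i Xᘁ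
  thetaPos : toDualCoend.A ⟶ 𝟙_ C
  i_thetaPos (X : C) : toDualCoend.i X ≫ thetaPos = Xᘁ ◁ (twist X).hom ≫ ε_ X Xᘁ
  thetaNeg : toDualCoend.A ⟶ 𝟙_ C
  i_thetaNeg (X : C) : toDualCoend.i X ≫ thetaNeg = Xᘁ ◁ (twist X).inv ≫ ε_ X Xᘁ

namespace CoendHopfData

variable (D : CoendHopfData C)

/-- `Γ_l = (id_A ⊗ m_A)(Δ_A ⊗ id_A)`. -/
def gammaL : D.A ⊗ D.A ⟶ D.A ⊗ D.A :=
  D.comul ▷ D.A ≫ (α_ D.A D.A D.A).hom ≫ D.A ◁ D.mul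

/-- `α ⊗ α`, as a morphism from the unit object. -/
def sq (α : 𝟙_ C ⟶ D.A) : 𝟙_ C ⟶ D.A ⊗ D.A := (λ_ (𝟙_ C)).inv ≫ (α ⊗ₘ α)

/-- The set `I(C)`. -/
def kirby [Preadditive C] : Set (𝟙_ C ⟶ D.A) :=
  {α | Negligible (α ≫ D.antipode - α) ∧ Negligible (D.sq α ≫ D.gammaL - D.sq α)}

/-- The set `I(C)^norm`. -/
def kirbyNorm [Preadditive C] : Set (𝟙_ C ⟶ D.A) :=
  {α | α ∈ D.kirby ∧ α ≫ D.thetaPos ≠ 0 ∧ α ≫ D.thetaNeg ≠ 0}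

end CoendHopfData

end RibbonCategory

end RibbonCategories

namespace HopfRep

variable {k H : Type u} [Field k] [Ring H] [HopfAlgebra k H]
variable {V W U V' W' : Type u} [AddCommGroup V] [Module k V] [AddCommGroup W] [Module k W]
  [AddCommGroup U] [Module k U] [AddCommGroup V'] [Module k V'] [AddCommGroup W'] [Module k W']

/-- The action of `H ⊗ H` on `V ⊗ W` for `H`-modules `V` and `W`. -/
noncomputable def act (ρ : H →ₐ[k] Module.End k V) (σ : H →ₐ[k] Module.End k W) :
    H ⊗[k] H →ₐ[k] Module.End k (V ⊗[k] W) :=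
  (Module.endTensorEndAlgHom (R := k) (S := k) (A := k)).comp (Algebra.TensorProduct.map ρ σ)

@[simp] theorem act_tmul (ρ : H →ₐ[k] Module.End k V) (σ : H →ₐ[k] Module.End k W) (a b : H)
    (v : V) (w : W) : act ρ σ (a ⊗ₜ b) (v ⊗ₜ w) = ρ a v ⊗ₜ σ b w := rfl

/-- The tensor product of two modules: `h` acts by `h₍₁₎ ⊗ h₍₂₎`. -/
noncomputable def tens (ρ : H →ₐ[k] Module.End k V) (σ : H →ₐ[k] Module.End k W) :
    H →ₐ[k] Module.End k (V ⊗[k] W) :=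
  (act ρ σ).comp (Bialgebra.comulAlgHom k H)

theorem tens_apply (ρ : H →ₐ[k] Module.End k V) (σ : H →ₐ[k] Module.End k W) (h : H) :
    tens ρ σ h = act ρ σ (Coalgebra.comul (R := k) h) := rfl

variable (k H) in
/-- The trivial module: `h` acts by `ε(h)`. -/
noncomputable def triv : H →ₐ[k] Module.End k k :=
  (Algebra.ofId k (Module.End k k)).comp (Bialgebra.counitAlgHom k H)

theorem triv_apply (h : H) (c : k) : triv k H h c = Coalgebra.counit (R := k) h * c := rfl

theorem map_act {ρ : H →ₐ[k] Module.End k V} {σ : H →ₐ[k] Module.End k W}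
    {ρ' : H →ₐ[k] Module.End k V'} {σ' : H →ₐ[k] Module.End k W'}
    {f : V →ₗ[k] V'} {g : W →ₗ[k] W'} (hf : ∀ h v, f (ρ h v) = ρ' h (f v))
    (hg : ∀ h v, g (σ h v) = σ' h (g v)) (t : H ⊗[k] H) (v : V ⊗[k] W) :
    TensorProduct.map f g (act ρ σ t v) = act ρ' σ' t (TensorProduct.map f g v) := by
  induction t with
  | zero => simp
  | add a b ha hb => simp [ha, hb]
  | tmul a b =>
    induction v with
    | zero => simp
    | add a b ha hb => simp [ha, hb]
    | tmul v w => simp [hf, hg]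

/-- The action of `H ⊗ H ⊗ H` on `V ⊗ W ⊗ U`. -/
noncomputable def act₃ (ρ : H →ₐ[k] Module.End k V) (σ : H →ₐ[k] Module.End k W)
    (τ : H →ₐ[k] Module.End k U) :
    H ⊗[k] (H ⊗[k] H) →ₐ[k] Module.End k (V ⊗[k] (W ⊗[k] U)) :=
  (Module.endTensorEndAlgHom (R := k) (S := k) (A := k)).comp
    (Algebra.TensorProduct.map ρ (act σ τ))

section
variable (ρ : H →ₐ[k] Module.End k V) (σ : H →ₐ[k] Module.End k W) (τ : H →ₐ[k] Module.End k U)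

@[simp] theorem act₃_tmul (a b c : H) (x : V) (y : W) (z : U) :
    act₃ ρ σ τ (a ⊗ₜ (b ⊗ₜ c)) (x ⊗ₜ (y ⊗ₜ z)) = ρ a x ⊗ₜ (σ b y ⊗ₜ τ c z) := rfl

theorem act_tens_right (t : H ⊗[k] H) (w : V ⊗[k] (W ⊗[k] U)) :
    act ρ (tens σ τ) t w =
      act₃ ρ σ τ ((Coalgebra.comul (R := k) (A := H)).lTensor H t) w := by
  induction t with
  | zero => simp
  | add a b ha hb => simp only [map_add, LinearMap.add_apply, ha, hb]
  | tmul a b => rfl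

theorem act_tens_left (t : H ⊗[k] H) (w : (V ⊗[k] W) ⊗[k] U) :
    TensorProduct.assoc k V W U (act (tens ρ σ) τ t w) =
      act₃ ρ σ τ (TensorProduct.assoc k H H H
        ((Coalgebra.comul (R := k) (A := H)).rTensor H t)) (TensorProduct.assoc k V W U w) := by
  induction t with
  | zero => simp
  | add a b ha hb => simp only [map_add, LinearMap.add_apply, ha, hb]
  | tmul a b =>
    have key : ∀ s : H ⊗[k] H, TensorProduct.assoc k V W U
        (TensorProduct.map (act ρ σ s) (τ b) w) =
        act₃ ρ σ τ (TensorProduct.assoc k H H H (s ⊗ₜ b)) (TensorProduct.assoc k V W U w) := by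
      intro s
      induction s with
      | zero => simp
      | add a b ha hb =>
        simp only [map_add, LinearMap.add_apply, TensorProduct.map_add_left, ha, hb,
          TensorProduct.add_tmul]
      | tmul c d =>
        induction w with
        | zero => simp
        | add a b ha hb => simp only [map_add, ha, hb]
        | tmul w z =>
          induction w with
          | zero => simp
          | add a b ha hb => simp only [map_add, ha, hb, TensorProduct.add_tmul]
          | tmul x y => simp
    exact key (Coalgebra.comul a)

theorem assoc_tens (h : H) (w : (V ⊗[k] W) ⊗[k] U) :
    TensorProduct.assoc k V W U (tens (tens ρ σ) τ h w) =
      tens ρ (tens σ τ) h (TensorProduct.assoc k V W U w) := by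
  rw [tens_apply, act_tens_left, tens_apply, act_tens_right, Coalgebra.coassoc_apply]

theorem lid_tens (h : H) (w : k ⊗[k] V) :
    TensorProduct.lid k V (tens (triv k H) ρ h w) = ρ h (TensorProduct.lid k V w) := by
  induction w with
  | zero => simp
  | add a b ha hb => simp only [map_add, ha, hb]
  | tmul c v =>
    have key : ∀ t : H ⊗[k] H, TensorProduct.lid k V (act (triv k H) ρ t (c ⊗ₜ v)) =
        c • ρ (TensorProduct.lid k H ((Coalgebra.counit (R := k) (A := H)).rTensor H t)) v := by
      intro t
      induction t with
      | zero => simp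
      | add a b ha hb => simp only [map_add, LinearMap.add_apply, ha, hb, smul_add]
      | tmul a b => simp [triv_apply, smul_smul, mul_comm]
    rw [tens_apply, key]
    simp

theorem rid_tens (h : H) (w : V ⊗[k] k) :
    TensorProduct.rid k V (tens ρ (triv k H) h w) = ρ h (TensorProduct.rid k V w) := by
  induction w with
  | zero => simp
  | add a b ha hb => simp only [map_add, ha, hb]
  | tmul v c =>
    have key : ∀ t : H ⊗[k] H, TensorProduct.rid k V (act ρ (triv k H) t (v ⊗ₜ c)) =
        c • ρ (TensorProduct.rid k H ((Coalgebra.counit (R := k) (A := H)).lTensor H t)) v := by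
      intro t
      induction t with
      | zero => simp
      | add a b ha hb => simp only [map_add, LinearMap.add_apply, ha, hb, smul_add]
      | tmul a b => simp [triv_apply, smul_smul, mul_comm]
    rw [tens_apply, key]
    simp

theorem comm_act (t : H ⊗[k] H) (v : V ⊗[k] W) :
    TensorProduct.comm k V W (act ρ σ t v) =
      act σ ρ (TensorProduct.comm k H H t) (TensorProduct.comm k V W v) := by
  induction t with
  | zero => simp
  | add a b ha hb => simp only [map_add, LinearMap.add_apply, ha, hb]
  | tmul a b =>
    induction v with
    | zero => simp
    | add a b ha hb => simp only [map_add, ha, hb]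
    | tmul v w => simp

/-- The dual module: `h` acts by the transpose of the action of `S(h)`. -/
noncomputable def dual : H →ₐ[k] Module.End k (Module.Dual k V) :=
  AlgHom.ofLinearMap
    ((Module.Dual.transpose (R := k) (M := V) (M' := V)) ∘ₗ ρ.toLinearMap ∘ₗ HopfAlgebra.antipode k)
    (by ext; simp [Module.Dual.transpose])
    (fun a b => by
      ext f v
      simp only [LinearMap.comp_apply, AlgHom.toLinearMap_apply,
        HopfAlgebra.antipode_mul_antidistrib, map_mul]
      rfl)

@[simp] theorem dual_apply (h : H) (f : Module.Dual k V) (v : V) :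
    dual ρ h f v = f (ρ (HopfAlgebra.antipode k h) v) := rfl

theorem contractLeft_tens (h : H) (w : Module.Dual k V ⊗[k] V) :
    contractLeft k V (tens (dual ρ) ρ h w) = Coalgebra.counit (R := k) h * contractLeft k V w := by
  induction w with
  | zero => simp
  | add a b ha hb => simp only [map_add, ha, hb, mul_add]
  | tmul f v =>
    have key : ∀ t : H ⊗[k] H, contractLeft k V (act (dual ρ) ρ t (f ⊗ₜ v)) =
        f (ρ (LinearMap.mul' k H ((HopfAlgebra.antipode k).rTensor H t)) v) := by
      intro t
      induction t with
      | zero => simp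
      | add a b ha hb => simp only [map_add, LinearMap.add_apply, ha, hb]
      | tmul a b => simp
    rw [tens_apply, key, HopfAlgebra.mul_antipode_rTensor_comul_apply]
    simp [Algebra.algebraMap_eq_smul_one]

theorem coevaluation_id [FiniteDimensional k V] :
    dualTensorHom k V V (TensorProduct.comm k _ _ (coevaluation k V 1)) = LinearMap.id := by
  ext x
  simp only [coevaluation_apply_one, map_sum, TensorProduct.comm_tmul, LinearMap.sum_apply,
    dualTensorHom_apply, LinearMap.id_apply]
  exact (Module.Basis.ofVectorSpace k V).sum_repr x

theorem dualTensorHom_comm_injective [FiniteDimensional k V] :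
    Function.Injective (fun w : V ⊗[k] Module.Dual k V =>
      dualTensorHom k V V (TensorProduct.comm k _ _ w)) :=
  (dualTensorHomEquiv k V V).injective.comp (TensorProduct.comm k _ _).injective

theorem map_coevaluation [FiniteDimensional k V] (f : V →ₗ[k] V) :
    f.rTensor (Module.Dual k V) (coevaluation k V 1) =
      (Module.Dual.transpose (R := k) f).lTensor V (coevaluation k V 1) := by
  apply dualTensorHom_comm_injective
  have h1 : ∀ w : V ⊗[k] Module.Dual k V,
      dualTensorHom k V V (TensorProduct.comm k _ _ (f.rTensor (Module.Dual k V) w)) =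
        f ∘ₗ dualTensorHom k V V (TensorProduct.comm k _ _ w) := by
    intro w
    induction w with
    | zero => simp
    | add a b ha hb => simp only [map_add, ha, hb, LinearMap.comp_add]
    | tmul a b => ext; simp
  have h2 : ∀ w : V ⊗[k] Module.Dual k V,
      dualTensorHom k V V (TensorProduct.comm k _ _
        ((Module.Dual.transpose (R := k) f).lTensor V w)) =
        dualTensorHom k V V (TensorProduct.comm k _ _ w) ∘ₗ f := by
    intro w
    induction w with
    | zero => simp
    | add a b ha hb => simp only [map_add, ha, hb, LinearMap.add_comp]
    | tmul a b => ext; simp [Module.Dual.transpose]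
  simp only [h1, h2, coevaluation_id]
  rfl

theorem tens_coevaluation [FiniteDimensional k V] (h : H) (c : k) :
    tens ρ (dual ρ) h (coevaluation k V c) =
      coevaluation k V (Coalgebra.counit (R := k) h * c) := by
  have key : ∀ (t : H ⊗[k] H) (w : V ⊗[k] Module.Dual k V),
      dualTensorHom k V V (TensorProduct.comm k _ _ w) = LinearMap.id →
      dualTensorHom k V V (TensorProduct.comm k _ _ (act ρ (dual ρ) t w)) =
      ρ (LinearMap.mul' k H ((HopfAlgebra.antipode k).lTensor H t)) := by
    intro t w hw
    induction t with
    | zero => simp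
    | add a b ha hb => simp only [map_add, LinearMap.add_apply, ha, hb]
    | tmul a b =>
      have : ∀ w : V ⊗[k] Module.Dual k V,
          dualTensorHom k V V (TensorProduct.comm k _ _ (act ρ (dual ρ) (a ⊗ₜ b) w)) =
          ρ a ∘ₗ dualTensorHom k V V (TensorProduct.comm k _ _ w) ∘ₗ
            ρ (HopfAlgebra.antipode k b) := by
        intro w
        induction w with
        | zero => simp
        | add w w' ha hb => simp only [map_add, ha, hb, LinearMap.add_comp, LinearMap.comp_add]
        | tmul v f => ext; simp
      rw [this, hw]
      simp only [LinearMap.lTensor_tmul, LinearMap.mul'_apply, map_mul]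
      rfl
  have hid := coevaluation_id (k := k) (V := V)
  have hinj := dualTensorHom_comm_injective (k := k) (V := V)
  have h1 : ∀ c : k, coevaluation k V c = c • coevaluation k V 1 := fun c => by
    rw [← map_smul, smul_eq_mul, mul_one]
  have h2 : tens ρ (dual ρ) h (coevaluation k V 1) =
      Coalgebra.counit (R := k) h • coevaluation k V 1 := by
    apply hinj
    simp only [tens_apply]
    rw [key _ _ hid, HopfAlgebra.mul_antipode_lTensor_comul_apply]
    simp [hid, Algebra.algebraMap_eq_smul_one]
    rfl
  rw [h1 c, h1 (_ * c), map_smul, h2, smul_smul, mul_comm]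


theorem comm_comm_apply' (w : V ⊗[k] W) :
    TensorProduct.comm k W V (TensorProduct.comm k V W w) = w :=
  (TensorProduct.comm k V W).symm_apply_apply w

/-- `v ⊗ w ↦ σ(t · (v ⊗ w))` for `t ∈ H ⊗ H`, with `σ` the flip. -/
noncomputable def flipAct (t : H ⊗[k] H) : V ⊗[k] W →ₗ[k] W ⊗[k] V :=
  (TensorProduct.comm k V W).toLinearMap ∘ₗ act ρ σ t

@[simp] theorem flipAct_tmul (a b : H) (v : V) (w : W) :
    flipAct ρ σ (a ⊗ₜ b) (v ⊗ₜ w) = σ b w ⊗ₜ ρ a v := rfl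

theorem flipAct_add (s t : H ⊗[k] H) :
    flipAct ρ σ (s + t) = flipAct ρ σ s + flipAct ρ σ t := by
  ext; simp [flipAct]

theorem flipAct_zero : flipAct ρ σ (0 : H ⊗[k] H) = 0 := by
  ext; simp [flipAct]

theorem flipAct_map {ρ : H →ₐ[k] Module.End k V} {σ : H →ₐ[k] Module.End k W}
    {ρ' : H →ₐ[k] Module.End k V'} {σ' : H →ₐ[k] Module.End k W'}
    {f : V →ₗ[k] V'} {g : W →ₗ[k] W'} (hf : ∀ h v, f (ρ h v) = ρ' h (f v))
    (hg : ∀ h v, g (σ h v) = σ' h (g v)) (t : H ⊗[k] H) (v : V ⊗[k] W) :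
    flipAct ρ' σ' t (TensorProduct.map f g v) = TensorProduct.map g f (flipAct ρ σ t v) := by
  simp only [flipAct, LinearMap.comp_apply, LinearEquiv.coe_coe]
  rw [← map_act hf hg, TensorProduct.map_comm]

theorem flipAct_flipAct (s t : H ⊗[k] H) (w : V ⊗[k] W) :
    flipAct σ ρ s (flipAct ρ σ t w) = act ρ σ (TensorProduct.comm k H H s * t) w := by
  simp only [flipAct, LinearMap.comp_apply, LinearEquiv.coe_coe]
  rw [comm_act, comm_comm_apply', map_mul]
  rfl

theorem hexagon_aux (t s : H ⊗[k] H) (x : V) (y : W) (z : U) :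
    TensorProduct.assoc k W U V (TensorProduct.comm k V (W ⊗[k] U)
      (act₃ ρ σ τ
        (Algebra.TensorProduct.map (AlgHom.id k H) Algebra.TensorProduct.includeRight t *
         Algebra.TensorProduct.map (AlgHom.id k H) Algebra.TensorProduct.includeLeft s)
        (x ⊗ₜ (y ⊗ₜ z)))) =
    (flipAct ρ τ t).lTensor W (TensorProduct.assoc k W V U
      (flipAct ρ σ s (x ⊗ₜ y) ⊗ₜ z)) := by
  induction t with
  | zero => simp [flipAct_zero]
  | add a b ha hb =>
    simp only [map_add, add_mul, LinearMap.add_apply, ha, hb, flipAct_add, LinearMap.lTensor_add]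
  | tmul a b =>
    induction s with
    | zero => simp [flipAct_zero]
    | add a b ha hb =>
      simp only [map_add, mul_add, LinearMap.add_apply, ha, hb, flipAct_add,
        TensorProduct.add_tmul]
    | tmul c d => simp

theorem hexagon_aux' (t s : H ⊗[k] H) (x : V) (y : W) (z : U) :
    (TensorProduct.assoc k U V W).symm (TensorProduct.comm k (V ⊗[k] W) U
      ((TensorProduct.assoc k V W U).symm (act₃ ρ σ τ
        (Algebra.TensorProduct.map (AlgHom.id k H) Algebra.TensorProduct.includeRight t *
         Algebra.TensorProduct.includeRight s)
        (x ⊗ₜ (y ⊗ₜ z))))) =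
    (flipAct ρ τ t).rTensor W ((TensorProduct.assoc k V U W).symm
      (x ⊗ₜ flipAct σ τ s (y ⊗ₜ z))) := by
  induction t with
  | zero => simp [flipAct_zero]
  | add a b ha hb =>
    simp only [map_add, add_mul, LinearMap.add_apply, ha, hb, flipAct_add, LinearMap.rTensor_add]
  | tmul a b =>
    induction s with
    | zero => simp [flipAct_zero]
    | add a b ha hb =>
      simp only [map_add, mul_add, LinearMap.add_apply, ha, hb, flipAct_add,
        TensorProduct.tmul_add]
    | tmul c d => simp

variable [QuasitriangularHopfAlgebra k H]

variable (k H) in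
/-- The `R`-matrix, as an element of `H ⊗ H`. -/
def Rm : H ⊗[k] H := (QuasitriangularHopfAlgebra.R : (H ⊗[k] H)ˣ)

variable (k H) in
/-- The inverse of the `R`-matrix, as an element of `H ⊗ H`. -/
def Rinv : H ⊗[k] H := ((QuasitriangularHopfAlgebra.R : (H ⊗[k] H)ˣ)⁻¹ : (H ⊗[k] H)ˣ)

variable (k H) in
/-- The Drinfeld element `u = m(S ⊗ id)σ(R)`. -/
noncomputable def drinfeld : H :=
  LinearMap.mul' k H ((HopfAlgebra.antipode k).rTensor H (TensorProduct.comm k H H (Rm k H)))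

theorem flipAct_tens (h : H) (w : V ⊗[k] W) :
    flipAct ρ σ (Rm k H) (tens ρ σ h w) = tens σ ρ h (flipAct ρ σ (Rm k H) w) := by
  have h1 : Rm k H * Coalgebra.comul (R := k) h =
      TensorProduct.comm k H H (Coalgebra.comul (R := k) h) * Rm k H :=
    QuasitriangularHopfAlgebra.R_comul h
  simp only [flipAct, LinearMap.comp_apply, LinearEquiv.coe_coe, tens_apply]
  rw [← Module.End.mul_apply, ← map_mul, h1, map_mul, Module.End.mul_apply, comm_act,
    comm_comm_apply']

/-- The braiding `v ⊗ w ↦ σ(R · (v ⊗ w))`. -/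
noncomputable def braid : V ⊗[k] W ≃ₗ[k] W ⊗[k] V where
  toLinearMap := flipAct ρ σ (Rm k H)
  invFun := fun w => act ρ σ (Rinv k H) (TensorProduct.comm k W V w)
  left_inv v := by
    simp only [flipAct, AddHom.toFun_eq_coe, LinearMap.coe_toAddHom, LinearMap.comp_apply,
      LinearEquiv.coe_coe, comm_comm_apply']
    rw [← Module.End.mul_apply, ← map_mul, Rinv, Rm, Units.inv_mul, map_one, Module.End.one_apply]
  right_inv v := by
    simp only [flipAct, AddHom.toFun_eq_coe, LinearMap.coe_toAddHom, LinearMap.comp_apply,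
      LinearEquiv.coe_coe]
    rw [← Module.End.mul_apply, ← map_mul, Rinv, Rm, Units.mul_inv, map_one, Module.End.one_apply,
      comm_comm_apply']

theorem contractLeft_braid (v : V) (f : Module.Dual k V) :
    contractLeft k V (braid ρ (dual ρ) (v ⊗ₜ f)) = f (ρ (drinfeld k H) v) := by
  have key : ∀ t : H ⊗[k] H, contractLeft k V (flipAct ρ (dual ρ) t (v ⊗ₜ f)) =
      f (ρ (LinearMap.mul' k H ((HopfAlgebra.antipode k).rTensor H
        (TensorProduct.comm k H H t))) v) := by
    intro t
    induction t with
    | zero => simp [flipAct_zero]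
    | add a b ha hb => simp only [map_add, LinearMap.add_apply, flipAct_add, ha, hb]
    | tmul a b => simp
  exact key _

theorem braid_apply (w : V ⊗[k] W) : braid ρ σ w = flipAct ρ σ (Rm k H) w := rfl

end

end HopfRep

/-! Structure maps of the braided Hopf algebra carried by `H`. -/

namespace HopfRep

section Coadjoint

variable {k H : Type u} [Field k] [Ring H] [HopfAlgebra k H]

variable (k H) in
/-- The linear map `a ⊗ b ↦ (x ↦ S(a) x b)`. -/
noncomputable def adj : H ⊗[k] H →ₗ[k] (H →ₗ[k] H) :=
  TensorProduct.lift (LinearMap.mk₂ k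
    (fun a b => LinearMap.mulLeft k (HopfAlgebra.antipode k a) ∘ₗ LinearMap.mulRight k b)
    (fun _ _ _ => by ext; simp [add_mul]) (fun _ _ _ => by ext; simp)
    (fun _ _ _ => by ext; simp [mul_add]) (fun _ _ _ => by ext; simp))

@[simp] theorem adj_tmul (a b x : H) :
    adj k H (a ⊗ₜ b) x = HopfAlgebra.antipode k a * (x * b) := rfl

theorem adj_mul (s t : H ⊗[k] H) : adj k H (s * t) = adj k H t ∘ₗ adj k H s := by
  induction s with
  | zero => simp
  | add a b ha hb => simp only [add_mul, map_add, ha, hb, LinearMap.comp_add]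
  | tmul a b =>
    induction t with
    | zero => simp
    | add a b ha hb => simp only [mul_add, map_add, ha, hb, LinearMap.add_comp]
    | tmul c d => ext x; simp [HopfAlgebra.antipode_mul_antidistrib, mul_assoc]

variable (k H) in
/-- The right action `x ◁ h = S(h₍₁₎) x h₍₂₎` of `H` on itself, as `h ↦ (x ↦ x ◁ h)`. -/
noncomputable def rightAdj : H →ₗ[k] (H →ₗ[k] H) := adj k H ∘ₗ Coalgebra.comul

variable (k H) in
/-- The coadjoint action `(h ▷ f)(x) = f(S(h₍₁₎) x h₍₂₎)`. -/
noncomputable def coadj : H →ₐ[k] Module.End k (Module.Dual k H) :=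
  AlgHom.ofLinearMap (Module.Dual.transpose (R := k) (M := H) (M' := H) ∘ₗ rightAdj k H)
    (by
      ext f x
      change f (adj k H (Coalgebra.comul (R := k) 1) x) = f x
      rw [Bialgebra.comul_one, Algebra.TensorProduct.one_def]
      simp)
    (fun a b => by
      ext f x
      change f (adj k H (Coalgebra.comul (R := k) (a * b)) x) =
        f (adj k H (Coalgebra.comul (R := k) b) (adj k H (Coalgebra.comul (R := k) a) x))
      rw [Bialgebra.comul_mul, adj_mul]
      rfl)

theorem coadj_apply (h x : H) (f : Module.Dual k H) :
    coadj k H h f x = f (adj k H (Coalgebra.comul (R := k) h) x) := rfl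

section
variable {V W : Type u} [AddCommGroup V] [Module k V] (ρ : H →ₐ[k] Module.End k V)
  [AddCommGroup W] [Module k W] (σ : H →ₐ[k] Module.End k W)

/-- The matrix coefficient map `l ⊗ m ↦ (x ↦ l(x m))`. -/
noncomputable def coeffMap : Module.Dual k V ⊗[k] V →ₗ[k] Module.Dual k H :=
  TensorProduct.lift (LinearMap.mk₂ k (fun l m => l ∘ₗ (ρ.toLinearMap.flip m))
    (fun _ _ _ => rfl) (fun _ _ _ => rfl)
    (fun _ _ _ => by ext; simp) (fun _ _ _ => by ext; simp))

@[simp] theorem coeffMap_tmul (l : Module.Dual k V) (m : V) (x : H) :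
    coeffMap ρ (l ⊗ₜ m) x = l (ρ x m) := rfl

theorem coeffMap_tens (h : H) (w : Module.Dual k V ⊗[k] V) :
    coeffMap ρ (tens (dual ρ) ρ h w) = coadj k H h (coeffMap ρ w) := by
  have key : ∀ (t : H ⊗[k] H) (x : H), coeffMap ρ (act (dual ρ) ρ t w) x =
      coeffMap ρ w (adj k H t x) := by
    intro t x
    induction t with
    | zero => simp
    | add a b ha hb => simp only [map_add, LinearMap.add_apply, ha, hb]
    | tmul a b =>
      induction w with
      | zero => simp
      | add a b ha hb => simp only [map_add, LinearMap.add_apply, ha, hb]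
      | tmul l m => simp
  ext x
  exact key _ x

/-- The action of `H ⊗ H` on `H ⊗ H` sending `a ⊗ b` to
`x ⊗ y ↦ y a ⊗ S(b₍₁₎) x b₍₂₎`. -/
noncomputable def braidedMap : H ⊗[k] H →ₗ[k] (H ⊗[k] H →ₗ[k] H ⊗[k] H) :=
  LinearMap.lcomp k (H ⊗[k] H) (TensorProduct.comm k H H).toLinearMap ∘ₗ
    TensorProduct.homTensorHomMap (RingHom.id k) H H H H ∘ₗ
      TensorProduct.map (LinearMap.mul k H).flip (rightAdj k H)

@[simp] theorem braidedMap_tmul (a b x y : H) :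
    braidedMap (k := k) (a ⊗ₜ b) (x ⊗ₜ y) = (y * a) ⊗ₜ rightAdj k H b x := rfl

theorem dualDistrib_braidedMap (t s : H ⊗[k] H)
    {V W : Type u} [AddCommGroup V] [Module k V] (ρ : H →ₐ[k] Module.End k V)
    [AddCommGroup W] [Module k W] (σ : H →ₐ[k] Module.End k W)
    (l : Module.Dual k V) (m : V) (w : Module.Dual k W ⊗[k] W)
    (F : (Module.Dual k W ⊗[k] W) ⊗[k] V →ₗ[k] k)
    (hF : ∀ w m, F (w ⊗ₜ m) =
      TensorProduct.dualDistrib k H H (coeffMap σ w ⊗ₜ coeffMap ρ (l ⊗ₜ m)) s) :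
    TensorProduct.dualDistrib k H H (coeffMap ρ (l ⊗ₜ m) ⊗ₜ coeffMap σ w) (braidedMap t s) =
      F (flipAct ρ (tens (dual σ) σ) t (m ⊗ₜ w)) := by
  induction t with
  | zero => simp [flipAct_zero]
  | add a b ha hb => simp only [map_add, LinearMap.add_apply, flipAct_add, ha, hb]
  | tmul a b =>
    rw [flipAct_tmul, hF, coeffMap_tens]
    clear hF
    induction s with
    | zero => simp
    | add a b ha hb => simp only [map_add, ha, hb]
    | tmul x y =>
      simp only [braidedMap_tmul, TensorProduct.dualDistrib_apply, coeffMap_tmul, map_mul,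
        coadj_apply, mul_comm (coeffMap σ w _)]
      rfl

end

section
variable [QuasitriangularHopfAlgebra k H]

variable (k H) in
/-- `x ↦ ∑ x₍₂₎ aᵢ ⊗ S(bᵢ₍₁₎) x₍₁₎ bᵢ₍₂₎` for `R = ∑ aᵢ ⊗ bᵢ`. -/
noncomputable def comulBd : H →ₗ[k] H ⊗[k] H := braidedMap (Rm k H) ∘ₗ Coalgebra.comul

end

section
variable [RibbonHopfAlgebra k H]

variable (k H) in
/-- The twist `θ ∈ H`, an invertible element. -/
def twistElt : Hˣ := RibbonHopfAlgebra.θ (k := k)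

theorem twistElt_central (x : H) : (twistElt k H : H) * x = x * (twistElt k H : H) :=
  RibbonHopfAlgebra.θ_central (k := k) x

theorem antipode_twistElt : HopfAlgebra.antipode k (twistElt k H : H) = twistElt k H :=
  RibbonHopfAlgebra.antipode_θ

variable (k H) in
/-- `x ↦ ∑ S(aᵢ) θ² S(x) u bᵢ` for `R = ∑ aᵢ ⊗ bᵢ`. -/
noncomputable def antipodeBd : H →ₗ[k] H :=
  adj k H (Rm k H) ∘ₗ LinearMap.mulLeft k ((twistElt k H : H) ^ 2) ∘ₗ
    LinearMap.mulRight k (drinfeld k H) ∘ₗ HopfAlgebra.antipode k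

/-- The action of the twist on a module. -/
noncomputable def twistEquiv {V : Type u} [AddCommGroup V] [Module k V]
    (ρ : H →ₐ[k] Module.End k V) : V ≃ₗ[k] V where
  toLinearMap := ρ (twistElt k H : H)
  invFun := ρ ((twistElt k H)⁻¹ : Hˣ)
  left_inv v := by
    change (ρ _ * ρ _) v = v
    rw [← map_mul, Units.inv_mul, map_one, Module.End.one_apply]
  right_inv v := by
    change (ρ _ * ρ _) v = v
    rw [← map_mul, Units.mul_inv, map_one, Module.End.one_apply]

theorem twist_tens {V W : Type u} [AddCommGroup V] [Module k V] [AddCommGroup W] [Module k W]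
    (ρ : H →ₐ[k] Module.End k V) (σ : H →ₐ[k] Module.End k W) (w : V ⊗[k] W) :
    tens ρ σ (twistElt k H : H) w = flipAct σ ρ (Rm k H) (flipAct ρ σ (Rm k H)
      (act ρ σ ((twistElt k H : H) ⊗ₜ (twistElt k H : H)) w)) := by
  have hc : ∀ t : H ⊗[k] H, ((twistElt k H : H) ⊗ₜ[k] (twistElt k H : H)) * t =
      t * ((twistElt k H : H) ⊗ₜ[k] (twistElt k H : H)) := by
    intro t
    induction t with
    | zero => simp
    | add a b ha hb => rw [mul_add, add_mul, ha, hb]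
    | tmul a b => simp only [Algebra.TensorProduct.tmul_mul_tmul, twistElt_central]
  have h : Coalgebra.comul (R := k) (twistElt k H : H) =
      TensorProduct.comm k H H (Rm k H) * Rm k H *
        ((twistElt k H : H) ⊗ₜ[k] (twistElt k H : H)) := by
    rw [← hc, ← mul_assoc]
    exact RibbonHopfAlgebra.comul_θ
  rw [flipAct_flipAct, ← Module.End.mul_apply, ← map_mul, ← h, tens_apply]

end

section
variable [FiniteDimensional k H]

variable (k H) in
/-- The comultiplication of `H*`, dual to the multiplication of `H`. -/
noncomputable def dualComul : Module.Dual k H →ₗ[k] Module.Dual k H ⊗[k] Module.Dual k H :=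
  (TensorProduct.dualDistribEquiv k H H).symm.toLinearMap ∘ₗ (LinearMap.mul' k H).dualMap

theorem dualDistrib_injective {s t : Module.Dual k H ⊗[k] Module.Dual k H}
    (h : ∀ x y : H, TensorProduct.dualDistrib k H H s (x ⊗ₜ y) =
      TensorProduct.dualDistrib k H H t (x ⊗ₜ y)) : s = t :=
  (TensorProduct.dualDistribEquiv k H H).injective (TensorProduct.ext' h)

theorem dualDistrib_dualComul (f : Module.Dual k H) (x y : H) :
    TensorProduct.dualDistrib k H H (dualComul k H f) (x ⊗ₜ y) = f (x * y) := by
  have h := (TensorProduct.dualDistribEquiv k H H).apply_symm_apply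
    ((LinearMap.mul' k H).dualMap f)
  exact LinearMap.congr_fun h (x ⊗ₜ y)

theorem dualComul_coeffMap {V : Type u} [AddCommGroup V] [Module k V] [FiniteDimensional k V]
    (ρ : H →ₐ[k] Module.End k V) (l : Module.Dual k V) (v : V) :
    dualComul k H (coeffMap ρ (l ⊗ₜ v)) = TensorProduct.map (coeffMap ρ) (coeffMap ρ)
      ((TensorProduct.assoc k _ _ _).symm (l ⊗ₜ
        (TensorProduct.assoc k _ _ _ (coevaluation k V 1 ⊗ₜ v)))) := by
  refine dualDistrib_injective fun x y => ?_
  have key : ∀ w : V ⊗[k] Module.Dual k V,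
      TensorProduct.dualDistrib k H H (TensorProduct.map (coeffMap ρ) (coeffMap ρ)
        ((TensorProduct.assoc k _ _ _).symm (l ⊗ₜ (TensorProduct.assoc k _ _ _ (w ⊗ₜ v)))))
        (x ⊗ₜ y) =
      l (ρ x (dualTensorHom k V V (TensorProduct.comm k _ _ w) (ρ y v))) := by
    intro w
    induction w with
    | zero => simp
    | add a b ha hb => 
      simp only [map_add, TensorProduct.add_tmul, TensorProduct.tmul_add, LinearMap.add_apply,
        ha, hb]
    | tmul a b => simp [mul_comm]
  rw [key, coevaluation_id, dualDistrib_dualComul, coeffMap_tmul, map_mul]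
  rfl

end

section
variable [QuasitriangularHopfAlgebra k H]

variable (k H) in
/-- The multiplication of `H*`, dual to `comulBd`. -/
noncomputable def dualMul : Module.Dual k H ⊗[k] Module.Dual k H →ₗ[k] Module.Dual k H :=
  (comulBd k H).dualMap ∘ₗ TensorProduct.dualDistrib k H H

theorem dualMul_apply (t : Module.Dual k H ⊗[k] Module.Dual k H) (x : H) :
    dualMul k H t x =
      TensorProduct.dualDistrib k H H t (braidedMap (Rm k H) (Coalgebra.comul (R := k) x)) := rfl

end

section
variable [RibbonHopfAlgebra k H]

variable (k H) in
/-- The antipode of the braided Hopf algebra `H*`, dual to `antipodeBd`. -/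
noncomputable def dualAntipode : Module.Dual k H →ₗ[k] Module.Dual k H := (antipodeBd k H).dualMap

theorem dualAntipode_coeffMap {V : Type u} [AddCommGroup V] [Module k V]
    (ρ : H →ₐ[k] Module.End k V) (l : Module.Dual k V) (v : V) (x : H)
    (F : V ⊗[k] Module.Dual k V →ₗ[k] k)
    (hF : ∀ v l, F (v ⊗ₜ l) = l (ρ (HopfAlgebra.antipode k x * (drinfeld k H *
      (twistElt k H : H))) v)) :
    dualAntipode k H (coeffMap ρ (l ⊗ₜ v)) x =
      F ((dual ρ (twistElt k H : H)).lTensor V (flipAct (dual ρ) ρ (Rm k H) (l ⊗ₜ v))) := by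
  have key : ∀ t : H ⊗[k] H, l (ρ (adj k H t ((twistElt k H : H) ^ 2 *
      (HopfAlgebra.antipode k x * drinfeld k H))) v) =
      F ((dual ρ (twistElt k H : H)).lTensor V (flipAct (dual ρ) ρ t (l ⊗ₜ v))) := by
    intro t
    induction t with
    | zero => simp [flipAct_zero]
    | add a b ha hb => 
      simp only [map_add, LinearMap.add_apply, flipAct_add, ha, hb]
    | tmul a b => 
      rw [flipAct_tmul, LinearMap.lTensor_tmul, hF]
      have h : HopfAlgebra.antipode k a * ((twistElt k H : H) ^ 2 *
          (HopfAlgebra.antipode k x * drinfeld k H) * b) =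
        HopfAlgebra.antipode k a * (twistElt k H : H) * (HopfAlgebra.antipode k x *
          (drinfeld k H * (twistElt k H : H)) * b) := by
        rw [← twistElt_central (drinfeld k H), ← mul_assoc (HopfAlgebra.antipode k x),
          ← twistElt_central (HopfAlgebra.antipode k x), pow_two]
        simp only [mul_assoc]
      rw [dual_apply, dual_apply, antipode_twistElt, ← Module.End.mul_apply,
        ← Module.End.mul_apply, ← Module.End.mul_apply, ← map_mul, ← map_mul, ← map_mul, adj_tmul,
        h]
      simp only [mul_assoc]
  exact key _

end

end Coadjoint

end HopfRep

/-- Finite-dimensional left `H`-modules. -/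
structure HRep (k H : Type u) [Field k] [Ring H] [HopfAlgebra k H] where
  V : Type u
  [addCommGroup : AddCommGroup V]
  [module : Module k V]
  [finite : FiniteDimensional k V]
  ρ : H →ₐ[k] Module.End k V

namespace HRep

attribute [instance] HRep.addCommGroup HRep.module HRep.finite

section Category

variable {k H : Type u} [Field k] [Ring H] [HopfAlgebra k H]

/-- `H`-linear maps. -/
@[ext] structure Hom (X Y : HRep k H) where
  lin : X.V →ₗ[k] Y.V
  comm : ∀ (h : H) (v : X.V), lin (X.ρ h v) = Y.ρ h (lin v)

instance : Category (HRep k H) where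
  Hom X Y := Hom X Y
  id X := ⟨LinearMap.id, fun _ _ => rfl⟩
  comp f g := ⟨g.lin ∘ₗ f.lin, fun h v => by simp [f.comm, g.comm]⟩

theorem hom_ext {X Y : HRep k H} {f g : X ⟶ Y} (h : f.lin = g.lin) : f = g := Hom.ext h

@[simp] theorem id_lin (X : HRep k H) : (𝟙 X : X ⟶ X).lin = LinearMap.id := rfl

@[simp] theorem comp_lin {X Y Z : HRep k H} (f : X ⟶ Y) (g : Y ⟶ Z) :
    (f ≫ g).lin = g.lin ∘ₗ f.lin := rfl

instance (X Y : HRep k H) : Add (X ⟶ Y) :=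
  ⟨fun f g => ⟨f.lin + g.lin, fun h v => by simp [f.comm, g.comm]⟩⟩
instance (X Y : HRep k H) : Zero (X ⟶ Y) := ⟨⟨0, fun h v => by simp⟩⟩
instance (X Y : HRep k H) : Neg (X ⟶ Y) :=
  ⟨fun f => ⟨-f.lin, fun h v => by simp [f.comm]⟩⟩
instance (X Y : HRep k H) : Sub (X ⟶ Y) :=
  ⟨fun f g => ⟨f.lin - g.lin, fun h v => by simp [f.comm, g.comm]⟩⟩
instance (X Y : HRep k H) : SMul k (X ⟶ Y) :=
  ⟨fun c f => ⟨c • f.lin, fun h v => by simp [f.comm]⟩⟩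

@[simp] theorem add_lin {X Y : HRep k H} (f g : X ⟶ Y) : (f + g).lin = f.lin + g.lin := rfl
@[simp] theorem zero_lin {X Y : HRep k H} : (0 : X ⟶ Y).lin = 0 := rfl
@[simp] theorem neg_lin {X Y : HRep k H} (f : X ⟶ Y) : (-f).lin = -f.lin := rfl
@[simp] theorem sub_lin {X Y : HRep k H} (f g : X ⟶ Y) : (f - g).lin = f.lin - g.lin := rfl
@[simp] theorem smul_lin {X Y : HRep k H} (c : k) (f : X ⟶ Y) : (c • f).lin = c • f.lin := rfl

instance instAddCommGroupHom (X Y : HRep k H) : AddCommGroup (X ⟶ Y) where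
  add_assoc _ _ _ := hom_ext (add_assoc _ _ _)
  zero_add _ := hom_ext (zero_add _)
  add_zero _ := hom_ext (add_zero _)
  add_comm _ _ := hom_ext (add_comm _ _)
  neg_add_cancel _ := hom_ext (neg_add_cancel _)
  sub_eq_add_neg _ _ := hom_ext (sub_eq_add_neg _ _)
  nsmul := nsmulRec
  zsmul := zsmulRec

instance : Preadditive (HRep k H) where
  add_comp _ _ _ _ _ _ := hom_ext (LinearMap.comp_add _ _ _)
  comp_add _ _ _ _ _ _ := hom_ext (LinearMap.add_comp _ _ _)

instance (X Y : HRep k H) : Module k (X ⟶ Y) where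
  one_smul _ := hom_ext (one_smul _ _)
  mul_smul _ _ _ := hom_ext (mul_smul _ _ _)
  smul_zero _ := hom_ext (smul_zero _)
  smul_add _ _ _ := hom_ext (smul_add _ _ _)
  add_smul _ _ _ := hom_ext (add_smul _ _ _)
  zero_smul _ := hom_ext (zero_smul _ _)

instance : Linear k (HRep k H) where
  smul_comp _ _ _ _ _ _ := hom_ext (LinearMap.comp_smul _ _ _)
  comp_smul _ _ _ _ _ _ := hom_ext (LinearMap.smul_comp _ _ _)

/-- Tensor product of modules. -/
noncomputable def tensor (X Y : HRep k H) : HRep k H where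
  V := X.V ⊗[k] Y.V
  ρ := HopfRep.tens X.ρ Y.ρ

/-- The unit object `k`. -/
noncomputable def unit : HRep k H where
  V := k
  ρ := HopfRep.triv k H

/-- The dual module. -/
noncomputable def dual (X : HRep k H) : HRep k H where
  V := Module.Dual k X.V
  ρ := HopfRep.dual X.ρ

/-- Isomorphism from a linear equivalence commuting with the actions. -/
def mkIso {X Y : HRep k H} (e : X.V ≃ₗ[k] Y.V) (h : ∀ a v, e (X.ρ a v) = Y.ρ a (e v)) :
    X ≅ Y where
  hom := ⟨e, h⟩
  inv := ⟨e.symm, fun a v => by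
    apply e.injective
    simp [h]⟩
  hom_inv_id := hom_ext (by ext; simp)
  inv_hom_id := hom_ext (by ext; simp)

noncomputable instance : MonoidalCategoryStruct (HRep k H) where
  tensorObj X Y := X.tensor Y
  whiskerLeft X {_ _} f := ⟨f.lin.lTensor X.V, fun _ v =>
    HopfRep.map_act (f := LinearMap.id) (fun _ _ => rfl) f.comm _ v⟩
  whiskerRight {_ _} f X := ⟨f.lin.rTensor X.V, fun _ v =>
    HopfRep.map_act (g := LinearMap.id) f.comm (fun _ _ => rfl) _ v⟩
  tensorHom f g := ⟨TensorProduct.map f.lin g.lin, fun _ v => HopfRep.map_act f.comm g.comm _ v⟩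
  tensorUnit := unit
  associator X Y Z := mkIso (X := (X.tensor Y).tensor Z) (Y := X.tensor (Y.tensor Z))
    (TensorProduct.assoc k X.V Y.V Z.V) fun h v => HopfRep.assoc_tens X.ρ Y.ρ Z.ρ h v
  leftUnitor X := mkIso (X := unit.tensor X) (TensorProduct.lid k X.V) fun h v =>
    HopfRep.lid_tens X.ρ h v
  rightUnitor X := mkIso (X := X.tensor unit) (TensorProduct.rid k X.V) fun h v =>
    HopfRep.rid_tens X.ρ h v

theorem tensorHom_lin {X Y X' Y' : HRep k H} (f : X ⟶ X') (g : Y ⟶ Y') :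
    (f ⊗ₘ g).lin = TensorProduct.map f.lin g.lin := rfl
theorem whiskerLeft_lin (X : HRep k H) {Y Y' : HRep k H} (f : Y ⟶ Y') :
    (X ◁ f).lin = f.lin.lTensor X.V := rfl
theorem whiskerRight_lin {Y Y' : HRep k H} (f : Y ⟶ Y') (X : HRep k H) :
    (f ▷ X).lin = f.lin.rTensor X.V := rfl

noncomputable instance : MonoidalCategory (HRep k H) where
  tensorHom_def _ _ := hom_ext (TensorProduct.ext' fun _ _ => rfl)
  id_tensorHom_id _ _ := hom_ext (TensorProduct.ext' fun _ _ => rfl)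
  tensorHom_comp_tensorHom _ _ _ _ := hom_ext (TensorProduct.ext' fun _ _ => rfl)
  whiskerLeft_id _ _ := hom_ext (TensorProduct.ext' fun _ _ => rfl)
  id_whiskerRight _ _ := hom_ext (TensorProduct.ext' fun _ _ => rfl)
  associator_naturality _ _ _ := hom_ext (TensorProduct.ext_threefold fun _ _ _ => rfl)
  leftUnitor_naturality f := hom_ext (TensorProduct.ext' fun c v => (f.lin.map_smul c v).symm)
  rightUnitor_naturality f := hom_ext (TensorProduct.ext' fun v c => (f.lin.map_smul c v).symm)
  pentagon _ _ _ _ := hom_ext (TensorProduct.ext_fourfold fun _ _ _ _ => rfl)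
  triangle _ _ := hom_ext (TensorProduct.ext_threefold fun x (c : k) y =>
    (TensorProduct.smul_tmul c x y).symm)

noncomputable instance : MonoidalPreadditive (HRep k H) where
  whiskerLeft_zero := hom_ext (TensorProduct.ext' fun _ _ => TensorProduct.tmul_zero _ _)
  zero_whiskerRight := hom_ext (TensorProduct.ext' fun _ _ => TensorProduct.zero_tmul _ _)
  whiskerLeft_add _ _ := hom_ext (TensorProduct.ext' fun _ _ => TensorProduct.tmul_add _ _ _)
  add_whiskerRight _ _ := hom_ext (TensorProduct.ext' fun _ _ => TensorProduct.add_tmul _ _ _)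

noncomputable instance : MonoidalLinear k (HRep k H) where
  whiskerLeft_smul _ _ _ _ _ := hom_ext (TensorProduct.ext' fun _ _ => TensorProduct.tmul_smul _ _ _)
  smul_whiskerRight _ _ _ _ _ := hom_ext (TensorProduct.ext' fun _ _ => rfl)

noncomputable instance (X : HRep k H) : ExactPairing X X.dual where
  coevaluation' := ⟨coevaluation k X.V, fun h c => (HopfRep.tens_coevaluation X.ρ h c).symm⟩
  evaluation' := ⟨contractLeft k X.V, fun h w => HopfRep.contractLeft_tens X.ρ h w⟩
  coevaluation_evaluation' := hom_ext (contractLeft_assoc_coevaluation k X.V)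
  evaluation_coevaluation' := hom_ext (contractLeft_assoc_coevaluation' k X.V)

noncomputable instance : RightRigidCategory (HRep k H) where
  rightDual X := { rightDual := X.dual }

variable [QuasitriangularHopfAlgebra k H]

/-- The braiding. -/
noncomputable instance : BraidedCategory (HRep k H) where
  braiding X Y := mkIso (X := X.tensor Y) (Y := Y.tensor X) (HopfRep.braid X.ρ Y.ρ)
    fun h v => HopfRep.flipAct_tens X.ρ Y.ρ h v
  braiding_naturality_right X _ _ f := hom_ext (LinearMap.ext fun v =>
    HopfRep.flipAct_map (f := LinearMap.id) (fun _ _ => rfl) f.comm _ v)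
  braiding_naturality_left f Z := hom_ext (LinearMap.ext fun v =>
    HopfRep.flipAct_map (g := LinearMap.id) f.comm (fun _ _ => rfl) _ v)
  hexagon_forward X Y Z := hom_ext (TensorProduct.ext_threefold fun x y z => by
    refine Eq.trans ?_ (HopfRep.hexagon_aux X.ρ Y.ρ Z.ρ (HopfRep.Rm k H) (HopfRep.Rm k H) x y z)
    rw [HopfRep.Rm, ← QuasitriangularHopfAlgebra.id_comul_R, ← HopfRep.act_tens_right]
    rfl)
  hexagon_reverse X Y Z := hom_ext (TensorProduct.ext_threefold' fun x y z => by
    refine Eq.trans ?_ (HopfRep.hexagon_aux' X.ρ Y.ρ Z.ρ (HopfRep.Rm k H) (HopfRep.Rm k H) x y z)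
    rw [HopfRep.Rm, ← QuasitriangularHopfAlgebra.comul_id_R,
      ← TensorProduct.assoc_tmul (R := k) x y z, ← HopfRep.act_tens_left,
      LinearEquiv.symm_apply_apply]
    rfl)

end Category

section Ribbon

open RibbonCategory ExactPairing

variable {k H : Type u} [Field k] [Ring H] [HopfAlgebra k H]

theorem adjoint_lin {P Q : HRep k H} (f : P ⊗ Q ⟶ 𝟙_ (HRep k H)) (p : P.V) (q : Q.V) :
    (show Module.Dual k Q.V from (adjoint f).lin p) q = f.lin (p ⊗ₜ[k] q) :=
  LinearMap.congr_fun (congrArg Hom.lin (adjoint_eval f)) (p ⊗ₜ[k] q)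

theorem dualTensorPairing_lin (X Y : HRep k H) (l : Module.Dual k X.V) (l' : Module.Dual k Y.V)
    (y : Y.V) (x : X.V) :
    (dualTensorPairing X Y).lin ((l ⊗ₜ[k] l') ⊗ₜ[k] (y ⊗ₜ[k] x)) = l' y * l x := by
  simp only [dualTensorPairing, comp_lin]
  exact l.map_smul (l' y) x

theorem dualTensor_lin (X Y : HRep k H) (l : Module.Dual k X.V) (l' : Module.Dual k Y.V)
    (y : Y.V) (x : X.V) :
    (show Module.Dual k (Y.V ⊗[k] X.V) from (dualTensor X Y).lin (l ⊗ₜ[k] l')) (y ⊗ₜ x) =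
      l' y * l x :=
  (adjoint_lin (dualTensorPairing X Y) (l ⊗ₜ[k] l') (y ⊗ₜ[k] x)).trans
    (dualTensorPairing_lin X Y l l' y x)

theorem mate_lin {X Y : HRep k H} (f : X ⟶ Y) (l : Module.Dual k Y.V) (v : X.V) :
    (show Module.Dual k X.V from (rightAdjointMate f).lin l) v = l (f.lin v) :=
  LinearMap.congr_fun (congrArg Hom.lin (rightAdjointMate_comp_evaluation f)) (l ⊗ₜ[k] v)

/-- A linear map whose composite with a surjective morphism is a morphism is itself one. -/
def homOfSurjective {X Y Z : HRep k H} (p : X ⟶ Y) (hp : Function.Surjective p.lin) (q : X ⟶ Z)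
    (r : Y.V →ₗ[k] Z.V) (hr : ∀ x, r (p.lin x) = q.lin x) : Y ⟶ Z :=
  ⟨r, fun h y => by
    obtain ⟨x, rfl⟩ := hp y
    rw [← p.comm, hr, q.comm, hr]⟩

section Coend

variable [FiniteDimensional k H]

variable (k H) in
/-- The coadjoint module `H*`. -/
noncomputable def coadjoint : HRep k H where
  V := Module.Dual k H
  ρ := HopfRep.coadj k H

variable (k H) in
/-- The left regular module `H`. -/
noncomputable def regular : HRep k H where
  V := H
  ρ := Algebra.lmul k H

/-- `i_X : l ⊗ m ↦ (x ↦ l(x m))`. -/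
noncomputable def coendMap (X : HRep k H) : Xᘁ ⊗ X ⟶ coadjoint k H where
  lin := HopfRep.coeffMap X.ρ
  comm h w := HopfRep.coeffMap_tens X.ρ h w

theorem coendMap_regular (f : Module.Dual k H) :
    (coendMap (regular k H)).lin (f ⊗ₜ[k] (1 : H)) = f := by
  refine LinearMap.ext fun x => ?_
  change f (x * 1) = f x
  rw [mul_one]

theorem coendMap_regular_surjective :
    Function.Surjective (coendMap (regular k H)).lin :=
  fun f => ⟨_, coendMap_regular f⟩

/-- Right multiplication by `v ∈ X`, a morphism from the regular module. -/
noncomputable def orbit {X : HRep k H} (v : X.V) : regular k H ⟶ X :=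
  ⟨X.ρ.toLinearMap.flip v, fun h (x : H) => by
    change X.ρ (h * x) v = X.ρ h (X.ρ x v)
    rw [map_mul]
    rfl⟩

theorem cowedge_π (s : Limits.Cowedge (dualTensorFunctor (HRep k H))) (X : HRep k H)
    (w : Module.Dual k X.V ⊗[k] X.V) :
    (s.π (regular k H)).lin (HopfRep.coeffMap X.ρ w ⊗ₜ[k] (1 : H)) = (s.π X).lin w := by
  have key : ∀ (A : Module.Dual k H ⊗[k] H →ₗ[k] s.pt.V)
      (B : Module.Dual k X.V ⊗[k] X.V →ₗ[k] s.pt.V),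
      (∀ l m, A (HopfRep.coeffMap X.ρ (l ⊗ₜ m) ⊗ₜ[k] (1 : H)) = B (l ⊗ₜ m)) →
      A (HopfRep.coeffMap X.ρ w ⊗ₜ[k] (1 : H)) = B w := fun A B h =>
    LinearMap.congr_fun (f := A ∘ₗ (TensorProduct.mk k (Module.Dual k H) H).flip 1 ∘ₗ
      HopfRep.coeffMap X.ρ) (TensorProduct.ext' h) w
  refine key _ _ fun l m => ?_
  have h := LinearMap.congr_fun (congrArg Hom.lin (s.condition (orbit m))) (l ⊗ₜ[k] (1 : H))
  have h1 : (rightAdjointMate (orbit m)).lin l = HopfRep.coeffMap X.ρ (l ⊗ₜ m) :=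
    LinearMap.ext fun x => mate_lin (orbit m) l x
  have h2 : (orbit m).lin (1 : H) = m := by
    change X.ρ 1 m = m
    rw [map_one, Module.End.one_apply]
  change (s.π (regular k H)).lin ((rightAdjointMate (orbit m)).lin l ⊗ₜ[k] (1 : H)) =
    (s.π X).lin (l ⊗ₜ[k] (orbit m).lin (1 : H)) at h
  rwa [h1, h2] at h

variable (k H) in
/-- The coadjoint module `H*` with the maps `i_X` is a coend. -/
noncomputable def dualCoend : DualCoend (HRep k H) where
  cowedge := Limits.Cowedge.mk (coadjoint k H) (fun X => coendMap X) (fun X Y f =>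
    hom_ext (TensorProduct.ext' fun l v => by
      refine LinearMap.ext fun x => ?_
      refine (mate_lin f l (X.ρ x v)).trans ?_
      rw [f.comm]
      rfl))
  isColimit := Limits.Multicofork.IsColimit.mk _
    (fun s => homOfSurjective (coendMap (regular k H)) coendMap_regular_surjective
      (s.π (regular k H)) ((s.π (regular k H)).lin ∘ₗ
        (TensorProduct.mk k (Module.Dual k H) H).flip 1) (fun w => cowedge_π s (regular k H) w))
    (fun s X => hom_ext (LinearMap.ext fun w => cowedge_π s X w))
    (fun s m hm => hom_ext (LinearMap.ext fun (f : Module.Dual k H) => by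
      have h := LinearMap.congr_fun (congrArg Hom.lin (hm (regular k H))) (f ⊗ₜ[k] (1 : H))
      refine Eq.trans ?_ h
      exact congrArg m.lin (coendMap_regular f).symm))

theorem dualComul_rel (X : HRep k H) (w : Module.Dual k X.V ⊗[k] X.V) :
    HopfRep.dualComul k H ((coendMap X).lin w) =
      (comulAux X ≫ (coendMap X ⊗ₘ coendMap X)).lin w := by
  have key : HopfRep.dualComul k H ∘ₗ (coendMap X).lin =
      (comulAux X ≫ (coendMap X ⊗ₘ coendMap X)).lin :=
    TensorProduct.ext' fun l v => HopfRep.dualComul_coeffMap X.ρ l v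
  exact LinearMap.congr_fun key w

variable (k H) in
/-- The comultiplication `Δ_A`. -/
noncomputable def comulHom : coadjoint k H ⟶ coadjoint k H ⊗ coadjoint k H :=
  homOfSurjective (coendMap (regular k H)) coendMap_regular_surjective _ (HopfRep.dualComul k H)
    (dualComul_rel (regular k H))

theorem tensor_coendMap_surjective :
    Function.Surjective (coendMap (regular k H) ⊗ₘ coendMap (regular k H)).lin :=
  TensorProduct.map_surjective coendMap_regular_surjective coendMap_regular_surjective

end Coend

variable [RibbonHopfAlgebra k H]

/-- The twist: multiplication by `θ`. -/
noncomputable instance : RibbonCategory (HRep k H) where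
  twist X := mkIso (HopfRep.twistEquiv X.ρ) fun h v => by
    change (X.ρ _ * X.ρ _) v = (X.ρ _ * X.ρ _) v
    rw [← map_mul, ← map_mul, HopfRep.twistElt_central]
  twist_naturality f := hom_ext (LinearMap.ext fun v => (f.comm _ v).symm)
  twist_dual X := hom_ext (LinearMap.ext_ring (by
    refine (HopfRep.map_coevaluation (X.ρ (HopfRep.twistElt k H : H))).trans ?_
    have : Module.Dual.transpose (R := k) (X.ρ (HopfRep.twistElt k H : H)) =
        HopfRep.dual X.ρ (HopfRep.twistElt k H : H) := by
      ext f v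
      rw [HopfRep.dual_apply, HopfRep.antipode_twistElt]
      rfl
    rw [this]
    rfl))
  twist_tensor X Y := hom_ext (TensorProduct.ext' fun v w =>
    HopfRep.twist_tens X.ρ Y.ρ (v ⊗ₜ w))

theorem bidual_lin (X : HRep k H) (v : X.V) (l : Module.Dual k X.V) :
    (show Module.Dual k (Module.Dual k X.V) from (bidual X).lin v) l =
      l (X.ρ (HopfRep.drinfeld k H * (HopfRep.twistElt k H : H)) v) := by
  refine (adjoint_lin (evTilde X) v l).trans ?_
  refine (HopfRep.contractLeft_braid X.ρ (X.ρ (HopfRep.twistElt k H : H) v) l).trans ?_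
  rw [map_mul]
  rfl

section CoendData

variable [FiniteDimensional k H]

theorem mulAux_lin (X Y : HRep k H) (l : Module.Dual k X.V) (m : X.V)
    (w : Module.Dual k Y.V ⊗[k] Y.V) (x : H) :
    HopfRep.dualMul k H ((coendMap X).lin (l ⊗ₜ[k] m) ⊗ₜ[k] (coendMap Y).lin w) x =
      (show Module.Dual k H from (mulAux X Y ≫ coendMap (Y ⊗ X)).lin ((l ⊗ₜ[k] m) ⊗ₜ[k] w)) x := by
  let G : Module.Dual k X.V ⊗[k] ((Module.Dual k Y.V ⊗[k] Y.V) ⊗[k] X.V) →ₗ[k]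
      Module.Dual k H :=
    (Xᘁ ◁ (α_ Yᘁ Y X).hom ≫ (α_ Xᘁ Yᘁ (Y ⊗ X)).inv ≫ dualTensor X Y ▷ (Y ⊗ X) ≫
      coendMap (Y ⊗ X)).lin
  let F : (Module.Dual k Y.V ⊗[k] Y.V) ⊗[k] X.V →ₗ[k] k :=
    (LinearMap.applyₗ x ∘ₗ G) ∘ₗ (TensorProduct.mk k _ _ l)
  refine (HopfRep.dualDistrib_braidedMap (HopfRep.Rm k H) (Coalgebra.comul (R := k) x) X.ρ Y.ρ
    l m w F ?_).trans ?_
  · intro w m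
    induction w with
    | zero => rw [TensorProduct.zero_tmul, map_zero, map_zero, TensorProduct.zero_tmul, map_zero,
        LinearMap.zero_apply]
    | add a b ha hb =>
      rw [TensorProduct.add_tmul, map_add, ha, hb, map_add, TensorProduct.add_tmul, map_add,
        LinearMap.add_apply]
    | tmul l' y =>
      have key : ∀ t : H ⊗[k] H,
          (show Module.Dual k (Y.V ⊗[k] X.V) from (dualTensor X Y).lin (l ⊗ₜ[k] l'))
            (HopfRep.act Y.ρ X.ρ t (y ⊗ₜ m)) =
          TensorProduct.dualDistrib k H H (HopfRep.coeffMap Y.ρ (l' ⊗ₜ y) ⊗ₜ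
            HopfRep.coeffMap X.ρ (l ⊗ₜ m)) t := by
        intro t
        induction t with
        | zero => rw [map_zero, map_zero, LinearMap.zero_apply, map_zero]
        | add a b ha hb => rw [map_add, map_add, LinearMap.add_apply, map_add, ha, hb]
        | tmul a b => exact dualTensor_lin X Y l l' (Y.ρ a y) (X.ρ b m)
      exact key _
  · rfl

theorem dualMul_rel (X Y : HRep k H)
    (w : (Module.Dual k X.V ⊗[k] X.V) ⊗[k] (Module.Dual k Y.V ⊗[k] Y.V)) :
    HopfRep.dualMul k H ((coendMap X ⊗ₘ coendMap Y).lin w) =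
      (mulAux X Y ≫ coendMap (Y ⊗ X)).lin w := by
  have key : HopfRep.dualMul k H ∘ₗ (coendMap X ⊗ₘ coendMap Y).lin =
      (mulAux X Y ≫ coendMap (Y ⊗ X)).lin :=
    TensorProduct.ext (TensorProduct.ext' fun l m => LinearMap.ext fun w =>
      LinearMap.ext fun x => mulAux_lin X Y l m w x)
  exact LinearMap.congr_fun key w

variable (k H) in
/-- The multiplication `m_A`. -/
noncomputable def mulHom : coadjoint k H ⊗ coadjoint k H ⟶ coadjoint k H :=
  homOfSurjective (coendMap (regular k H) ⊗ₘ coendMap (regular k H)) tensor_coendMap_surjective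
    _ (HopfRep.dualMul k H) (dualMul_rel (regular k H) (regular k H))

theorem dualAntipode_rel (X : HRep k H) (w : Module.Dual k X.V ⊗[k] X.V) :
    HopfRep.dualAntipode k H ((coendMap X).lin w) =
      (antipodeAux X ≫ coendMap Xᘁ).lin w := by
  have key : HopfRep.dualAntipode k H ∘ₗ (coendMap X).lin =
      (antipodeAux X ≫ coendMap Xᘁ).lin :=
    TensorProduct.ext' fun l v => LinearMap.ext fun x => by
      let G : X.V ⊗[k] Module.Dual k X.V →ₗ[k] Module.Dual k H :=
        (bidual X ▷ Xᘁ ≫ coendMap Xᘁ).lin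
      let F : X.V ⊗[k] Module.Dual k X.V →ₗ[k] k := LinearMap.applyₗ x ∘ₗ G
      refine (HopfRep.dualAntipode_coeffMap X.ρ l v x F ?_).trans ?_
      · intro v l
        refine (bidual_lin X v (HopfRep.dual X.ρ x l)).trans ?_
        rw [HopfRep.dual_apply, ← Module.End.mul_apply, ← map_mul]
      · rfl
  exact LinearMap.congr_fun key w

variable (k H) in
/-- The antipode `S_A`. -/
noncomputable def antipodeHom : coadjoint k H ⟶ coadjoint k H :=
  homOfSurjective (coendMap (regular k H)) coendMap_regular_surjective _
    (HopfRep.dualAntipode k H) (dualAntipode_rel (regular k H))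

theorem thetaPos_rel (X : HRep k H) (w : Module.Dual k X.V ⊗[k] X.V) :
    Module.Dual.eval k H (HopfRep.twistElt k H : H) ((coendMap X).lin w) =
      (Xᘁ ◁ (twist X).hom ≫ ε_ X Xᘁ).lin w := by
  have key : Module.Dual.eval k H (HopfRep.twistElt k H : H) ∘ₗ (coendMap X).lin =
      (Xᘁ ◁ (twist X).hom ≫ ε_ X Xᘁ).lin := TensorProduct.ext' fun _ _ => rfl
  exact LinearMap.congr_fun key w

theorem thetaNeg_rel (X : HRep k H) (w : Module.Dual k X.V ⊗[k] X.V) :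
    Module.Dual.eval k H ((HopfRep.twistElt k H)⁻¹ : Hˣ) ((coendMap X).lin w) =
      (Xᘁ ◁ (twist X).inv ≫ ε_ X Xᘁ).lin w := by
  have key : Module.Dual.eval k H ((HopfRep.twistElt k H)⁻¹ : Hˣ) ∘ₗ (coendMap X).lin =
      (Xᘁ ◁ (twist X).inv ≫ ε_ X Xᘁ).lin := TensorProduct.ext' fun _ _ => rfl
  exact LinearMap.congr_fun key w

variable (k H) in
/-- The coend `A = H*` of the category of finite-dimensional left `H`-modules, with its structural
morphisms. -/
noncomputable def repCoend : CoendHopfData (HRep k H) where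
  toDualCoend := dualCoend k H
  comul := comulHom k H
  i_comul X := hom_ext (LinearMap.ext fun w => dualComul_rel X w)
  mul := mulHom k H
  i_mul X Y := hom_ext (LinearMap.ext fun w => dualMul_rel X Y w)
  antipode := antipodeHom k H
  i_antipode X := hom_ext (LinearMap.ext fun w => dualAntipode_rel X w)
  thetaPos := homOfSurjective (coendMap (regular k H)) coendMap_regular_surjective _
    (Module.Dual.eval k H (HopfRep.twistElt k H : H)) (thetaPos_rel (regular k H))
  i_thetaPos X := hom_ext (LinearMap.ext fun w => thetaPos_rel X w)
  thetaNeg := homOfSurjective (coendMap (regular k H)) coendMap_regular_surjective _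
    (Module.Dual.eval k H ((HopfRep.twistElt k H)⁻¹ : Hˣ)) (thetaNeg_rel (regular k H))
  i_thetaNeg X := hom_ext (LinearMap.ext fun w => thetaNeg_rel X w)

end CoendData
end Ribbon

end HRep

/-! ### The elements `z ∈ H` parameterizing Kirby elements -/

namespace HopfKirby

section

variable {k H : Type u} [Field k] [Ring H] [HopfAlgebra k H]

/-- Left integrals for `H`: `x Λ = ε(x) Λ`. -/
def IsLeftIntegral (Λ : H) : Prop := ∀ x : H, x * Λ = Coalgebra.counit (R := k) x • Λ

/-- Right integrals for `H*`: `λ(x₍₁₎) x₍₂₎ = λ(x) 1`. -/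
def IsRightIntegral (lam : Module.Dual k H) : Prop :=
  ∀ x : H, TensorProduct.lid k H (lam.rTensor H (Coalgebra.comul x)) = lam x • (1 : H)

/-- The distinguished grouplike element `ν` of `H*`: the algebra map `ν : H → k` such that
`Λ x = ν(x) Λ` for every left integral `Λ` for `H`. -/
def IsDistinguished (ν : H →ₐ[k] k) : Prop :=
  ∀ Λ : H, IsLeftIntegral (k := k) Λ → ∀ x : H, Λ * x = ν x • Λ

/-- `x ↼ f = f(x₍₁₎) x₍₂₎`. -/
noncomputable def harpoon (f : Module.Dual k H) (x : H) : H :=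
  TensorProduct.lid k H (f.rTensor H (Coalgebra.comul x))

/-- `L(H)`: the `z` such that `(x ↼ ν) z = z x` for all `x`. -/
def L (ν : H →ₐ[k] k) : Set H := {z | ∀ x : H, harpoon ν.toLinearMap x * z = z * x}

/-- `N(H)`: the `z ∈ L(H)` such that `λ(z a) = 0` for all central `a`. -/
def N (lam : Module.Dual k H) (ν : H →ₐ[k] k) : Set H :=
  {z | z ∈ L ν ∧ ∀ a ∈ Subalgebra.center k H, lam (z * a) = 0}

variable (k H) in
/-- `V₂(H)`: the `X ∈ H ⊗ H` such that `X ◁ h = ε(h) X` for all `h`, where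
`(x ⊗ y) ◁ h = S(h₍₁₎) x h₍₂₎ ⊗ S(h₍₃₎) y h₍₄₎`. -/
def V₂ : Set (H ⊗[k] H) :=
  {X | ∀ h : H, TensorProduct.homTensorHomMap (RingHom.id k) H H H H
    (TensorProduct.map (HopfRep.rightAdj k H) (HopfRep.rightAdj k H) (Coalgebra.comul h)) X =
      Coalgebra.counit (R := k) h • X}

/-- The form `λ · z`, `x ↦ λ(z x)`. -/
noncomputable def lamMul (lam : Module.Dual k H) (z : H) : Module.Dual k H :=
  lam ∘ₗ LinearMap.mulLeft k z

/-- `x ⊗ y ↦ λ(z x) λ(z y)`. -/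
noncomputable def lamSq (lam : Module.Dual k H) (z : H) : H ⊗[k] H →ₗ[k] k :=
  TensorProduct.dualDistrib k H H (lamMul lam z ⊗ₜ lamMul lam z)

variable (k H) in
/-- `x ⊗ y ↦ x₍₁₎ ⊗ x₍₂₎ y`. -/
noncomputable def slide : H ⊗[k] H →ₗ[k] H ⊗[k] H :=
  (LinearMap.mul' k H).lTensor H ∘ₗ (TensorProduct.assoc k H H H).toLinearMap ∘ₗ
    (Coalgebra.comul (R := k) (A := H)).rTensor H

/-- `φ_z : α ↦ α (λ · z)`. -/
noncomputable def phi (lam : Module.Dual k H) (z : H) : k →ₗ[k] Module.Dual k H :=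
  LinearMap.toSpanSingleton k (Module.Dual k H) (lamMul lam z)

/-- `T(z) = (S(z) ↼ ν) h_ν`, where `h_ν = (id ⊗ ν)(R)`. -/
noncomputable def T [QuasitriangularHopfAlgebra k H] (ν : H →ₐ[k] k) (z : H) : H :=
  harpoon ν.toLinearMap (HopfAlgebra.antipode k z) *
    TensorProduct.rid k H (ν.toLinearMap.lTensor H (HopfRep.Rm k H))

variable [FiniteDimensional k H] [RibbonHopfAlgebra k H]

/-- `I(H)`: the `z` such that `φ_z` is a morphism `𝟙_ ⟶ A` that belongs to `I(rep_H)`. -/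
def kirby (lam : Module.Dual k H) : Set H :=
  {z | ∃ α ∈ (HRep.repCoend k H).kirby, α.lin = phi lam z}

/-- `I(H)^norm`: the `z` such that `φ_z` is a morphism `𝟙_ ⟶ A` that belongs to
`I(rep_H)^norm`. -/
def kirbyNorm (lam : Module.Dual k H) : Set H :=
  {z | ∃ α ∈ (HRep.repCoend k H).kirbyNorm, α.lin = phi lam z}

end

end HopfKirby

set_option linter.unusedSectionVars false

attribute [fun_prop] IsLinearMap

/-! ### Sums over the components of a tensor -/

namespace TensorSum

section

variable {k M N P Q : Type*} [Field k] [AddCommGroup M] [Module k M] [AddCommGroup N] [Module k N]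
  [AddCommGroup P] [Module k P] [AddCommGroup Q] [Module k Q]

@[fun_prop] theorem lin_id : IsLinearMap k (fun x : M => x) := ⟨fun _ _ => rfl, fun _ _ => rfl⟩

@[fun_prop] theorem lin_comp {g : N → P} {f : M → N} (hg : IsLinearMap k g)
    (hf : IsLinearMap k f) : IsLinearMap k (fun x => g (f x)) :=
  ⟨fun x y => by rw [hf.map_add, hg.map_add], fun c x => by rw [hf.map_smul, hg.map_smul]⟩

@[fun_prop] theorem lin_coe (L : N →ₗ[k] P) {f : M → N} (hf : IsLinearMap k f) :
    IsLinearMap k (fun x => L (f x)) :=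
  lin_comp L.isLinear hf

@[fun_prop] theorem lin_coe_equiv (L : N ≃ₗ[k] P) {f : M → N} (hf : IsLinearMap k f) :
    IsLinearMap k (fun x => L (f x)) :=
  lin_comp L.toLinearMap.isLinear hf

@[fun_prop] theorem lin_apply {L : M → N →ₗ[k] P} (hL : IsLinearMap k L) (y : N) :
    IsLinearMap k (fun x => L x y) :=
  ⟨fun x y => by rw [hL.map_add]; rfl, fun c x => by rw [hL.map_smul]; rfl⟩

@[fun_prop] theorem lin_smul_left {f : M → k} (hf : IsLinearMap k f) (v : N) :
    IsLinearMap k (fun x => f x • v) :=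
  ⟨fun x y => by rw [hf.map_add, add_smul], fun c x => by
    rw [hf.map_smul, smul_eq_mul, mul_smul]⟩

@[fun_prop] theorem lin_smul_right (c : k) {f : M → N} (hf : IsLinearMap k f) :
    IsLinearMap k (fun x => c • f x) :=
  ⟨fun x y => by rw [hf.map_add, smul_add], fun d x => by rw [hf.map_smul, smul_comm]⟩

@[fun_prop] theorem lin_tmul_left {f : M → N} (hf : IsLinearMap k f) (y : P) :
    IsLinearMap k (fun x => f x ⊗ₜ[k] y) :=
  ⟨fun a b => by rw [hf.map_add, TensorProduct.add_tmul], fun c a => by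
    rw [hf.map_smul, TensorProduct.smul_tmul']⟩

@[fun_prop] theorem lin_tmul_right (y : P) {f : M → N} (hf : IsLinearMap k f) :
    IsLinearMap k (fun x => y ⊗ₜ[k] f x) :=
  ⟨fun a b => by rw [hf.map_add, TensorProduct.tmul_add], fun c a => by
    rw [hf.map_smul, TensorProduct.tmul_smul]⟩

variable {A : Type*} [Ring A] [Algebra k A]

@[fun_prop] theorem lin_mul_left (a : A) {f : M → A} (hf : IsLinearMap k f) :
    IsLinearMap k (fun x => a * f x) :=
  lin_comp (LinearMap.mulLeft k a).isLinear hf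

@[fun_prop] theorem lin_mul_right (a : A) {f : M → A} (hf : IsLinearMap k f) :
    IsLinearMap k (fun x => f x * a) :=
  lin_comp (LinearMap.mulRight k a).isLinear hf

variable (k) in
/-- Bilinearity of a function of two variables. -/
structure IsBilin (f : M → N → P) : Prop where
  left : ∀ y, IsLinearMap k fun x => f x y
  right : ∀ x, IsLinearMap k fun y => f x y

variable (k) in
/-- Trilinearity of a function of three variables. -/
structure IsTrilin (f : M → N → P → Q) : Prop where
  left : ∀ y z, IsLinearMap k fun x => f x y z
  middle : ∀ x z, IsLinearMap k fun y => f x y z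
  right : ∀ x y, IsLinearMap k fun z => f x y z

/-- The sum of `f x y` over the components `x ⊗ y` of a tensor. -/
noncomputable def sumT (t : M ⊗[k] N) (f : M → N → P) : P :=
  ∑ p ∈ (TensorProduct.exists_finset t).choose, f p.1 p.2

/-- The linear map on the tensor product induced by a bilinear function. -/
def IsBilin.lift {f : M → N → P} (hf : IsBilin k f) : M ⊗[k] N →ₗ[k] P :=
  TensorProduct.lift (LinearMap.mk₂ k f (fun x x' y => (hf.1 y).map_add x x')
    (fun c x y => (hf.1 y).map_smul c x) (fun x y y' => (hf.2 x).map_add y y')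
    (fun c x y => (hf.2 x).map_smul c y))

theorem IsBilin.lift_tmul {f : M → N → P} (hf : IsBilin k f) (x : M) (y : N) :
    hf.lift (x ⊗ₜ y) = f x y := rfl

theorem sumT_tmul_eq (t : M ⊗[k] N) : sumT t (fun x y => x ⊗ₜ[k] y) = t :=
  (TensorProduct.exists_finset t).choose_spec.symm

theorem map_sumT (L : P →ₗ[k] Q) (t : M ⊗[k] N) (f : M → N → P) :
    L (sumT t f) = sumT t fun x y => L (f x y) := map_sum L _ _

theorem apply_eq_sumT (L : M ⊗[k] N →ₗ[k] P) (t : M ⊗[k] N) :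
    L t = sumT t fun x y => L (x ⊗ₜ y) := by
  conv_lhs => rw [← sumT_tmul_eq t]
  exact map_sumT L t _

theorem IsBilin.lift_apply {f : M → N → P} (hf : IsBilin k f) (t : M ⊗[k] N) :
    hf.lift t = sumT t f := apply_eq_sumT _ _

theorem sumT_tmul {f : M → N → P} (hf : IsBilin k f) (x : M) (y : N) :
    sumT (x ⊗ₜ[k] y) f = f x y := by rw [← hf.lift_apply, hf.lift_tmul]

theorem sumT_sumT_left {R S : Type*} [AddCommGroup R] [Module k R] [AddCommGroup S] [Module k S]
    {f : M → N → P} (hf : IsBilin k f) (s : R ⊗[k] S) (F : R → S → M ⊗[k] N) :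
    sumT (sumT s F) f = sumT s fun a b => sumT (F a b) f := by
  simp only [← hf.lift_apply, map_sumT]

theorem sumT_congr {t : M ⊗[k] N} {f g : M → N → P} (h : ∀ x y, f x y = g x y) :
    sumT t f = sumT t g := Finset.sum_congr rfl fun _ _ => h _ _

theorem sumT_sumT {R S : Type*} [AddCommGroup R] [Module k R] [AddCommGroup S] [Module k S]
    (t : M ⊗[k] N) (s : R ⊗[k] S) (f : R → S → M → N → P) :
    sumT s (fun a b => sumT t fun x y => f a b x y) =
      sumT t fun x y => sumT s fun a b => f a b x y := Finset.sum_comm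

theorem sumT_map {R S : Type*} [AddCommGroup R] [Module k R] [AddCommGroup S] [Module k S]
    {f : M → N → P} (hf : IsBilin k f) (g : R →ₗ[k] M) (h : S →ₗ[k] N) (t : R ⊗[k] S) :
    sumT (TensorProduct.map g h t) f = sumT t fun x y => f (g x) (h y) := by
  rw [← hf.lift_apply, ← LinearMap.comp_apply, apply_eq_sumT]
  rfl

theorem sumT_comm {f : N → M → P} (hf : IsBilin k f) (t : M ⊗[k] N) :
    sumT (TensorProduct.comm k M N t) f = sumT t fun x y => f y x := by
  rw [← hf.lift_apply, ← LinearEquiv.coe_coe, ← LinearMap.comp_apply, apply_eq_sumT]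
  rfl

theorem mul_sumT (a : A) (t : M ⊗[k] N) (f : M → N → A) :
    a * sumT t f = sumT t fun x y => a * f x y := Finset.mul_sum _ _ _

theorem sumT_mul (a : A) (t : M ⊗[k] N) (f : M → N → A) :
    sumT t f * a = sumT t fun x y => f x y * a := Finset.sum_mul _ _ _

theorem smul_sumT (c : k) (t : M ⊗[k] N) (f : M → N → P) :
    c • sumT t f = sumT t fun x y => c • f x y := Finset.smul_sum

theorem sumT_smul (v : P) (t : M ⊗[k] N) (f : M → N → k) :
    sumT t f • v = sumT t fun x y => f x y • v := Finset.sum_smul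

theorem sumT_mul_tmul {B : Type*} [Ring B] [Algebra k B] {f : A → B → P} (hf : IsBilin k f)
    (s t : A ⊗[k] B) :
    sumT (s * t) f = sumT s fun a b => sumT t fun c d => f (a * c) (b * d) := by
  rw [← hf.lift_apply]
  conv_lhs => rw [← sumT_tmul_eq s, sumT_mul, map_sumT]
  refine sumT_congr fun a b => ?_
  conv_lhs => rw [← sumT_tmul_eq t, mul_sumT, map_sumT]
  exact sumT_congr fun c d => by rw [Algebra.TensorProduct.tmul_mul_tmul, hf.lift_tmul]

@[fun_prop] theorem lin_sumT {R : Type*} [AddCommGroup R] [Module k R] (t : M ⊗[k] N)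
    {f : R → M → N → P} (hf : ∀ x y, IsLinearMap k fun r => f r x y) :
    IsLinearMap k fun r => sumT t fun x y => f r x y :=
  ⟨fun a b => by
    simp only [sumT, (hf _ _).map_add, Finset.sum_add_distrib],
   fun c a => by simp only [sumT, (hf _ _).map_smul, Finset.smul_sum]⟩

@[fun_prop] theorem lin_sumT_arg {R : Type*} [AddCommGroup R] [Module k R] {t : R → M ⊗[k] N}
    (ht : IsLinearMap k t) {f : M → N → P} (hf : IsBilin k f) :
    IsLinearMap k fun r => sumT (t r) f := by
  simp only [← hf.lift_apply]
  fun_prop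

theorem IsBilin.mul_mul {B : Type*} [Ring B] [Algebra k B] {F : A → B → P} (hF : IsBilin k F)
    (a : A) (s : B) : IsBilin k fun c t => F (a * c) (s * t) :=
  ⟨fun _ => lin_comp (hF.left _) (by fun_prop), fun _ => lin_comp (hF.right _) (by fun_prop)⟩

theorem IsBilin.sumT_mul_mul {B : Type*} [Ring B] [Algebra k B] {F : A → B → P}
    (hF : IsBilin k F) (t : A ⊗[k] B) :
    IsBilin k fun a s => sumT t fun c d => F (a * c) (s * d) :=
  ⟨fun _ => lin_sumT _ fun _ _ => lin_comp (hF.left _) (by fun_prop),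
    fun _ => lin_sumT _ fun _ _ => lin_comp (hF.right _) (by fun_prop)⟩

theorem sumT_assoc {f : M → N → P → Q} (hf : IsTrilin k f) (t : (M ⊗[k] N) ⊗[k] P) :
    sumT (TensorProduct.assoc k M N P t) (fun x s => sumT s fun y z => f x y z) =
      sumT t fun s z => sumT s fun x y => f x y z := by
  have h1 : ∀ x, IsBilin k (f x) := fun x => ⟨fun z => hf.middle x z, fun y => hf.right x y⟩
  have h2 : ∀ z, IsBilin k (fun x y => f x y z) :=
    fun z => ⟨fun y => hf.1 y z, fun x => hf.middle x z⟩
  have h3 : IsBilin k (fun x (s : N ⊗[k] P) => sumT s fun y z => f x y z) :=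
    ⟨fun s => lin_sumT s fun y z => hf.1 y z, fun x => lin_sumT_arg lin_id (h1 x)⟩
  have h4 : IsBilin k (fun (s : M ⊗[k] N) z => sumT s fun x y => f x y z) :=
    ⟨fun z => lin_sumT_arg lin_id (h2 z), fun s => lin_sumT s fun x y => hf.right x y⟩
  rw [← h3.lift_apply, ← h4.lift_apply]
  suffices h : h3.lift ∘ₗ (TensorProduct.assoc k M N P).toLinearMap = h4.lift from
    LinearMap.congr_fun h t
  refine TensorProduct.ext_threefold fun x y z => ?_
  change sumT (y ⊗ₜ[k] z) (f x) = sumT (x ⊗ₜ[k] y) (fun x y => f x y z)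
  rw [sumT_tmul (h2 z)]
  exact sumT_tmul (h1 x) y z

end

end TensorSum

/-! ### Hopf algebra identities in Sweedler form -/

namespace HopfSweedler

open TensorSum

section

variable {k H M : Type u} [Field k] [Ring H] [HopfAlgebra k H] [AddCommGroup M] [Module k M]

local notation "Δ" => Coalgebra.comul (R := k)
local notation "ε" => Coalgebra.counit (R := k)
local notation "S" => HopfAlgebra.antipode k

theorem coassoc {f : H → H → H → M} (hf : IsTrilin k f) (x : H) :
    sumT (Δ x) (fun a b => sumT (Δ a) fun a₁ a₂ => f a₁ a₂ b) =
      sumT (Δ x) fun a b => sumT (Δ b) fun b₁ b₂ => f a b₁ b₂ := by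
  have h := sumT_assoc hf ((Coalgebra.comul (R := k) (A := H)).rTensor H (Δ x))
  rw [Coalgebra.coassoc_apply] at h
  refine ((sumT_map ?_ _ LinearMap.id (Δ x)).symm.trans h.symm).trans
    (sumT_map ?_ LinearMap.id _ (Δ x))
  · exact ⟨fun z => lin_sumT_arg lin_id ⟨fun y => hf.1 y z, fun x => hf.middle x z⟩,
      fun s => lin_sumT s fun x y => hf.right x y⟩
  · exact ⟨fun s => lin_sumT s fun y z => hf.1 y z,
      fun x => lin_sumT_arg lin_id ⟨fun z => hf.middle x z, fun y => hf.right x y⟩⟩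

theorem counit_left {f : H → M} (hf : IsLinearMap k f) (x : H) :
    sumT (Δ x) (fun a b => ε a • f b) = f x := by
  have h := congrArg ((TensorProduct.lid k M).toLinearMap ∘ₗ (hf.mk' f).lTensor k)
    (Coalgebra.rTensor_counit_comul (R := k) x)
  simp only [LinearMap.comp_apply, LinearMap.lTensor_tmul, LinearEquiv.coe_coe,
    TensorProduct.lid_tmul, one_smul, IsLinearMap.mk'_apply] at h
  rw [← h, ← LinearMap.comp_apply, ← LinearEquiv.coe_coe, ← LinearMap.comp_apply, apply_eq_sumT]
  rfl

theorem counit_right {f : H → M} (hf : IsLinearMap k f) (x : H) :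
    sumT (Δ x) (fun a b => ε b • f a) = f x := by
  have h := congrArg ((TensorProduct.rid k M).toLinearMap ∘ₗ (hf.mk' f).rTensor k)
    (Coalgebra.lTensor_counit_comul (R := k) x)
  simp only [LinearMap.comp_apply, LinearMap.rTensor_tmul, LinearEquiv.coe_coe,
    TensorProduct.rid_tmul, one_smul, IsLinearMap.mk'_apply] at h
  rw [← h, ← LinearMap.comp_apply, ← LinearEquiv.coe_coe, ← LinearMap.comp_apply, apply_eq_sumT]
  rfl

theorem antipode_left (x : H) : sumT (Δ x) (fun a b => S a * b) = ε x • 1 := by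
  rw [← Algebra.algebraMap_eq_smul_one, ← HopfAlgebra.mul_antipode_rTensor_comul_apply,
    ← LinearMap.comp_apply, apply_eq_sumT]
  rfl

theorem antipode_right (x : H) : sumT (Δ x) (fun a b => a * S b) = ε x • 1 := by
  rw [← Algebra.algebraMap_eq_smul_one, ← HopfAlgebra.mul_antipode_lTensor_comul_apply,
    ← LinearMap.comp_apply, apply_eq_sumT]
  rfl

theorem sw_mul {f : H → H → M} (hf : IsBilin k f) (x y : H) :
    sumT (Δ (x * y)) f = sumT (Δ x) fun a b => sumT (Δ y) fun c d => f (a * c) (b * d) := by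
  rw [Bialgebra.comul_mul, sumT_mul_tmul hf]

theorem antipode_mul (a b : H) : S (a * b) = S b * S a := HopfAlgebra.antipode_mul_antidistrib a b

theorem comul_antipode_aux (x : H) : sumT (Δ x) (fun a b => Δ a *
    sumT (Δ b) fun b₁ b₂ => S b₂ ⊗ₜ[k] S b₁) = ε x • (1 : H ⊗[k] H) := by
  have h1 : ∀ a b : H, sumT (Δ a) (fun a₁ a₂ => Δ a₁ * (S b ⊗ₜ[k] S a₂)) =
      (a * S b) ⊗ₜ[k] 1 := by
    intro a b
    have h2 : ∀ a₁ a₂ : H, Δ a₁ * (S b ⊗ₜ[k] S a₂) =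
        sumT (Δ a₁) fun c d => (c * S b) ⊗ₜ[k] (d * S a₂) := by
      intro a₁ a₂
      conv_lhs => rw [← sumT_tmul_eq (Δ a₁), sumT_mul]
      exact sumT_congr fun _ _ => Algebra.TensorProduct.tmul_mul_tmul _ _ _ _
    rw [sumT_congr h2, coassoc (f := fun c d e => (c * S b) ⊗ₜ[k] (d * S e))
      ⟨fun _ _ => by fun_prop, fun _ _ => by fun_prop, fun _ _ => by fun_prop⟩]
    have h3 : ∀ c d : H, sumT (Δ d) (fun d₁ d₂ => (c * S b) ⊗ₜ[k] (d₁ * S d₂)) =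
        ε d • ((c * S b) ⊗ₜ[k] 1) := by
      intro c d
      have := map_sumT (TensorProduct.mk k H H (c * S b)) (Δ d) fun d₁ d₂ => d₁ * S d₂
      rw [antipode_right, map_smul] at this
      exact this.symm
    rw [sumT_congr h3, counit_right (f := fun c => (c * S b) ⊗ₜ[k] (1 : H)) (by fun_prop)]
  simp only [mul_sumT]
  rw [← coassoc (f := fun a b c => Δ a * (S c ⊗ₜ[k] S b))
    ⟨fun _ _ => by fun_prop, fun _ _ => by fun_prop, fun _ _ => by fun_prop⟩, sumT_congr h1]
  have := map_sumT ((TensorProduct.mk k H H).flip 1) (Δ x) fun a b => a * S b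
  rw [antipode_right, map_smul] at this
  exact this.symm

theorem comul_antipode (x : H) :
    Δ (S x) = sumT (Δ x) fun a b => S b ⊗ₜ[k] S a := by
  have h1 : ∀ x : H, sumT (Δ x) (fun a b => Δ (S a) * Δ b) = ε x • (1 : H ⊗[k] H) := by
    intro x
    simp only [← Bialgebra.comul_mul]
    rw [← map_sumT, antipode_left, map_smul, Bialgebra.comul_one]
  have hG : IsLinearMap k (fun x : H => sumT (Δ x) fun a b => S b ⊗ₜ[k] S a) :=
    lin_sumT_arg (by fun_prop) ⟨fun _ => by fun_prop, fun _ => by fun_prop⟩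
  have h2 := coassoc (f := fun a b c => Δ (S a) * Δ b * sumT (Δ c) fun c₁ c₂ => S c₂ ⊗ₜ[k] S c₁)
    ⟨fun _ _ => by fun_prop, fun _ _ => by fun_prop, fun _ _ => lin_mul_left _ hG⟩ x
  simp only [← sumT_mul, h1, smul_mul_assoc, one_mul] at h2
  rw [counit_left hG] at h2
  rw [h2]
  simp only [mul_assoc, ← mul_sumT, comul_antipode_aux, mul_smul_comm, mul_one]
  rw [counit_right (f := fun a => Δ (S a)) (by fun_prop)]

theorem sw_antipode {f : H → H → M} (hf : IsBilin k f) (x : H) :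
    sumT (Δ (S x)) f = sumT (Δ x) fun a b => f (S b) (S a) := by
  rw [← hf.lift_apply, comul_antipode, map_sumT]
  rfl

end

end HopfSweedler

/-! ### Integrals of finite-dimensional Hopf algebras -/

namespace HopfKirby

open TensorSum HopfSweedler

section

variable {k H : Type u} [Field k] [Ring H] [HopfAlgebra k H]

local notation "Δ" => Coalgebra.comul (R := k)
local notation "ε" => Coalgebra.counit (R := k)
local notation "S" => HopfAlgebra.antipode k

theorem harpoon_eq (f : Module.Dual k H) (x : H) :
    harpoon f x = sumT (Δ x) fun a b => f a • b := by
  rw [harpoon, ← LinearEquiv.coe_coe, ← LinearMap.comp_apply, apply_eq_sumT]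
  rfl

@[fun_prop] theorem lin_harpoon {M : Type*} [AddCommGroup M] [Module k M] (f : Module.Dual k H)
    {g : M → H} (hg : IsLinearMap k g) : IsLinearMap k fun x => harpoon f (g x) := by
  simp only [harpoon]
  fun_prop

theorem harpoon_mul (ν : H →ₐ[k] k) (x y : H) :
    harpoon ν.toLinearMap (x * y) = harpoon ν.toLinearMap x * harpoon ν.toLinearMap y := by
  rw [harpoon_eq, harpoon_eq, harpoon_eq, sw_mul ⟨fun _ => by fun_prop, fun _ => by fun_prop⟩,
    sumT_mul]
  refine sumT_congr fun a b => ?_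
  rw [mul_sumT]
  refine sumT_congr fun c d => ?_
  simp [smul_smul, mul_comm]

theorem charMul_antipode (ν : H →ₐ[k] k) (x : H) :
    sumT (Δ x) (fun a b => ν a * ν (S b)) = ε x := by
  have h := congrArg ν (antipode_right (k := k) x)
  rw [← AlgHom.toLinearMap_apply, map_sumT] at h
  simpa using h

theorem antipode_charMul (ν : H →ₐ[k] k) (x : H) :
    sumT (Δ x) (fun a b => ν (S a) * ν b) = ε x := by
  have h := congrArg ν (antipode_left (k := k) x)
  rw [← AlgHom.toLinearMap_apply, map_sumT] at h
  simpa using h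

@[fun_prop] theorem lin_char {M : Type*} [AddCommGroup M] [Module k M] (ν : H →ₐ[k] k)
    {g : M → H} (hg : IsLinearMap k g) : IsLinearMap k fun x => ν (g x) :=
  lin_coe ν.toLinearMap hg

theorem char_antipode_antipode (ν : H →ₐ[k] k) (x : H) : ν (S (S x)) = ν x := by
  have h1 : ∀ x : H, sumT (Δ x) (fun a b => ν (S a) * ν (S (S b))) = ε x := by
    intro x
    have h := antipode_charMul ν (S x)
    rw [sw_antipode ⟨fun _ => by fun_prop, fun _ => by fun_prop⟩, HopfAlgebra.counit_antipode] at h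
    rw [← h]
    exact sumT_congr fun _ _ => mul_comm _ _
  have h2 := coassoc (k := k) (f := fun a b c => ν a * (ν (S b) * ν (S (S c))))
    ⟨fun _ _ => by fun_prop, fun _ _ => by fun_prop, fun _ _ => by fun_prop⟩ x
  have h3 := counit_left (k := k) (f := fun x => ν (S (S x))) (by fun_prop) x
  have h4 := counit_right (k := k) (f := fun x => ν x) (by fun_prop) x
  simp only [smul_eq_mul] at h3 h4
  rw [← h3, ← h4]
  simp only [← mul_sumT, h1] at h2
  simp only [← mul_assoc, ← sumT_mul, charMul_antipode] at h2
  rw [h2]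
  exact sumT_congr fun _ _ => mul_comm _ _

theorem antipode_antipode_harpoon (ν : H →ₐ[k] k) (x : H) :
    S (S (harpoon ν.toLinearMap x)) = harpoon ν.toLinearMap (S (S x)) := by
  rw [harpoon_eq, harpoon_eq, map_sumT, map_sumT,
    sw_antipode ⟨fun _ => by fun_prop, fun _ => by fun_prop⟩,
    sw_antipode ⟨fun _ => by fun_prop, fun _ => by fun_prop⟩]
  refine sumT_congr fun a b => ?_
  rw [map_smul, map_smul, AlgHom.toLinearMap_apply, AlgHom.toLinearMap_apply,
    char_antipode_antipode]

variable {lam : Module.Dual k H}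

theorem IsRightIntegral.sumT_eq (hlam : IsRightIntegral lam) (x : H) :
    sumT (Δ x) (fun a b => lam a • b) = lam x • (1 : H) := by
  rw [← hlam x, ← harpoon_eq, harpoon]

theorem IsRightIntegral.antipode_eq (hlam : IsRightIntegral lam) (x y : H) :
    sumT (Δ x) (fun a b => lam (a * y) • b) = sumT (Δ y) fun a b => lam (x * a) • S b := by
  have h1 : ∀ c d : H, lam (x * c) • S d =
      sumT (Δ c) fun p q => sumT (Δ x) fun a b => lam (a * p) • (b * q * S d) := by
    intro c d
    have h := congrArg (· * S d) (hlam.sumT_eq (x * c))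
    simp only [smul_mul_assoc, one_mul] at h
    rw [← h, sw_mul ⟨fun _ => by fun_prop, fun _ => by fun_prop⟩, sumT_sumT, sumT_mul]
    refine sumT_congr fun p q => ?_
    rw [sumT_mul]
    exact sumT_congr fun a b => by rw [smul_mul_assoc]
  rw [sumT_congr h1, coassoc (f := fun p q d => sumT (Δ x) fun a b => lam (a * p) • (b * q * S d))
    ⟨fun _ _ => by fun_prop, fun _ _ => by fun_prop, fun _ _ => by fun_prop⟩]
  have h2 : ∀ c d : H, sumT (Δ d) (fun p q => sumT (Δ x) fun a b =>
      lam (a * c) • (b * p * S q)) = ε d • sumT (Δ x) fun a b => lam (a * c) • b := by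
    intro c d
    rw [sumT_sumT, smul_sumT]
    refine sumT_congr fun a b => ?_
    simp only [mul_assoc]
    rw [← smul_sumT, ← mul_sumT, antipode_right, mul_smul_comm, mul_one, smul_comm]
  rw [sumT_congr h2, counit_right (f := fun c => sumT (Δ x) fun a b => lam (a * c) • b)
    (by fun_prop)]

theorem IsRightIntegral.eq_zero [FiniteDimensional k H] (hlam : IsRightIntegral lam)
    (h0 : lam ≠ 0) {x : H}
    (hx : ∀ y, lam (x * y) = 0) : x = 0 := by
  have h1 : ∀ x : H, (∀ y, lam (x * y) = 0) → ε x = 0 := by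
    intro x hx
    have h2 : ∀ y, ε x * lam y = 0 := by
      intro y
      have e := Module.finBasis k H
      have h3 : ∀ a b : H, lam (a * S b * y) = ∑ i, lam (e.repr b i • a * (S (e i) * y)) := by
        intro a b
        conv_lhs => rw [← e.sum_repr b]
        simp only [map_sum, map_smul, Finset.mul_sum, Finset.sum_mul, smul_mul_assoc,
          mul_smul_comm, mul_assoc]
      have h4 : sumT (Δ x) (fun a b => lam (a * S b * y)) = ε x * lam y := by
        have := congrArg (fun t => lam (t * y)) (antipode_right (k := k) x)
        simp only [smul_mul_assoc, one_mul, map_smul, smul_eq_mul] at this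
        rw [← this, sumT_mul, map_sumT]
      rw [← h4, sumT_congr h3]
      have h5 : ∀ i, sumT (Δ x) (fun a b => lam (e.repr b i • a * (S (e i) * y))) = 0 := by
        intro i
        have h6 := hlam.antipode_eq x (S (e i) * y)
        have h7 := congrArg (e.coord i) h6
        rw [map_sumT] at h7
        simp only [hx, zero_smul, map_smul] at h7
        rw [show sumT (Δ (S (e i) * y)) (fun _ _ : H => (0 : H)) = 0 from
          Finset.sum_const_zero, map_zero] at h7
        rw [← h7]
        refine sumT_congr fun a b => ?_
        simp [mul_comm]
      simp only [sumT] at h5 ⊢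
      rw [Finset.sum_comm]
      exact Finset.sum_eq_zero fun i _ => h5 i
    obtain ⟨y, hy⟩ : ∃ y, lam y ≠ 0 := by
      by_contra! h
      exact h0 (LinearMap.ext h)
    exact (mul_eq_zero.mp (h2 y)).resolve_right hy
  rw [← Module.forall_dual_apply_eq_zero_iff k]
  intro φ
  have h2 : φ x = ε (sumT (Δ x) fun a b => φ b • a) := by
    rw [← counit_left (k := k) (f := fun x => φ x) (by fun_prop) x, map_sumT]
    exact sumT_congr fun a b => by rw [map_smul, smul_eq_mul, smul_eq_mul, mul_comm]
  rw [h2]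
  refine h1 _ fun y => ?_
  have h6 := congrArg φ (hlam.antipode_eq x y)
  rw [map_sumT] at h6
  simp only [hx, zero_smul, map_smul] at h6
  rw [show sumT (Δ y) (fun _ _ : H => (0 : H)) = 0 from Finset.sum_const_zero, map_zero] at h6
  rw [← h6, sumT_mul, map_sumT]
  exact sumT_congr fun a b => by
    rw [smul_mul_assoc, map_smul, smul_eq_mul, smul_eq_mul, mul_comm]

variable [FiniteDimensional k H]

theorem IsRightIntegral.exists_mul_eq (hlam : IsRightIntegral lam) (h0 : lam ≠ 0)
    (φ : Module.Dual k H) : ∃ x, ∀ y, lam (x * y) = φ y := by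
  have hs : Function.Surjective ((LinearMap.mul k H).compr₂ lam) := by
    refine (LinearMap.injective_iff_surjective_of_finrank_eq_finrank
      (Subspace.dual_finrank_eq (K := k) (V := H)).symm).mp ?_
    rw [← LinearMap.ker_eq_bot, LinearMap.ker_eq_bot']
    exact fun x hx => hlam.eq_zero h0 fun y => LinearMap.congr_fun hx y
  obtain ⟨x, hx⟩ := hs φ
  exact ⟨x, fun y => LinearMap.congr_fun hx y⟩

theorem IsRightIntegral.eq_zero' (hlam : IsRightIntegral lam) (h0 : lam ≠ 0) {x : H}
    (hx : ∀ y, lam (y * x) = 0) : x = 0 := by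
  rw [← Module.forall_dual_apply_eq_zero_iff k]
  intro φ
  obtain ⟨y, hy⟩ := hlam.exists_mul_eq h0 φ
  rw [← hy, hx]

theorem IsRightIntegral.eq_of_mul_right (hlam : IsRightIntegral lam) (h0 : lam ≠ 0) {x x' : H}
    (hx : ∀ y, lam (x * y) = lam (x' * y)) : x = x' :=
  sub_eq_zero.mp (hlam.eq_zero h0 fun y => by rw [sub_mul, map_sub, hx, sub_self])

theorem IsRightIntegral.eq_of_mul_left (hlam : IsRightIntegral lam) (h0 : lam ≠ 0) {x x' : H}
    (hx : ∀ y, lam (y * x) = lam (y * x')) : x = x' :=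
  sub_eq_zero.mp (hlam.eq_zero' h0 fun y => by rw [mul_sub, map_sub, hx, sub_self])

theorem IsRightIntegral.exists_mul_eq' (hlam : IsRightIntegral lam) (h0 : lam ≠ 0)
    (φ : Module.Dual k H) : ∃ x, ∀ y, lam (y * x) = φ y := by
  have hs : Function.Surjective ((LinearMap.mul k H).compr₂ lam).flip := by
    refine (LinearMap.injective_iff_surjective_of_finrank_eq_finrank
      (Subspace.dual_finrank_eq (K := k) (V := H)).symm).mp ?_
    rw [← LinearMap.ker_eq_bot, LinearMap.ker_eq_bot']
    exact fun x hx => hlam.eq_zero' h0 fun y => LinearMap.congr_fun hx y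
  obtain ⟨x, hx⟩ := hs φ
  exact ⟨x, fun y => LinearMap.congr_fun hx y⟩

/-- The left integral `Λ` normalized by `λ(Λ) = 1`. -/
theorem IsRightIntegral.exists_leftIntegral (hlam : IsRightIntegral lam) (h0 : lam ≠ 0) :
    ∃ Λ : H, (∀ y, lam (y * Λ) = ε y) ∧ IsLeftIntegral (k := k) Λ := by
  obtain ⟨Λ, hΛ⟩ := hlam.exists_mul_eq' h0 Coalgebra.counit
  refine ⟨Λ, hΛ, fun x => hlam.eq_of_mul_left h0 fun y => ?_⟩
  rw [← mul_assoc, hΛ, mul_smul_comm, map_smul, hΛ, Bialgebra.counit_mul, smul_eq_mul, mul_comm]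

theorem IsRightIntegral.sumT_antipode_leftIntegral (hlam : IsRightIntegral lam) {Λ : H}
    (hΛ : ∀ y, lam (y * Λ) = ε y) (x : H) :
    sumT (Δ Λ) (fun a b => lam (x * a) • S b) = x := by
  rw [← hlam.antipode_eq]
  simp only [hΛ]
  exact counit_left (f := fun x : H => x) (by fun_prop) x

theorem IsRightIntegral.sumT_leftIntegral (hlam : IsRightIntegral lam) {Λ : H}
    (hΛ : ∀ y, lam (y * Λ) = ε y) (hΛ' : IsLeftIntegral (k := k) Λ) {ν : H →ₐ[k] k}
    (hν : IsDistinguished ν) (y : H) :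
    sumT (Δ Λ) (fun a b => lam (a * y) • b) = S (harpoon ν.toLinearMap y) := by
  have h1 : lam Λ = 1 := by simpa using hΛ 1
  rw [hlam.antipode_eq, harpoon_eq, map_sumT]
  refine sumT_congr fun a b => ?_
  rw [hν Λ hΛ', map_smul, h1, map_smul, smul_eq_mul, mul_one]
  rfl

theorem IsRightIntegral.antipode_bijective (hlam : IsRightIntegral lam) (h0 : lam ≠ 0) :
    Function.Bijective (HopfAlgebra.antipode k (A := H)) := by
  obtain ⟨Λ, hΛ, -⟩ := hlam.exists_leftIntegral h0
  have hs : Function.Surjective (HopfAlgebra.antipode k (A := H)) := fun x =>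
    ⟨sumT (Δ Λ) fun a b => lam (x * a) • b, by
      rw [map_sumT]
      simp only [map_smul]
      exact hlam.sumT_antipode_leftIntegral hΛ x⟩
  exact ⟨LinearMap.injective_iff_surjective.mpr hs, hs⟩

theorem IsRightIntegral.mul_comm (hlam : IsRightIntegral lam) (h0 : lam ≠ 0) {ν : H →ₐ[k] k}
    (hν : IsDistinguished ν) (x y : H) :
    lam (x * y) = lam (S (S (harpoon ν.toLinearMap y)) * x) := by
  obtain ⟨Λ, hΛ, hΛ'⟩ := hlam.exists_leftIntegral h0
  have h1 : sumT (Δ Λ) (fun a b => lam (S b * x) • a) = x := by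
    refine hlam.eq_of_mul_left h0 fun w => ?_
    conv_rhs => rw [← hlam.sumT_antipode_leftIntegral hΛ w, sumT_mul, map_sumT]
    rw [mul_sumT, map_sumT]
    refine sumT_congr fun a b => ?_
    rw [mul_smul_comm, map_smul, smul_mul_assoc, map_smul, smul_eq_mul, smul_eq_mul,
      _root_.mul_comm]
  rw [← hlam.sumT_leftIntegral hΛ hΛ' hν, map_sumT, sumT_mul, map_sumT]
  conv_lhs => rw [← h1, sumT_mul, map_sumT]
  refine sumT_congr fun a b => ?_
  rw [smul_mul_assoc, map_smul, map_smul, smul_mul_assoc, map_smul, smul_eq_mul, smul_eq_mul,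
      _root_.mul_comm]

/-- The integral composed with the antipode, in terms of the distinguished element `g` of `H`. -/
theorem IsRightIntegral.comp_antipode (hlam : IsRightIntegral lam) (h0 : lam ≠ 0) {ν : H →ₐ[k] k}
    (hν : IsDistinguished ν) {g : H} (hg : ∀ y, sumT (Δ y) (fun a b => lam b • a) = lam y • g)
    (y : H) : lam (S y) = lam (g * y) := by
  obtain ⟨Λ, hΛ, hΛ'⟩ := hlam.exists_leftIntegral h0
  have h1 : lam Λ = 1 := by simpa using hΛ 1
  have h2 : lam (S (harpoon ν.toLinearMap y)) = lam (g * y) := by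
    rw [← one_smul k g, ← h1, ← hg, ← hlam.sumT_leftIntegral hΛ hΛ' hν, map_sumT, sumT_mul,
      map_sumT]
    refine sumT_congr fun a b => ?_
    rw [map_smul, smul_mul_assoc, map_smul, smul_eq_mul, smul_eq_mul, _root_.mul_comm]
  rw [← h2]
  have hS := (hlam.antipode_bijective h0).1
  have h3 : sumT (Δ y) (fun a b => lam (S b) • a) = lam (S y) • (1 : H) := by
    apply hS
    rw [map_smul, HopfAlgebra.antipode_one, ← hlam.sumT_eq (S y),
      sw_antipode ⟨fun _ => by fun_prop, fun _ => by fun_prop⟩, map_sumT]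
    exact sumT_congr fun a b => by rw [map_smul]
  have h4 := congrArg ν h3
  rw [map_smul, map_one, smul_eq_mul, mul_one, ← AlgHom.toLinearMap_apply, map_sumT] at h4
  rw [← h4, harpoon_eq, map_sumT, map_sumT]
  refine sumT_congr fun a b => ?_
  rw [map_smul, map_smul, map_smul, smul_eq_mul, smul_eq_mul, _root_.mul_comm]

end

end HopfKirby

/-! ### Ad-invariant forms -/

namespace HopfKirby

open TensorSum HopfSweedler

section

variable {k H : Type u} [Field k] [Ring H] [HopfAlgebra k H]

local notation "Δ" => Coalgebra.comul (R := k)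
local notation "ε" => Coalgebra.counit (R := k)
local notation "S" => HopfAlgebra.antipode k

theorem rightAdj_apply (h x : H) :
    HopfRep.rightAdj k H h x = sumT (Δ h) fun a b => S a * (x * b) := by
  change (HopfRep.adj k H).flip x (Δ h) = _
  rw [apply_eq_sumT]
  rfl

/-- Invariance of a form under the right adjoint action. -/
def IsAdInvariant (f : Module.Dual k H) : Prop :=
  ∀ h x : H, f (HopfRep.rightAdj k H h x) = ε h * f x

theorem IsAdInvariant.mul_comm {f : Module.Dual k H} (hf : IsAdInvariant f) (x h : H) :
    f (x * h) = f (S (S h) * x) := by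
  have h1 := coassoc (k := k) (f := fun a b c => f (S b * (S (S a) * x * c)))
    ⟨fun _ _ => by fun_prop, fun _ _ => by fun_prop, fun _ _ => by fun_prop⟩ h
  have h2 : ∀ a b : H, sumT (Δ b) (fun b₁ b₂ => f (S b₁ * (S (S a) * x * b₂))) =
      ε b • f (S (S a) * x) := fun a b => by
    rw [← map_sumT, ← rightAdj_apply, hf]
    rfl
  have h3 : ∀ a b : H, sumT (Δ a) (fun a₁ a₂ => f (S a₂ * (S (S a₁) * x * b))) =
      ε a • f (x * b) := fun a b => by
    have h4 := antipode_left (k := k) a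
    replace h4 := congrArg (fun t => f (S t * x * b)) h4
    simp only [map_smul, HopfAlgebra.antipode_one, smul_mul_assoc, one_mul] at h4
    rw [← h4, map_sumT, sumT_mul, sumT_mul, map_sumT]
    exact sumT_congr fun c d => by rw [antipode_mul]; simp only [mul_assoc]
  rw [sumT_congr h2, sumT_congr h3, counit_left (f := fun b => f (x * b)) (by fun_prop),
    counit_right (f := fun a => f (S (S a) * x)) (by fun_prop)] at h1
  exact h1

theorem lamMul_apply (lam : Module.Dual k H) (z x : H) : lamMul lam z x = lam (z * x) := rfl

theorem mem_L_iff [FiniteDimensional k H] {lam : Module.Dual k H} (hlam : IsRightIntegral lam)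
    (h0 : lam ≠ 0) {ν : H →ₐ[k] k} (hν : IsDistinguished ν) (z : H) :
    z ∈ L ν ↔ IsAdInvariant (lamMul lam z) := by
  refine ⟨fun hz h x => ?_, fun hf => ?_⟩
  · have h1 : ∀ a b : H, lam (z * (S a * (x * b))) = lam (z * S (a * S b) * x) := fun a b => by
      rw [← mul_assoc, ← mul_assoc, hlam.mul_comm h0 hν, antipode_antipode_harpoon, ← mul_assoc,
        ← mul_assoc, hz, antipode_mul]
      simp only [mul_assoc]
    rw [rightAdj_apply, lamMul_apply, mul_sumT, map_sumT, sumT_congr h1, ← map_sumT lam,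
      ← sumT_mul, ← mul_sumT, ← map_sumT, antipode_right, map_smul, HopfAlgebra.antipode_one,
      mul_smul_comm, mul_one, smul_mul_assoc, map_smul]
    rfl
  · intro x
    obtain ⟨w, rfl⟩ := (hlam.antipode_bijective h0).2 x
    obtain ⟨h, rfl⟩ := (hlam.antipode_bijective h0).2 w
    refine hlam.eq_of_mul_right h0 fun y => ?_
    have h1 := hf.mul_comm y h
    rw [lamMul_apply, lamMul_apply, ← mul_assoc, hlam.mul_comm h0 hν, antipode_antipode_harpoon,
      ← mul_assoc, ← mul_assoc] at h1
    exact h1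

/-- The map `x ⊗ y ↦ y₍₁₎ ⊗ (x ◁ y₍₂₎)`. -/
noncomputable def adBraid : H ⊗[k] H →ₗ[k] H ⊗[k] H :=
  (TensorProduct.lift (HopfRep.rightAdj k H)).lTensor H ∘ₗ
    (TensorProduct.assoc k H H H).toLinearMap ∘ₗ
      (Coalgebra.comul (R := k) (A := H)).rTensor H ∘ₗ (TensorProduct.comm k H H).toLinearMap

theorem adBraid_tmul (x y : H) :
    adBraid (k := k) (x ⊗ₜ y) = sumT (Δ y) fun a b => a ⊗ₜ HopfRep.rightAdj k H b x := by
  have h : ∀ t : H ⊗[k] H, (TensorProduct.lift (HopfRep.rightAdj k H)).lTensor H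
      (TensorProduct.assoc k H H H (t ⊗ₜ x)) =
      sumT t fun a b => a ⊗ₜ HopfRep.rightAdj k H b x := by
    intro t
    refine (apply_eq_sumT ((TensorProduct.lift (HopfRep.rightAdj k H)).lTensor H ∘ₗ
      (TensorProduct.assoc k H H H).toLinearMap ∘ₗ
      (TensorProduct.mk k (H ⊗[k] H) H).flip x) t).trans ?_
    rfl
  exact h _

variable (k) in
/-- The right adjoint action on `H ⊗ H`. -/
noncomputable def rightAdj₂ (h : H) : H ⊗[k] H →ₗ[k] H ⊗[k] H :=
  TensorProduct.homTensorHomMap (RingHom.id k) H H H H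
    (TensorProduct.map (HopfRep.rightAdj k H) (HopfRep.rightAdj k H) (Δ h))

theorem rightAdj₂_tmul (h x y : H) : rightAdj₂ k h (x ⊗ₜ y) =
    sumT (Δ h) fun a b => HopfRep.rightAdj k H a x ⊗ₜ HopfRep.rightAdj k H b y := by
  exact apply_eq_sumT (LinearMap.applyₗ (x ⊗ₜ[k] y) ∘ₗ
    TensorProduct.homTensorHomMap (RingHom.id k) H H H H ∘ₗ
    TensorProduct.map (HopfRep.rightAdj k H) (HopfRep.rightAdj k H)) (Δ h)

theorem rightAdj_mul (a b x : H) :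
    HopfRep.rightAdj k H (a * b) x = HopfRep.rightAdj k H b (HopfRep.rightAdj k H a x) := by
  change HopfRep.adj k H (Δ (a * b)) x = HopfRep.adj k H (Δ b) (HopfRep.adj k H (Δ a) x)
  rw [Bialgebra.comul_mul, HopfRep.adj_mul]
  rfl

theorem rightAdj_one (x : H) : HopfRep.rightAdj k H 1 x = x := by
  change HopfRep.adj k H (Δ 1) x = x
  rw [Bialgebra.comul_one, Algebra.TensorProduct.one_def, HopfRep.adj_tmul]
  simp

theorem adBraid_rightAdj₂_tmul (h x y : H) :
    adBraid (rightAdj₂ k h (x ⊗ₜ y)) = rightAdj₂ k h (adBraid (x ⊗ₜ y)) := by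
  let g : H → H → H ⊗[k] H := fun c d => c ⊗ₜ HopfRep.rightAdj k H d x
  have hg : IsBilin k g := ⟨fun _ => by fun_prop, fun _ => by fun_prop⟩
  have h1 : ∀ a b : H, adBraid (HopfRep.rightAdj k H a x ⊗ₜ[k] HopfRep.rightAdj k H b y) =
      sumT (Δ y) fun y₁ y₂ => sumT (Δ b) fun p q => sumT (Δ p) fun p₁ p₂ =>
        sumT (Δ q) fun q₁ q₂ => g (S p₂ * (y₁ * q₁)) (a * (S p₁ * (y₂ * q₂))) := by
    intro a b
    rw [adBraid_tmul, rightAdj_apply, map_sumT, sumT_sumT_left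
      ⟨fun _ => by fun_prop, fun _ => by fun_prop⟩, sumT_sumT]
    refine sumT_congr fun p q => ?_
    rw [sw_mul ⟨fun _ => by fun_prop, fun _ => by fun_prop⟩, sw_antipode
      ⟨fun _ => by exact lin_sumT _ fun _ _ => by fun_prop,
        fun _ => by exact lin_sumT _ fun _ _ => by fun_prop⟩]
    rw [sumT_sumT (Δ p) (Δ y)]
    refine sumT_congr fun p₁ p₂ => ?_
    rw [sw_mul ⟨fun _ => by fun_prop, fun _ => by fun_prop⟩]
    simp only [← rightAdj_mul]
    rfl
  have h2 : ∀ y₁ y₂ : H, sumT (Δ h) (fun a b => sumT (Δ b) fun p q => sumT (Δ p) fun p₁ p₂ =>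
        sumT (Δ q) fun q₁ q₂ => g (S p₂ * (y₁ * q₁)) (a * (S p₁ * (y₂ * q₂)))) =
      sumT (Δ h) fun t q => sumT (Δ q) fun q₁ q₂ => g (S t * (y₁ * q₁)) (y₂ * q₂) := by
    intro y₁ y₂
    have hg' : ∀ p₁ p₂ a : H, IsBilin k fun q₁ q₂ =>
        g (S p₂ * (y₁ * q₁)) (a * (S p₁ * (y₂ * q₂))) := fun _ _ _ =>
      ⟨fun _ => by fun_prop, fun _ => by fun_prop⟩
    rw [← coassoc (f := fun a p q => sumT (Δ p) fun p₁ p₂ =>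
      sumT (Δ q) fun q₁ q₂ => g (S p₂ * (y₁ * q₁)) (a * (S p₁ * (y₂ * q₂))))
      ⟨fun _ _ => lin_sumT _ fun _ _ => lin_sumT _ fun _ _ => by fun_prop,
       fun _ _ => lin_sumT_arg (by fun_prop) ⟨fun _ => lin_sumT _ fun _ _ => by fun_prop,
          fun _ => lin_sumT _ fun _ _ => by fun_prop⟩,
       fun _ _ => lin_sumT _ fun _ _ => lin_sumT_arg (by fun_prop) (hg' _ _ _)⟩]
    refine sumT_congr fun t q => ?_
    rw [← coassoc (f := fun a p₁ p₂ =>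
      sumT (Δ q) fun q₁ q₂ => g (S p₂ * (y₁ * q₁)) (a * (S p₁ * (y₂ * q₂))))
      ⟨fun _ _ => lin_sumT _ fun _ _ => by fun_prop, fun _ _ => lin_sumT _ fun _ _ => by fun_prop,
       fun _ _ => lin_sumT _ fun _ _ => by fun_prop⟩]
    have h3 : ∀ s p : H, sumT (Δ s) (fun a p₁ => sumT (Δ q) fun q₁ q₂ =>
        g (S p * (y₁ * q₁)) (a * (S p₁ * (y₂ * q₂)))) =
        ε s • sumT (Δ q) fun q₁ q₂ => g (S p * (y₁ * q₁)) (y₂ * q₂) := by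
      intro s p
      rw [sumT_sumT, smul_sumT]
      refine sumT_congr fun q₁ q₂ => ?_
      have h4 : ∀ a p₁ : H, g (S p * (y₁ * q₁)) (a * (S p₁ * (y₂ * q₂))) =
          (hg.right (S p * (y₁ * q₁))).mk' _ (a * S p₁ * (y₂ * q₂)) := fun a p₁ => by
        rw [mul_assoc]
        rfl
      rw [sumT_congr h4, ← map_sumT, ← sumT_mul, antipode_right, smul_mul_assoc, one_mul, map_smul]
      rfl
    rw [sumT_congr h3, counit_left (f := fun p => sumT (Δ q) fun q₁ q₂ =>
      g (S p * (y₁ * q₁)) (y₂ * q₂)) (lin_sumT _ fun _ _ => by fun_prop)]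
  have h3 : ∀ y₁ y₂ : H, rightAdj₂ k h (y₁ ⊗ₜ[k] HopfRep.rightAdj k H y₂ x) =
      sumT (Δ h) fun t q => sumT (Δ q) fun q₁ q₂ => g (S t * (y₁ * q₁)) (y₂ * q₂) := by
    intro y₁ y₂
    rw [rightAdj₂_tmul, ← coassoc (f := fun t q₁ q₂ => g (S t * (y₁ * q₁)) (y₂ * q₂))
      ⟨fun _ _ => by fun_prop, fun _ _ => by fun_prop, fun _ _ => by fun_prop⟩]
    refine sumT_congr fun a b => ?_
    rw [← rightAdj_mul, rightAdj_apply]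
    exact map_sumT ((TensorProduct.mk k H H).flip _) _ _
  rw [rightAdj₂_tmul, map_sumT, sumT_congr h1, sumT_sumT, adBraid_tmul, map_sumT]
  exact sumT_congr fun y₁ y₂ => (h2 y₁ y₂).trans (h3 y₁ y₂).symm

theorem adBraid_rightAdj₂ (h : H) (X : H ⊗[k] H) :
    adBraid (rightAdj₂ k h X) = rightAdj₂ k h (adBraid X) := by
  have : adBraid ∘ₗ rightAdj₂ k h = rightAdj₂ k h ∘ₗ adBraid :=
    TensorProduct.ext' fun x y => adBraid_rightAdj₂_tmul h x y
  exact LinearMap.congr_fun this X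

theorem adBraid_surjective (hS : Function.Bijective (HopfAlgebra.antipode k (A := H))) :
    Function.Surjective (adBraid (k := k) (H := H)) := by
  let e := LinearEquiv.ofBijective (HopfAlgebra.antipode k (A := H)) hS
  have he : ∀ x, S (e.symm x) = x := e.apply_symm_apply
  have h1 : ∀ c : H, sumT (Δ c) (fun b p => e.symm p * b) = ε c • 1 := by
    intro c
    apply hS.1
    rw [map_sumT, map_smul, HopfAlgebra.antipode_one, ← antipode_left]
    exact sumT_congr fun a b => by rw [antipode_mul, he]
  have h2 : ∀ p q : H, adBraid (sumT (Δ p) fun p₁ p₂ =>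
      HopfRep.rightAdj k H (e.symm p₂) q ⊗ₜ[k] p₁) = p ⊗ₜ[k] q := by
    intro p q
    simp only [map_sumT, adBraid_tmul, ← rightAdj_mul]
    rw [coassoc (f := fun a b c => a ⊗ₜ[k] HopfRep.rightAdj k H (e.symm c * b) q)
      ⟨fun _ _ => by fun_prop, fun _ _ => by fun_prop, fun _ _ => by fun_prop⟩]
    have h3 : ∀ a c : H, sumT (Δ c) (fun b d => a ⊗ₜ[k] HopfRep.rightAdj k H (e.symm d * b) q) =
        ε c • (a ⊗ₜ[k] q) := by
      intro a c
      have := congrArg (TensorProduct.mk k H H a ∘ₗ (HopfRep.rightAdj k H).flip q) (h1 c)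
      rw [map_sumT, map_smul] at this
      refine this.trans ?_
      simp [rightAdj_one]
    rw [sumT_congr h3, counit_right (f := fun a => a ⊗ₜ[k] q) (by fun_prop)]
  rw [← LinearMap.range_eq_top, eq_top_iff, ← TensorProduct.span_tmul_eq_top, Submodule.span_le]
  rintro _ ⟨p, q, rfl⟩
  exact ⟨_, h2 p q⟩

end

end HopfKirby

/-! ### Identities for the `R`-matrix, the Drinfeld element and the twist -/

namespace HopfKirby

open TensorSum HopfSweedler

section

variable {k H M : Type u} [Field k] [Ring H] [HopfAlgebra k H] [QuasitriangularHopfAlgebra k H]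
  [AddCommGroup M] [Module k M]

local notation "Δ" => Coalgebra.comul (R := k)
local notation "ε" => Coalgebra.counit (R := k)
local notation "S" => HopfAlgebra.antipode k
local notation "ℜ" => HopfRep.Rm k H

theorem sumT_R_comul {f : H → H → M} (hf : IsBilin k f) (x : H) :
    sumT ℜ (fun a b => sumT (Δ x) fun c d => f (a * c) (b * d)) =
      sumT ℜ fun a b => sumT (Δ x) fun c d => f (d * a) (c * b) := by
  have h : ℜ * Δ x = TensorProduct.comm k H H (Δ x) * ℜ := QuasitriangularHopfAlgebra.R_comul x
  have h1 : IsBilin k fun c d => sumT ℜ fun a b => f (c * a) (d * b) :=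
    ⟨fun _ => lin_sumT _ fun _ _ => lin_comp (hf.left _) (by fun_prop),
      fun _ => lin_sumT _ fun _ _ => lin_comp (hf.right _) (by fun_prop)⟩
  rw [← sumT_mul_tmul hf, h, sumT_mul_tmul hf, sumT_comm h1, sumT_sumT]

theorem sumT_id_comul {f : H → H → H → M} (hf : IsTrilin k f) :
    sumT ℜ (fun a b => sumT (Δ b) fun b₁ b₂ => f a b₁ b₂) =
      sumT ℜ fun a b => sumT ℜ fun a' b' => f (a * a') b' b := by
  have h1 : ∀ x, IsBilin k (f x) := fun x => ⟨fun z => hf.middle x z, fun y => hf.right x y⟩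
  have hF : IsBilin k (fun a (s : H ⊗[k] H) => sumT s (f a)) :=
    ⟨fun s => lin_sumT s fun y z => hf.left y z, fun x => lin_sumT_arg lin_id (h1 x)⟩
  have h := congrArg (fun t => sumT t fun a s => sumT s (f a))
    (QuasitriangularHopfAlgebra.id_comul_R (k := k) (H := H))
  rw [sumT_mul_tmul hF] at h
  refine ((sumT_map hF LinearMap.id (Coalgebra.comul (R := k) (A := H)) ℜ).symm.trans h).trans ?_
  have hG : ∀ (a : H) (s : H ⊗[k] H), IsBilin k fun c t => sumT (s * t) (f (a * c)) :=
    hF.mul_mul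
  have hG' : IsBilin k fun (a : H) (s : H ⊗[k] H) => sumT
      (Algebra.TensorProduct.map (AlgHom.id k H) Algebra.TensorProduct.includeLeft ℜ)
        fun c t => sumT (s * t) (f (a * c)) :=
    hF.sumT_mul_mul _
  refine (sumT_map hG' LinearMap.id
    (Algebra.TensorProduct.includeRight (R := k) (A := H) (B := H)).toLinearMap ℜ).trans ?_
  refine sumT_congr fun a b => ?_
  refine (sumT_map (hG a _) LinearMap.id
    (Algebra.TensorProduct.includeLeft : H →ₐ[k] H ⊗[k] H).toLinearMap ℜ).trans ?_
  refine sumT_congr fun c d => ?_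
  simp only [AlgHom.toLinearMap_apply, Algebra.TensorProduct.includeRight_apply,
    Algebra.TensorProduct.includeLeft_apply, Algebra.TensorProduct.tmul_mul_tmul, one_mul, mul_one]
  exact sumT_tmul (h1 _) _ _

theorem sumT_comul_id {f : H → H → H → M} (hf : IsTrilin k f) :
    sumT ℜ (fun a b => sumT (Δ a) fun a₁ a₂ => f a₁ a₂ b) =
      sumT ℜ fun a b => sumT ℜ fun a' b' => f a a' (b * b') := by
  have h1 : ∀ x, IsBilin k (f x) := fun x => ⟨fun z => hf.middle x z, fun y => hf.right x y⟩
  have h2 : ∀ z, IsBilin k (fun x y => f x y z) :=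
    fun z => ⟨fun y => hf.left y z, fun x => hf.middle x z⟩
  have hF : IsBilin k (fun a (s : H ⊗[k] H) => sumT s (f a)) :=
    ⟨fun s => lin_sumT s fun y z => hf.left y z, fun x => lin_sumT_arg lin_id (h1 x)⟩
  have h4 : IsBilin k (fun (s : H ⊗[k] H) z => sumT s fun x y => f x y z) :=
    ⟨fun z => lin_sumT_arg lin_id (h2 z), fun s => lin_sumT s fun x y => hf.right x y⟩
  have h := congrArg (fun t => sumT t fun a s => sumT s (f a))
    (QuasitriangularHopfAlgebra.comul_id_R (k := k) (H := H))
  rw [sumT_assoc hf, sumT_mul_tmul hF] at h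
  refine ((sumT_map h4 (Coalgebra.comul (R := k) (A := H)) LinearMap.id ℜ).symm.trans h).trans ?_
  have hG : ∀ (a : H) (s : H ⊗[k] H), IsBilin k fun c t => sumT (s * t) (f (a * c)) :=
    hF.mul_mul
  have hG' : IsBilin k fun (a : H) (s : H ⊗[k] H) => sumT
      (Algebra.TensorProduct.includeRight (R := k) (A := H) ℜ)
        fun c t => sumT (s * t) (f (a * c)) :=
    hF.sumT_mul_mul _
  refine (sumT_map hG' LinearMap.id
    (Algebra.TensorProduct.includeRight (R := k) (A := H) (B := H)).toLinearMap ℜ).trans ?_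
  refine sumT_congr fun a b => ?_
  refine (sumT_tmul (hG a _) _ _).trans ?_
  rw [mul_one, AlgHom.toLinearMap_apply, Algebra.TensorProduct.includeRight_apply,
    sumT_mul_tmul (h1 a)]
  refine (sumT_tmul ⟨fun _ => by exact lin_sumT _ fun _ _ => lin_comp (hf.middle _ _) (by fun_prop),
    fun _ => by exact lin_sumT _ fun _ _ => lin_comp (hf.right _ _) (by fun_prop)⟩ _ _).trans ?_
  simp only [one_mul]

theorem R_mul_inv : ℜ * HopfRep.Rinv k H = 1 := Units.mul_inv _

theorem sumT_counit_R : sumT ℜ (fun a b => ε a • b) = 1 := by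
  have h := sumT_comul_id (k := k) (H := H) (f := fun a c b => ε a • (c ⊗ₜ[k] b))
    ⟨fun _ _ => by fun_prop, fun _ _ => by fun_prop, fun _ _ => by fun_prop⟩
  have h1 : ∀ a b : H, sumT (Δ a) (fun a₁ a₂ => ε a₁ • (a₂ ⊗ₜ[k] b)) = a ⊗ₜ[k] b := fun a b =>
    counit_left (f := fun c => c ⊗ₜ[k] b) (by fun_prop) a
  have h2 : ∀ a b : H, sumT ℜ (fun a' b' => ε a • (a' ⊗ₜ[k] (b * b'))) =
      (1 ⊗ₜ[k] (ε a • b)) * ℜ := fun a b => by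
    conv_rhs => rw [← sumT_tmul_eq ℜ, mul_sumT]
    refine sumT_congr fun c d => ?_
    rw [Algebra.TensorProduct.tmul_mul_tmul, one_mul, smul_mul_assoc, TensorProduct.tmul_smul]
  rw [sumT_congr h1, sumT_tmul_eq, sumT_congr h2, ← sumT_mul] at h
  have h3 := congrArg (· * HopfRep.Rinv k H) h
  simp only [mul_assoc, R_mul_inv, mul_one] at h3
  have h4 := congrArg (TensorProduct.lid k H ∘ (Coalgebra.counit (R := k)).rTensor H) h3
  rw [Function.comp_apply, Function.comp_apply, map_sumT, ← LinearEquiv.coe_coe, map_sumT] at h4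
  simpa [Algebra.TensorProduct.one_def] using h4.symm

theorem sumT_R_counit : sumT ℜ (fun a b => ε b • a) = 1 := by
  have h := sumT_id_comul (k := k) (H := H) (f := fun a c b => ε c • (a ⊗ₜ[k] b))
    ⟨fun _ _ => by fun_prop, fun _ _ => by fun_prop, fun _ _ => by fun_prop⟩
  have h1 : ∀ a b : H, sumT (Δ b) (fun b₁ b₂ => ε b₁ • (a ⊗ₜ[k] b₂)) = a ⊗ₜ[k] b := fun a b =>
    counit_left (f := fun c => a ⊗ₜ[k] c) (by fun_prop) b
  have h2 : ∀ a b : H, sumT ℜ (fun a' b' => ε b' • ((a * a') ⊗ₜ[k] b)) =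
      (a ⊗ₜ[k] b) * (sumT ℜ (fun a b => ε b • a) ⊗ₜ[k] 1) := fun a b => by
    rw [Algebra.TensorProduct.tmul_mul_tmul, mul_one, mul_sumT]
    refine Eq.trans ?_ (map_sumT ((TensorProduct.mk k H H).flip b) ℜ _).symm
    refine sumT_congr fun c d => ?_
    rw [mul_smul_comm, map_smul]
    rfl
  rw [sumT_congr h1, sumT_tmul_eq, sumT_congr h2, ← sumT_mul, sumT_tmul_eq] at h
  have h3 := congrArg (HopfRep.Rinv k H * ·) h
  have h5 : HopfRep.Rinv k H * ℜ = 1 := Units.inv_mul _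
  simp only [← mul_assoc, h5, one_mul] at h3
  have h4 := congrArg (TensorProduct.rid k H ∘ (Coalgebra.counit (R := k)).lTensor H) h3
  simpa [Algebra.TensorProduct.one_def] using h4.symm

/-- `S(a) a' ⊗ b b' = 1 ⊗ 1`. -/
theorem sumT_antipode_R_mul {f : H → H → M} (hf : IsBilin k f) :
    sumT ℜ (fun a b => sumT ℜ fun a' b' => f (S a * a') (b * b')) = f 1 1 := by
  have h := sumT_comul_id (k := k) (H := H) (f := fun a c b => f (S a * c) b)
    ⟨fun _ _ => lin_comp (hf.left _) (by fun_prop), fun _ _ => lin_comp (hf.left _) (by fun_prop),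
      fun _ _ => hf.right _⟩
  have e := congrArg ((hf.right 1).mk' _) (sumT_counit_R (k := k) (H := H))
  rw [map_sumT] at e
  refine h.symm.trans (Eq.trans (sumT_congr fun a b => ?_) e)
  have e' := congrArg ((hf.left b).mk' _) (antipode_left (k := k) a)
  rw [map_sumT, map_smul] at e'
  exact e'.trans ((hf.right 1).map_smul _ _).symm

/-- `a S(a') ⊗ b b' = 1 ⊗ 1`. -/
theorem sumT_R_mul_antipode {f : H → H → M} (hf : IsBilin k f) :
    sumT ℜ (fun a b => sumT ℜ fun a' b' => f (a * S a') (b * b')) = f 1 1 := by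
  have h := sumT_comul_id (k := k) (H := H) (f := fun a c b => f (a * S c) b)
    ⟨fun _ _ => lin_comp (hf.left _) (by fun_prop), fun _ _ => lin_comp (hf.left _) (by fun_prop),
      fun _ _ => hf.right _⟩
  have e := congrArg ((hf.right 1).mk' _) (sumT_counit_R (k := k) (H := H))
  rw [map_sumT] at e
  refine h.symm.trans (Eq.trans (sumT_congr fun a b => ?_) e)
  have e' := congrArg ((hf.left b).mk' _) (antipode_right (k := k) a)
  rw [map_sumT, map_smul] at e'
  exact e'.trans ((hf.right 1).map_smul _ _).symm

/-- `(S ⊗ S)(R) = R`. -/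
theorem sumT_antipode_R {f : H → H → M} (hf : IsBilin k f) :
    sumT ℜ (fun a b => f (S a) (S b)) = sumT ℜ f := by
  have h1 : sumT ℜ (fun a b => S a ⊗ₜ[k] b) * ℜ = 1 := by
    have := sumT_antipode_R_mul (k := k) (H := H) (f := fun a b => a ⊗ₜ[k] b)
      ⟨fun _ => by fun_prop, fun _ => by fun_prop⟩
    rw [Algebra.TensorProduct.one_def, ← this, sumT_mul]
    refine sumT_congr fun a b => ?_
    conv_lhs => rw [← sumT_tmul_eq ℜ, mul_sumT]
    exact sumT_congr fun c d => by rw [Algebra.TensorProduct.tmul_mul_tmul]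
  have h2 : sumT ℜ (fun a b => S a ⊗ₜ[k] b) * sumT ℜ (fun a b => S a ⊗ₜ[k] S b) = 1 := by
    have h := sumT_id_comul (k := k) (H := H) (f := fun a b c => S a ⊗ₜ[k] (b * S c))
      ⟨fun _ _ => by fun_prop, fun _ _ => by fun_prop, fun _ _ => by fun_prop⟩
    have h3 : ∀ a b : H, sumT (Δ b) (fun b₁ b₂ => S a ⊗ₜ[k] (b₁ * S b₂)) =
        S (ε b • a) ⊗ₜ[k] 1 := fun a b => by
      have := congrArg (TensorProduct.mk k H H (S a)) (antipode_right (k := k) b)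
      rw [map_sumT, map_smul, ← LinearMap.smul_apply, ← map_smul, ← map_smul] at this
      exact this
    have h4 := congrArg (fun x => S x ⊗ₜ[k] (1 : H)) (sumT_R_counit (k := k) (H := H))
    rw [sumT_congr h3] at h
    rw [HopfAlgebra.antipode_one, ← Algebra.TensorProduct.one_def, map_sumT] at h4
    have h5 := map_sumT ((TensorProduct.mk k H H).flip 1) ℜ fun a b => S (ε b • a)
    rw [← h4]
    refine (Eq.trans ?_ h.symm).trans h5.symm
    rw [sumT_mul, sumT_sumT]
    refine sumT_congr fun a b => ?_
    rw [mul_sumT]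
    refine sumT_congr fun c d => ?_
    rw [Algebra.TensorProduct.tmul_mul_tmul, antipode_mul]
  have h3 : sumT ℜ (fun a b => S a ⊗ₜ[k] S b) = ℜ := by
    have h4 : sumT ℜ (fun a b => S a ⊗ₜ[k] b) = HopfRep.Rinv k H := by
      have := congrArg (· * HopfRep.Rinv k H) h1
      simpa only [mul_assoc, R_mul_inv, mul_one, one_mul] using this
    rw [h4] at h2
    have := congrArg (ℜ * ·) h2
    simpa only [← mul_assoc, R_mul_inv, mul_one, one_mul] using this
  conv_rhs => rw [← h3]
  rw [sumT_sumT_left hf]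
  exact sumT_congr fun a b => (sumT_tmul hf _ _).symm

end

end HopfKirby

namespace HopfKirby

open TensorSum HopfSweedler

section

variable {k H : Type u} [Field k] [Ring H] [HopfAlgebra k H] [QuasitriangularHopfAlgebra k H]

local notation "Δ" => Coalgebra.comul (R := k)
local notation "ε" => Coalgebra.counit (R := k)
local notation "S" => HopfAlgebra.antipode k
local notation "ℜ" => HopfRep.Rm k H
local notation "𝓊" => HopfRep.drinfeld k H

theorem drinfeld_eq : 𝓊 = sumT ℜ fun a b => S b * a := by
  change LinearMap.mul' k H ((S).rTensor H (TensorProduct.comm k H H ℜ)) = _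
  rw [← LinearEquiv.coe_coe, ← LinearMap.comp_apply, ← LinearMap.comp_apply, apply_eq_sumT]
  rfl

variable (k H) in
/-- The inverse `m(id ⊗ S²)σ(R)` of the Drinfeld element. -/
noncomputable def drinfeldInv : H := sumT ℜ fun a b => b * S (S a)

local notation "𝓋" => drinfeldInv k H

theorem drinfeld_mul (x : H) : 𝓊 * x = S (S x) * 𝓊 := by
  have h1 : ∀ p q : H, sumT (Δ p) (fun c d => S (S q) * (S d * 𝓊 * c)) =
      ε p • (S (S q) * 𝓊) := by
    intro p q
    have h2 := sumT_R_comul (k := k) (H := H) (f := fun a b => S (S q) * (S b * a))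
      ⟨fun _ => by fun_prop, fun _ => by fun_prop⟩ p
    have h3 : ∀ c d : H, S (S q) * (S d * 𝓊 * c) =
        sumT ℜ fun a b => S (S q) * (S (b * d) * (a * c)) := fun c d => by
      rw [drinfeld_eq, mul_sumT, sumT_mul, mul_sumT]
      exact sumT_congr fun a b => by simp only [antipode_mul, mul_assoc]
    rw [sumT_congr h3, ← sumT_sumT, h2, drinfeld_eq, mul_sumT, smul_sumT]
    refine sumT_congr fun a b => ?_
    have h4 := congrArg (fun t => S (S q) * (S b * (t * a))) (antipode_left (k := k) p)
    simp only [sumT_mul, mul_sumT, smul_mul_assoc, mul_smul_comm, one_mul] at h4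
    rw [← h4]
    exact sumT_congr fun c d => by simp only [antipode_mul, mul_assoc]
  have h2 := coassoc (k := k) (f := fun c d q => S (S q) * (S d * 𝓊 * c))
    ⟨fun _ _ => by fun_prop, fun _ _ => by fun_prop, fun _ _ => by fun_prop⟩ x
  have h3 : ∀ c e : H, sumT (Δ e) (fun d q => S (S q) * (S d * 𝓊 * c)) = ε e • (𝓊 * c) := by
    intro c e
    have h4 := congrArg (fun t => S t * (𝓊 * c)) (antipode_right (k := k) e)
    simp only [map_smul, HopfAlgebra.antipode_one, smul_mul_assoc, one_mul, map_sumT,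
      sumT_mul] at h4
    rw [← h4]
    exact sumT_congr fun d q => by simp only [antipode_mul, mul_assoc]
  rw [sumT_congr h1, sumT_congr h3, counit_left (f := fun q => S (S q) * 𝓊) (by fun_prop),
    counit_right (f := fun c => 𝓊 * c) (by fun_prop)] at h2
  exact h2.symm

theorem drinfeld_mul_drinfeldInv : 𝓊 * 𝓋 = 1 := by
  have h1 : ∀ a b : H, 𝓊 * (b * S (S a)) = sumT ℜ fun a' b' => S (b' * S b) * (a' * S (S a)) := by
    intro a b
    rw [← mul_assoc, drinfeld_mul, drinfeld_eq, mul_sumT, sumT_mul]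
    exact sumT_congr fun a' b' => by simp only [antipode_mul, mul_assoc]
  rw [drinfeldInv, mul_sumT, sumT_congr h1,
    sumT_antipode_R (k := k) (f := fun a b => sumT ℜ fun a' b' => S (b' * b) * (a' * S a))
      ⟨fun _ => by exact lin_sumT _ fun _ _ => by fun_prop,
       fun _ => by exact lin_sumT _ fun _ _ => by fun_prop⟩, sumT_sumT,
    sumT_R_mul_antipode (k := k) (f := fun a b => S b * a)
      ⟨fun _ => by fun_prop, fun _ => by fun_prop⟩, HopfAlgebra.antipode_one, mul_one]

theorem antipode_antipode_drinfeldInv : S (S 𝓋) = 𝓋 := by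
  have h1 := drinfeld_mul (k := k) (H := H) 𝓋
  have h2 := congrArg (· * 𝓋) h1
  simpa only [mul_assoc, drinfeld_mul_drinfeldInv, mul_one, one_mul] using h2.symm

theorem drinfeldInv_mul_drinfeld : 𝓋 * 𝓊 = 1 := by
  have h1 := drinfeld_mul (k := k) (H := H) 𝓋
  rw [antipode_antipode_drinfeldInv, drinfeld_mul_drinfeldInv] at h1
  exact h1.symm

theorem antipode_antipode_drinfeld : S (S 𝓊) = 𝓊 := by
  have h2 := congrArg (· * 𝓋) (drinfeld_mul (k := k) (H := H) 𝓊)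
  simpa only [mul_assoc, drinfeld_mul_drinfeldInv, mul_one, one_mul] using h2.symm

theorem drinfeldInv_mul (x : H) : 𝓋 * S (S x) = x * 𝓋 := by
  have h := congrArg (fun t => 𝓋 * t * 𝓋) (drinfeld_mul (k := k) x)
  simpa only [← mul_assoc, drinfeldInv_mul_drinfeld, one_mul,
    mul_assoc _ 𝓊 𝓋, drinfeld_mul_drinfeldInv, mul_one] using h.symm

theorem antipode_drinfeldInv_mul_antipode_drinfeld : S 𝓊 * S 𝓋 = 1 := by
  rw [← antipode_mul, drinfeldInv_mul_drinfeld, HopfAlgebra.antipode_one]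

variable (k H) in
/-- The element `S(u)⁻¹ u`, which implements the fourth power of the antipode. -/
noncomputable def antipodeFour : H := S 𝓋 * 𝓊

variable (k H) in
/-- The inverse of `antipodeFour`. -/
noncomputable def antipodeFourInv : H := S 𝓊 * 𝓋

local notation "𝓌" => antipodeFour k H
local notation "𝓌'" => antipodeFourInv k H

theorem antipode_antipodeFour : S 𝓌 = 𝓌' := by
  rw [antipodeFour, antipode_mul, antipode_antipode_drinfeldInv, antipodeFourInv]

theorem antipode_antipodeFourInv : S 𝓌' = 𝓌 := by
  rw [antipodeFourInv, antipode_mul, antipode_antipode_drinfeld, antipodeFour]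

theorem antipodeFour_mul_inv : 𝓌 * 𝓌' = 1 := by
  have h : 𝓊 * S 𝓊 = S 𝓊 * 𝓊 := by rw [drinfeld_mul, antipode_antipode_drinfeld]
  rw [antipodeFour, antipodeFourInv, mul_assoc, ← mul_assoc 𝓊, h, mul_assoc (S 𝓊),
    drinfeld_mul_drinfeldInv, mul_one, ← antipode_mul, drinfeld_mul_drinfeldInv,
    HopfAlgebra.antipode_one]

theorem antipodeFour_inv_mul : 𝓌' * 𝓌 = 1 := by
  have h := drinfeldInv_mul (k := k) (S 𝓋)
  rw [antipode_antipode_drinfeldInv] at h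
  rw [antipodeFour, antipodeFourInv, mul_assoc, ← mul_assoc 𝓋, h, mul_assoc (S 𝓋),
    drinfeldInv_mul_drinfeld, mul_one, antipode_drinfeldInv_mul_antipode_drinfeld]

theorem antipodeFour_mul (x : H) : 𝓌 * x = S (S (S (S x))) * 𝓌 := by
  have h := congrArg S (drinfeldInv_mul (k := k) (S x))
  simp only [antipode_mul] at h
  rw [antipodeFour, mul_assoc, drinfeld_mul, ← mul_assoc, ← mul_assoc, ← h]

theorem mul_antipodeFourInv (x : H) : x * 𝓌' = 𝓌' * S (S (S (S x))) := by
  have h := congrArg (fun t => 𝓌' * t * 𝓌') (antipodeFour_mul (k := k) x)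
  simpa only [← mul_assoc, antipodeFour_inv_mul, one_mul,
    mul_assoc _ 𝓌 𝓌', antipodeFour_mul_inv, mul_one] using h

end

section

variable {k H M : Type u} [Field k] [Ring H] [HopfAlgebra k H] [RibbonHopfAlgebra k H]
  [AddCommGroup M] [Module k M]

local notation "Δ" => Coalgebra.comul (R := k)
local notation "ε" => Coalgebra.counit (R := k)
local notation "S" => HopfAlgebra.antipode k
local notation "ℜ" => HopfRep.Rm k H
local notation "𝓊" => HopfRep.drinfeld k H
local notation "𝓋" => drinfeldInv k H
local notation "ϑ" => (HopfRep.twistElt k H : H)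

theorem sumT_comul_twist {f : H → H → M} (hf : IsBilin k f) :
    sumT (Δ ϑ) f = sumT ℜ fun a b => sumT ℜ fun a' b' => f (ϑ * b * a') (ϑ * a * b') := by
  have h : Δ ϑ = (ϑ ⊗ₜ[k] ϑ) * TensorProduct.comm k H H ℜ * ℜ := RibbonHopfAlgebra.comul_θ
  have h1 : (ϑ ⊗ₜ[k] ϑ) * TensorProduct.comm k H H ℜ =
      sumT ℜ fun a b => (ϑ * b) ⊗ₜ[k] (ϑ * a) := by
    conv_lhs => rw [← sumT_tmul_eq (TensorProduct.comm k H H ℜ), mul_sumT]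
    rw [sumT_comm (k := k) (f := fun x y => (ϑ ⊗ₜ[k] ϑ) * (x ⊗ₜ[k] y))
      ⟨fun _ => by fun_prop, fun _ => by fun_prop⟩]
    exact sumT_congr fun a b => Algebra.TensorProduct.tmul_mul_tmul _ _ _ _
  rw [h, h1, sumT_mul_tmul hf, sumT_sumT_left (hf.sumT_mul_mul ℜ)]
  exact sumT_congr fun a b => sumT_tmul (hf.sumT_mul_mul ℜ) _ _

theorem counit_twist : ε ϑ = 1 := by
  have h := sumT_comul_twist (k := k) (H := H) (f := fun a b => ε a • b)
    ⟨fun _ => by fun_prop, fun _ => by fun_prop⟩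
  have h1 : ∀ a b : H, sumT ℜ (fun a' b' => ε (ϑ * b * a') • (ϑ * a * b')) =
      ε ϑ • (ϑ * (ε b • a)) := fun a b => by
    have := congrArg (fun t => (ε ϑ * ε b) • (ϑ * a * t)) (sumT_counit_R (k := k) (H := H))
    simp only [mul_sumT, smul_sumT, mul_one] at this
    rw [mul_smul_comm, smul_smul, ← this]
    refine sumT_congr fun a' b' => ?_
    rw [Bialgebra.counit_mul, Bialgebra.counit_mul, mul_smul_comm, smul_smul]
  rw [counit_left (f := fun b => b) (by fun_prop), sumT_congr h1, ← smul_sumT, ← mul_sumT,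
    sumT_R_counit, mul_one] at h
  have h2 := congrArg (fun t => ε (t * (((HopfRep.twistElt k H)⁻¹ : Hˣ) : H))) h
  simpa using h2.symm

theorem twist_sq_mul : ϑ ^ 2 * (S 𝓊 * 𝓊) = 1 := by
  have h := sumT_comul_twist (k := k) (H := H) (f := fun a b => S a * b)
    ⟨fun _ => by fun_prop, fun _ => by fun_prop⟩
  have h1 : ∀ a b a' b' : H, S (ϑ * b * a') * (ϑ * a * b') = ϑ ^ 2 * (S a' * (S b * a) * b') := by
    intro a b a' b'
    have hc := HopfRep.twistElt_central (k := k) (H := H)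
    rw [antipode_mul, antipode_mul, HopfRep.antipode_twistElt, ← hc (S b), pow_two, mul_assoc ϑ a,
      ← mul_assoc _ ϑ, ← hc (S a' * _), ← mul_assoc (S a') ϑ, ← hc (S a')]
    simp only [mul_assoc]
  have h2 : ∀ a' b' : H, sumT ℜ (fun a b => S (ϑ * b * a') * (ϑ * a * b')) =
      ϑ ^ 2 * (S (S b' * a') * 𝓊) := fun a' b' => by
    rw [sumT_congr fun a b => h1 a b a' b', ← mul_sumT, ← sumT_mul, ← mul_sumT, ← drinfeld_eq,
      mul_assoc (S a'), drinfeld_mul, ← mul_assoc (S a'), antipode_mul]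
  rw [antipode_left, counit_twist, one_smul, sumT_sumT, sumT_congr h2, ← mul_sumT, ← sumT_mul,
    ← map_sumT, ← drinfeld_eq] at h
  exact h.symm

theorem twist_sq_mul_drinfeld_sq : ϑ ^ 2 * (𝓊 * 𝓊) = antipodeFour k H := by
  have h := congrArg (· * (S 𝓋 * 𝓊)) (twist_sq_mul (k := k) (H := H))
  have h1 : 𝓊 * S 𝓋 = S 𝓋 * 𝓊 := by rw [drinfeld_mul, antipode_antipode_drinfeldInv]
  simp only [one_mul] at h
  rw [antipodeFour, ← h, mul_assoc, mul_assoc, ← mul_assoc 𝓊 (S 𝓋), h1, ← mul_assoc (S 𝓊),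
    ← mul_assoc (S 𝓊), antipode_drinfeldInv_mul_antipode_drinfeld, one_mul]

theorem IsAdInvariant.antipodeBd_apply {f : Module.Dual k H} (hf : IsAdInvariant f) (x : H) :
    f (HopfRep.antipodeBd k H x) = f (antipodeFour k H * S x) := by
  have hc : ∀ x : H, ϑ ^ 2 * x = x * ϑ ^ 2 := fun x => by
    rw [pow_two, mul_assoc, HopfRep.twistElt_central, mul_assoc, HopfRep.twistElt_central,
      mul_assoc]
  have h1 : HopfRep.antipodeBd k H x = sumT ℜ fun a b => S a * (ϑ ^ 2 * (S x * 𝓊) * b) := by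
    change (HopfRep.adj k H).flip (ϑ ^ 2 * (S x * 𝓊)) ℜ = _
    rw [apply_eq_sumT]
    rfl
  have h2 : sumT ℜ (fun a b => S (S b) * S a) = 𝓊 := by
    rw [sumT_antipode_R (k := k) (f := fun a b => S b * a)
      ⟨fun _ => by fun_prop, fun _ => by fun_prop⟩, drinfeld_eq]
  have h3 : ∀ a b : H, f (S a * (ϑ ^ 2 * (S x * 𝓊) * b)) =
      f (S (S b) * S a * (ϑ ^ 2 * (S x * 𝓊))) := fun a b => by
    rw [← mul_assoc, hf.mul_comm, mul_assoc]
  rw [h1, map_sumT, sumT_congr h3, ← map_sumT, ← sumT_mul, h2, ← mul_assoc, ← mul_assoc,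
    hf.mul_comm, antipode_antipode_drinfeld, ← twist_sq_mul_drinfeld_sq, hc (𝓊 * 𝓊), ← mul_assoc,
    ← mul_assoc]

end

end HopfKirby

/-! ### The distinguished grouplike element and the map `T` -/

namespace HopfKirby

open TensorSum HopfSweedler

section

variable {k H : Type u} [Field k] [Ring H] [HopfAlgebra k H] [QuasitriangularHopfAlgebra k H]

local notation "Δ" => Coalgebra.comul (R := k)
local notation "ε" => Coalgebra.counit (R := k)
local notation "S" => HopfAlgebra.antipode k
local notation "ℜ" => HopfRep.Rm k H
local notation "𝓊" => HopfRep.drinfeld k H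
local notation "𝓋" => drinfeldInv k H
local notation "𝓌" => antipodeFour k H
local notation "𝓌'" => antipodeFourInv k H

/-- The element `h_ν = (id ⊗ ν)(R)`. -/
noncomputable def charR (ν : H →ₐ[k] k) : H := sumT ℜ fun a b => ν b • a

theorem T_eq (ν : H →ₐ[k] k) (z : H) : T ν z = harpoon ν.toLinearMap (S z) * charR ν := by
  have h : TensorProduct.rid k H (ν.toLinearMap.lTensor H ℜ) = charR ν := by
    rw [← LinearEquiv.coe_coe, ← LinearMap.comp_apply, apply_eq_sumT]
    rfl
  rw [T, h]

theorem antipode_antipode_charR (ν : H →ₐ[k] k) : S (S (charR ν)) = charR ν := by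
  have h1 : ∀ a b : H, S (S (ν b • a)) = ν (S (S b)) • S (S a) := fun a b => by
    rw [map_smul, map_smul, char_antipode_antipode]
  rw [charR, map_sumT, map_sumT, sumT_congr h1,
    sumT_antipode_R (k := k) (f := fun a b => ν (S b) • S a)
      ⟨fun _ => by fun_prop, fun _ => by fun_prop⟩,
    sumT_antipode_R (k := k) (f := fun a b => ν b • a)
      ⟨fun _ => by fun_prop, fun _ => by fun_prop⟩]

theorem charR_mul (ν : H →ₐ[k] k) (x : H) :
    charR ν * sumT (Δ x) (fun a b => ν b • a) = harpoon ν.toLinearMap x * charR ν := by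
  have h := sumT_R_comul (k := k) (H := H) (f := fun a b => ν b • a)
    ⟨fun _ => by fun_prop, fun _ => by fun_prop⟩ x
  have h1 : charR ν * sumT (Δ x) (fun a b => ν b • a) =
      sumT ℜ fun a b => sumT (Δ x) fun c d => ν (b * d) • (a * c) := by
    rw [charR, sumT_mul]
    refine sumT_congr fun a b => ?_
    rw [mul_sumT]
    refine sumT_congr fun c d => ?_
    rw [smul_mul_smul_comm, map_mul]
  rw [h1, h, sumT_sumT, harpoon_eq, sumT_mul]
  refine sumT_congr fun c d => ?_
  rw [charR, mul_sumT]
  refine sumT_congr fun a b => ?_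
  rw [smul_mul_smul_comm, map_mul]
  rfl

theorem harpoon_char_antipode (ν : H →ₐ[k] k) (x : H) :
    sumT (Δ x) (fun a b => ν (S b) • sumT (Δ a) fun c d => ν d • c) = x := by
  have h := coassoc (k := k) (f := fun c d b => ν (S b) • ν d • c)
    ⟨fun _ _ => by fun_prop, fun _ _ => by fun_prop, fun _ _ => by fun_prop⟩ x
  simp only [smul_sumT]
  rw [h]
  have h1 : ∀ a b : H, sumT (Δ b) (fun d e => ν (S e) • ν d • a) = ε b • a := fun a b => by
    rw [← charMul_antipode ν b, sumT_smul]
    exact sumT_congr fun d e => by rw [smul_smul, _root_.mul_comm]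
  rw [sumT_congr h1, counit_right (f := fun a => a) (by fun_prop)]

theorem mul_antipode_of_mem_L (hS : Function.Surjective (HopfAlgebra.antipode k (A := H)))
    {ν : H →ₐ[k] k} {z : H} (hz : z ∈ L ν) (x : H) :
    x * S z = S z * sumT (Δ x) fun a b => ν (S b) • a := by
  obtain ⟨y, rfl⟩ := hS x
  rw [← antipode_mul, ← hz, antipode_mul, harpoon_eq, map_sumT,
    sw_antipode ⟨fun _ => by fun_prop, fun _ => by fun_prop⟩]
  congr 1
  refine sumT_congr fun a b => ?_
  rw [map_smul, char_antipode_antipode]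
  rfl

theorem T_mem_L (hS : Function.Surjective (HopfAlgebra.antipode k (A := H)))
    {ν : H →ₐ[k] k} {z : H} (hz : z ∈ L ν) : T ν z ∈ L ν := by
  intro x
  have h1 : sumT (Δ x) (fun a b => ν (S b) • harpoon ν.toLinearMap a) * charR ν =
      charR ν * x := by
    conv_rhs => rw [← harpoon_char_antipode ν x, mul_sumT]
    rw [sumT_mul]
    exact sumT_congr fun a b => by rw [smul_mul_assoc, mul_smul_comm, charR_mul]
  have h2 : harpoon ν.toLinearMap (sumT (Δ x) fun a b => ν (S b) • a) =
      sumT (Δ x) fun a b => ν (S b) • harpoon ν.toLinearMap a := by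
    have hl : IsLinearMap k fun x : H => harpoon ν.toLinearMap x := by fun_prop
    refine (map_sumT (hl.mk' _) _ _).trans (sumT_congr fun a b => ?_)
    exact hl.map_smul _ _
  rw [T_eq, ← mul_assoc, ← harpoon_mul, mul_antipode_of_mem_L hS hz, harpoon_mul, h2, mul_assoc,
    h1, mul_assoc]

theorem sumT_R_harpoon {M : Type u} [AddCommGroup M] [Module k M] (ν : H →ₐ[k] k) {f : H → H → M}
    (hf : IsBilin k f) :
    sumT ℜ (fun a b => f a (harpoon ν.toLinearMap b)) = sumT ℜ fun a b => f (a * charR ν) b := by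
  have h := sumT_id_comul (k := k) (H := H) (f := fun a c d => ν c • f a d)
    ⟨fun _ _ => lin_smul_right _ (hf.left _), fun a d => lin_smul_left (by fun_prop) (f a d),
      fun _ _ => lin_smul_right _ (hf.right _)⟩
  have h1 : ∀ a b : H, f a (harpoon ν.toLinearMap b) = sumT (Δ b) fun c d => ν c • f a d := by
    intro a b
    rw [harpoon_eq]
    refine (map_sumT ((hf.right a).mk' _) _ _).trans (sumT_congr fun c d => ?_)
    exact (hf.right a).map_smul _ _
  rw [sumT_congr h1, h, sumT_sumT]
  have h2 : ∀ a b : H, f (a * charR ν) b = sumT ℜ fun a' b' => ν b' • f (a * a') b := by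
    intro a b
    rw [charR, mul_sumT]
    refine (map_sumT ((hf.left b).mk' _) _ _).trans (sumT_congr fun c d => ?_)
    rw [mul_smul_comm]
    exact (hf.left b).map_smul _ _
  rw [sumT_congr h2, sumT_sumT]

theorem sumT_comul_snd_drinfeldInv {M : Type u} [AddCommGroup M] [Module k M] {f : H → H → M}
    (hf : IsBilin k f) :
    sumT ℜ (fun a b => sumT (Δ b) fun b₁ b₂ => f b₁ (b₂ * S (S a))) =
      sumT ℜ fun a b => f b (𝓋 * S (S a)) := by
  rw [sumT_id_comul (k := k) (H := H) (f := fun a b c => f b (c * S (S a)))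
    ⟨fun _ _ => lin_comp (hf.right _) (by fun_prop), fun _ _ => hf.left _,
      fun _ _ => lin_comp (hf.right _) (by fun_prop)⟩, sumT_sumT]
  refine sumT_congr fun a b => ?_
  rw [drinfeldInv, sumT_mul]
  refine Eq.trans ?_ (map_sumT ((hf.right b).mk' _) _ _).symm
  refine sumT_congr fun a' b' => ?_
  rw [IsLinearMap.mk'_apply]
  simp only [antipode_mul, mul_assoc]

theorem sumT_comul_snd_drinfeld {M : Type u} [AddCommGroup M] [Module k M] {f : H → H → M}
    (hf : IsBilin k f) :
    sumT ℜ (fun a b => sumT (Δ b) fun b₁ b₂ => f b₁ (S a * S (S b₂))) =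
      sumT ℜ fun a b => f b (S a * S 𝓊) := by
  rw [sumT_id_comul (k := k) (H := H) (f := fun a b c => f b (S a * S (S c)))
    ⟨fun _ _ => lin_comp (hf.right _) (by fun_prop), fun _ _ => hf.left _,
      fun _ _ => lin_comp (hf.right _) (by fun_prop)⟩, sumT_sumT]
  refine sumT_congr fun a b => ?_
  rw [drinfeld_eq, map_sumT, mul_sumT]
  refine Eq.trans ?_ (map_sumT ((hf.right b).mk' _) _ _).symm
  refine sumT_congr fun a' b' => ?_
  rw [IsLinearMap.mk'_apply]
  simp only [antipode_mul, mul_assoc]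

variable {lam : Module.Dual k H}

theorem sumT_comul_lam (y : H) :
    sumT (Δ y) (fun c d => lam d • c) = sumT ℜ fun a b => sumT ℜ fun a' b' => sumT (Δ y) fun c d =>
      lam (b * (c * b')) • (S a * (d * a')) := by
  have h1 : ∀ c d : H, lam d • c = sumT ℜ fun a b => sumT ℜ fun a' b' =>
      lam (b * b' * d) • (S a * a' * c) := fun c d => by
    rw [sumT_antipode_R_mul (k := k) (f := fun p q => lam (q * d) • (p * c))
      ⟨fun _ => by fun_prop, fun _ => by fun_prop⟩, one_mul, one_mul]
  rw [sumT_congr h1, sumT_sumT]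
  refine sumT_congr fun a b => ?_
  have h := sumT_R_comul (k := k) (H := H) (f := fun p q => lam (b * q) • (S a * p))
    ⟨fun _ => by fun_prop, fun _ => by fun_prop⟩ y
  rw [sumT_sumT, ← h]
  refine sumT_congr fun a' b' => sumT_congr fun c d => ?_
  simp only [mul_assoc]

theorem antipode_sumT_R (hlam : IsRightIntegral lam) (y : H) :
    S (sumT ℜ fun a b => sumT ℜ fun a' b' => sumT (Δ y) fun c d =>
      lam (S (S b') * (b * c)) • (S a * (d * a'))) = lam y • 𝓌' := by
  have h1 : ∀ a b a' b' : H, S (sumT (Δ y) fun c d =>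
      lam (S (S b') * (b * c)) • (S a * (d * a'))) =
      sumT (Δ b') fun p q => sumT (Δ b) fun p' q' =>
        lam (S (S p) * p' * y) • (S a' * S (S q) * (q' * S (S a))) := by
    intro a b a' b'
    have h2 := congrArg (fun t => S a' * t * S (S a))
      (hlam.antipode_eq (S (S b') * b) y)
    simp only [mul_sumT, sumT_mul] at h2
    have h3 : ∀ c d : H, S (lam (S (S b') * (b * c)) • (S a * (d * a'))) =
        S a' * lam (S (S b') * b * c) • S d * S (S a) := fun c d => by
      simp only [map_smul, antipode_mul, mul_assoc, mul_smul_comm, smul_mul_assoc]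
    rw [map_sumT, sumT_congr h3, ← h2,
      sw_mul (k := k) (f := fun p q => S a' * lam (p * y) • q * S (S a))
        ⟨fun _ => by fun_prop, fun _ => by fun_prop⟩,
      sw_antipode (k := k) ⟨fun _ => by exact lin_sumT _ fun _ _ => by fun_prop,
        fun _ => by exact lin_sumT _ fun _ _ => by fun_prop⟩,
      sw_antipode (k := k) ⟨fun _ => by exact lin_sumT _ fun _ _ => by fun_prop,
        fun _ => by exact lin_sumT _ fun _ _ => by fun_prop⟩]
    refine sumT_congr fun p q => sumT_congr fun p' q' => ?_
    simp only [mul_assoc, mul_smul_comm, smul_mul_assoc]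
  have h2 : ∀ a' b' : H, sumT ℜ (fun a b => sumT (Δ b') fun p q => sumT (Δ b) fun p' q' =>
        lam (S (S p) * p' * y) • (S a' * S (S q) * (q' * S (S a)))) =
      sumT (Δ b') fun p q => sumT ℜ fun a b =>
        lam (S (S p) * b * y) • (S a' * S (S q) * (𝓋 * S (S a))) := by
    intro a' b'
    rw [sumT_sumT]
    refine sumT_congr fun p q => ?_
    exact sumT_comul_snd_drinfeldInv (k := k)
      (f := fun c d => lam (S (S p) * c * y) • (S a' * S (S q) * d))
      ⟨fun _ => by fun_prop, fun _ => by fun_prop⟩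
  have h3 : ∀ a b : H, sumT ℜ (fun a' b' => sumT (Δ b') fun p q =>
        lam (S (S p) * b * y) • (S a' * S (S q) * (𝓋 * S (S a)))) =
      sumT ℜ fun a' b' => lam (S (S b') * b * y) • (S a' * S 𝓊 * (𝓋 * S (S a))) := fun a b =>
    sumT_comul_snd_drinfeld (k := k)
      (f := fun c d => lam (S (S c) * b * y) • (d * (𝓋 * S (S a))))
      ⟨fun _ => by fun_prop, fun _ => by fun_prop⟩
  have h4 : ∀ a b : H, sumT ℜ (fun a' b' =>
        lam (S (S b') * b * y) • (S a' * S 𝓊 * (𝓋 * S (S a)))) =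
      sumT ℜ fun a' b' => lam (b' * b * y) • (𝓌' * S (S (S a' * a))) := by
    intro a b
    have h5 : ∀ a' : H, S a' * S 𝓊 * (𝓋 * S (S a)) = 𝓌' * (S (S (S (S (S a')))) * S (S a)) := by
      intro a'
      rw [← mul_assoc 𝓌', ← mul_antipodeFourInv, antipodeFourInv]
      simp only [mul_assoc]
    simp only [h5]
    rw [sumT_antipode_R (k := k) (f := fun p q => lam (S q * b * y) •
        (𝓌' * (S (S (S (S p))) * S (S a)))) ⟨fun _ => by fun_prop, fun _ => by fun_prop⟩,
      sumT_antipode_R (k := k) (f := fun p q => lam (q * b * y) •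
        (𝓌' * (S (S (S p)) * S (S a)))) ⟨fun _ => by fun_prop, fun _ => by fun_prop⟩]
    exact sumT_congr fun _ _ => by simp only [antipode_mul]
  rw [map_sumT]
  simp only [map_sumT, h1]
  rw [sumT_sumT]
  simp only [h2]
  have h6 : sumT ℜ (fun a' b' => sumT (Δ b') fun p q => sumT ℜ fun a b =>
        lam (S (S p) * b * y) • (S a' * S (S q) * (𝓋 * S (S a)))) =
      sumT ℜ fun a b => sumT ℜ fun a' b' => sumT (Δ b') fun p q =>
        lam (S (S p) * b * y) • (S a' * S (S q) * (𝓋 * S (S a))) := by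
    rw [sumT_sumT]
    exact sumT_congr fun _ _ => sumT_sumT _ _ _
  rw [h6, sumT_congr h3, sumT_congr h4, sumT_sumT,
    sumT_antipode_R_mul (k := k) (f := fun p q => lam (q * y) • (𝓌' * S (S p)))
      ⟨fun _ => by fun_prop, fun _ => by fun_prop⟩]
  simp only [one_mul, HopfAlgebra.antipode_one, mul_one]

variable [FiniteDimensional k H]

/-- The distinguished grouplike element of `H` is `S(u)⁻¹ u h_ν`. -/
theorem IsRightIntegral.sumT_comul_eq (hlam : IsRightIntegral lam) (h0 : lam ≠ 0) {ν : H →ₐ[k] k}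
    (hν : IsDistinguished ν) (y : H) :
    sumT (Δ y) (fun a b => lam b • a) = lam y • (𝓌 * charR ν) := by
  have h1 : ∀ a b : H, sumT ℜ (fun a' b' => sumT (Δ y) fun c d =>
      lam (b * (c * b')) • (S a * (d * a'))) =
      sumT ℜ (fun a' b' => sumT (Δ y) fun c d =>
        lam (S (S b') * (b * c)) • (S a * (d * a'))) * charR ν := by
    intro a b
    have h2 : ∀ a' b' : H, sumT (Δ y) (fun c d => lam (b * (c * b')) • (S a * (d * a'))) =
        sumT (Δ y) fun c d => lam (S (S (harpoon ν.toLinearMap b')) * (b * c)) •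
          (S a * (d * a')) := fun a' b' => sumT_congr fun c d => by
      rw [← mul_assoc, hlam.mul_comm h0 hν]
    rw [sumT_congr h2, sumT_R_harpoon (k := k) ν (f := fun a' b' => sumT (Δ y) fun c d =>
        lam (S (S b') * (b * c)) • (S a * (d * a')))
      ⟨fun _ => by exact lin_sumT _ fun _ _ => by fun_prop,
        fun _ => by exact lin_sumT _ fun _ _ => by fun_prop⟩, sumT_mul]
    refine sumT_congr fun a' b' => ?_
    rw [sumT_mul]
    exact sumT_congr fun c d => by simp only [smul_mul_assoc, mul_assoc]
  have h2 := antipode_sumT_R hlam y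
  rw [← antipode_antipodeFour, ← map_smul] at h2
  rw [sumT_comul_lam, sumT_congr h1, ← sumT_mul, (hlam.antipode_bijective h0).1 h2,
    smul_mul_assoc]

theorem IsRightIntegral.antipodeFour_mul_antipode (hlam : IsRightIntegral lam) (h0 : lam ≠ 0)
    {ν : H →ₐ[k] k} (hν : IsDistinguished ν) (z x : H) (hx : ∀ y, x * y = y * x) :
    lam (z * (𝓌 * S x)) = lam (T ν z * x) := by
  obtain ⟨y, rfl⟩ := (hlam.antipode_bijective h0).2 z
  have h1 : S y * (𝓌 * S x) = S (x * (𝓌' * y)) := by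
    rw [antipode_mul, antipode_mul, antipode_antipodeFourInv, mul_assoc]
  have h2 : 𝓌 * charR ν * 𝓌' = charR ν := by
    rw [antipodeFour_mul, antipode_antipode_charR, antipode_antipode_charR, mul_assoc,
      antipodeFour_mul_inv, mul_one]
  have h3 : 𝓌 * charR ν * (x * (𝓌' * y)) = charR ν * x * y := by
    rw [← mul_assoc x, hx, ← mul_assoc, ← mul_assoc, h2]
  rw [h1, hlam.comp_antipode h0 hν (hlam.sumT_comul_eq h0 hν), h3, hlam.mul_comm h0 hν, T_eq,
    antipode_antipode_harpoon, mul_assoc]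

end

end HopfKirby

/-! ### Negligible morphisms from the unit object and morphisms from the coend -/

namespace HRep

open RibbonCategory TensorSum HopfSweedler HopfKirby

section

variable {k H : Type u} [Field k] [Ring H] [HopfAlgebra k H]

local notation "Δ" => Coalgebra.comul (R := k)
local notation "ε" => Coalgebra.counit (R := k)
local notation "S" => HopfAlgebra.antipode k

/-- A morphism to the unit object, as a linear form. -/
def form {X : HRep k H} (g : X ⟶ 𝟙_ (HRep k H)) : Module.Dual k X.V := g.lin

theorem form_comm {X : HRep k H} (g : X ⟶ 𝟙_ (HRep k H)) (h : H) (v : X.V) :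
    form g (X.ρ h v) = ε h * form g v := g.comm h v

theorem contractLeft_comm_coevaluation :
    contractLeft k k (TensorProduct.comm k k (Module.Dual k k) (coevaluation k k 1)) = 1 := by
  have h : contractLeft k k = (LinearMap.applyₗ (1 : k)) ∘ₗ dualTensorHom k k k :=
    TensorProduct.ext' fun l v => by
      change l v = l 1 * v
      rw [_root_.mul_comm, ← smul_eq_mul, ← map_smul, smul_eq_mul, mul_one]
  rw [h, LinearMap.comp_apply, HopfRep.coevaluation_id]
  rfl

section

variable [RibbonHopfAlgebra k H]

theorem qTrace_unit (f : 𝟙_ (HRep k H) ⟶ 𝟙_ (HRep k H)) :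
    form (qTrace f) (1 : k) = ε (HopfRep.drinfeld k H) * form f (1 : k) := by
  have key : (form (f ▷ (𝟙_ (HRep k H)).dual ≫ evTilde (𝟙_ (HRep k H))) :
      k ⊗[k] Module.Dual k k →ₗ[k] k) =
      (ε (HopfRep.drinfeld k H) * form f (1 : k)) •
        (contractLeft k k ∘ₗ (TensorProduct.comm k k (Module.Dual k k)).toLinearMap) := by
    refine TensorProduct.ext' fun (c : k) (l : Module.Dual k k) => ?_
    refine (HopfRep.contractLeft_braid (HopfRep.triv k H)
      (HopfRep.triv k H (HopfRep.twistElt k H : H) (form f c)) l).trans ?_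
    have hc : form f c = c * form f (1 : k) := by
      refine Eq.trans ?_ ((form f).map_smul c (1 : k))
      exact congrArg (form f) (mul_one c).symm
    rw [HopfRep.triv_apply, HopfRep.triv_apply, counit_twist, one_mul, hc]
    generalize form f (1 : k) = d
    have hl : ∀ e : k, l e = e * l 1 := fun e => by
      rw [← smul_eq_mul, ← map_smul, smul_eq_mul, mul_one]
    change l _ = (ε (HopfRep.drinfeld k H) * d) * l c
    rw [hl, hl c]
    ring
  refine (LinearMap.congr_fun key (coevaluation k k 1)).trans ?_
  exact (congrArg _ contractLeft_comm_coevaluation).trans (mul_one _)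

theorem counit_drinfeld_ne_zero : ε (HopfRep.drinfeld k H) ≠ 0 := fun h => by
  have := congrArg ε (drinfeld_mul_drinfeldInv (k := k) (H := H))
  rw [Bialgebra.counit_mul, h, zero_mul, Bialgebra.counit_one] at this
  exact zero_ne_one this

theorem negligible_iff {X : HRep k H} (α : 𝟙_ (HRep k H) ⟶ X) :
    Negligible α ↔ ∀ g : X ⟶ 𝟙_ (HRep k H), form g (α.lin (1 : k)) = 0 := by
  refine forall_congr' fun g => ?_
  have h1 := qTrace_unit (α ≫ g)
  refine ⟨fun h => ?_, fun h => hom_ext (LinearMap.ext_ring ?_)⟩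
  · rw [h] at h1
    exact (mul_eq_zero.mp h1.symm).resolve_left counit_drinfeld_ne_zero
  · refine h1.trans ?_
    exact (congrArg _ h).trans (mul_zero _)

end

theorem rightAdj_of_central {a : H} (ha : a ∈ Subalgebra.center k H) (h : H) :
    HopfRep.rightAdj k H h a = ε h • a := by
  have h1 : ∀ b c : H, S b * (a * c) = S b * c * a := fun b c => by
    rw [← Subalgebra.mem_center_iff.mp ha, mul_assoc]
  rw [rightAdj_apply, sumT_congr h1, ← sumT_mul, antipode_left, smul_mul_assoc, one_mul]

theorem central_of_rightAdj {a : H} (ha : ∀ h, HopfRep.rightAdj k H h a = ε h • a) :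
    a ∈ Subalgebra.center k H := by
  refine Subalgebra.mem_center_iff.mpr fun x => ?_
  have h := coassoc (k := k) (f := fun b c d => b * (S c * (a * d)))
    ⟨fun _ _ => by fun_prop, fun _ _ => by fun_prop, fun _ _ => by fun_prop⟩ x
  have h1 : ∀ b c : H, sumT (Δ b) (fun d e => d * (S e * (a * c))) = ε b • (a * c) := fun b c => by
    simp only [← mul_assoc]
    rw [← sumT_mul, ← sumT_mul, antipode_right, smul_mul_assoc, smul_mul_assoc, one_mul]
  simp only [← mul_sumT, ← rightAdj_apply, ha, h1, mul_smul_comm] at h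
  rw [counit_left (f := fun c => a * c) (by fun_prop),
    counit_right (f := fun c => c * a) (by fun_prop)] at h
  exact h.symm

variable [FiniteDimensional k H]

theorem coadjoint_hom_iff (w : Module.Dual k H) :
    (∀ g : coadjoint k H ⟶ 𝟙_ (HRep k H), form g w = 0) ↔
      ∀ a ∈ Subalgebra.center k H, w a = 0 := by
  refine ⟨fun hw a ha => hw ⟨Module.Dual.eval k H a, fun h (f : Module.Dual k H) => ?_⟩,
    fun hw g => ?_⟩
  · change f (HopfRep.rightAdj k H h a) = ε h * f a
    rw [rightAdj_of_central ha, map_smul, smul_eq_mul]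
  · obtain ⟨a, ha⟩ := (Module.evalEquiv k H).surjective (form g)
    have h1 : ∀ f : Module.Dual k H, form g f = f a := fun f =>
      (LinearMap.congr_fun ha f).symm
    rw [h1]
    refine hw a (central_of_rightAdj fun h => ?_)
    rw [← sub_eq_zero, ← Module.forall_dual_apply_eq_zero_iff k]
    intro f
    have h2 : form g (HopfRep.coadj k H h f) = ε h * form g f := form_comm g h f
    rw [h1, h1] at h2
    rw [map_sub, map_smul, smul_eq_mul, ← h2, sub_eq_zero]
    rfl

theorem dualDistrib_tens_coadj (h : H) (w : Module.Dual k H ⊗[k] Module.Dual k H) (X : H ⊗[k] H) :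
    TensorProduct.dualDistrib k H H
      (HopfRep.tens (HopfRep.coadj k H) (HopfRep.coadj k H) h w) X =
      TensorProduct.dualDistrib k H H w (rightAdj₂ k h X) := by
  have key : ∀ t : H ⊗[k] H, TensorProduct.dualDistrib k H H
      (HopfRep.act (HopfRep.coadj k H) (HopfRep.coadj k H) t w) X =
      TensorProduct.dualDistrib k H H w (TensorProduct.homTensorHomMap (RingHom.id k) H H H H
        (TensorProduct.map (HopfRep.rightAdj k H) (HopfRep.rightAdj k H) t) X) := by
    intro t
    induction t with
    | zero => simp
    | add a b ha hb => simp only [map_add, LinearMap.add_apply, ha, hb]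
    | tmul a b =>
      induction w with
      | zero => simp
      | add p q hp hq => simp only [map_add, LinearMap.add_apply, hp, hq]
      | tmul f g =>
        induction X with
        | zero => simp
        | add p q hp hq => simp only [map_add, hp, hq]
        | tmul x y => rfl
  exact key _

theorem coadjoint_tensor_hom_iff (w : Module.Dual k H ⊗[k] Module.Dual k H) :
    (∀ g : coadjoint k H ⊗ coadjoint k H ⟶ 𝟙_ (HRep k H), form g w = 0) ↔
      ∀ X ∈ V₂ k H, TensorProduct.dualDistrib k H H w X = 0 := by
  refine ⟨fun hw X hX => hw ⟨(TensorProduct.dualDistrib k H H).flip X,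
    fun h (f : Module.Dual k H ⊗[k] Module.Dual k H) => ?_⟩, fun hw g => ?_⟩
  · refine (dualDistrib_tens_coadj h f X).trans ?_
    have h1 : rightAdj₂ k h X = ε h • X := hX h
    rw [h1, map_smul]
    rfl
  · obtain ⟨X, hX⟩ := (Module.evalEquiv k (H ⊗[k] H)).surjective
      (form g ∘ₗ (TensorProduct.dualDistribEquiv k H H).symm.toLinearMap)
    have h1 : ∀ f : Module.Dual k H ⊗[k] Module.Dual k H,
        form g f = TensorProduct.dualDistrib k H H f X := fun f => by
      have h2 := LinearMap.congr_fun hX (TensorProduct.dualDistribEquiv k H H f)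
      refine (congrArg (form g) ?_).trans h2.symm
      exact ((TensorProduct.dualDistribEquiv k H H).symm_apply_apply f).symm
    rw [h1]
    refine hw X fun h => ?_
    rw [← sub_eq_zero, ← Module.forall_dual_apply_eq_zero_iff k]
    intro φ
    obtain ⟨f, rfl⟩ := (TensorProduct.dualDistribEquiv k H H).surjective φ
    have h2 : form g (HopfRep.tens (HopfRep.coadj k H) (HopfRep.coadj k H) h f) = ε h * form g f :=
      form_comm g h f
    rw [h1, h1, dualDistrib_tens_coadj] at h2
    rw [map_sub, map_smul, smul_eq_mul, sub_eq_zero]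
    exact h2

end

end HRep

/-! ### The Kirby elements of `H` -/

namespace HopfKirby

open RibbonCategory TensorSum HopfSweedler

section

variable {k H : Type u} [Field k] [Ring H] [HopfAlgebra k H]

local notation "Δ" => Coalgebra.comul (R := k)
local notation "ε" => Coalgebra.counit (R := k)
local notation "S" => HopfAlgebra.antipode k
local notation "ℜ" => HopfRep.Rm k H

theorem slide_tmul (x y : H) : slide k H (x ⊗ₜ y) = sumT (Δ x) fun a b => a ⊗ₜ (b * y) := by
  refine (apply_eq_sumT ((LinearMap.mul' k H).lTensor H ∘ₗ
    (TensorProduct.assoc k H H H).toLinearMap ∘ₗ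
    (TensorProduct.mk k (H ⊗[k] H) H).flip y) (Δ x)).trans ?_
  rfl

theorem lamSq_tmul (lam : Module.Dual k H) (z x y : H) :
    lamSq lam z (x ⊗ₜ y) = lam (z * x) * lam (z * y) := rfl

theorem slide_adBraid_tmul (x y : H) :
    slide k H (adBraid (x ⊗ₜ y)) = sumT (Δ y) fun a b => a ⊗ₜ (x * b) := by
  have h1 : ∀ a b : H, slide k H (a ⊗ₜ HopfRep.rightAdj k H b x) =
      sumT (Δ a) fun c d => c ⊗ₜ (d * HopfRep.rightAdj k H b x) := fun a b => slide_tmul _ _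
  have h2 : ∀ b : H, sumT (Δ b) (fun c d => c * HopfRep.rightAdj k H d x) = x * b := fun b => by
    have h3 := coassoc (k := k) (f := fun c d e => c * (S d * (x * e)))
      ⟨fun _ _ => by fun_prop, fun _ _ => by fun_prop, fun _ _ => by fun_prop⟩ b
    simp only [rightAdj_apply, mul_sumT, ← h3]
    simp only [← mul_assoc]
    simp only [← sumT_mul, antipode_right, smul_mul_assoc, one_mul]
    rw [counit_left (f := fun c => x * c) (by fun_prop)]
  rw [adBraid_tmul, map_sumT, sumT_congr h1,
    coassoc (k := k) (f := fun c d e => c ⊗ₜ[k] (d * HopfRep.rightAdj k H e x))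
      ⟨fun _ _ => by fun_prop, fun _ _ => by fun_prop, fun _ _ => by fun_prop⟩]
  refine sumT_congr fun a b => ?_
  rw [← h2]
  exact (map_sumT (TensorProduct.mk k H H a) _ _).symm

theorem lamSq_adBraid {lam : Module.Dual k H} {z : H} (hz : IsAdInvariant (lamMul lam z))
    (X : H ⊗[k] H) : lamSq lam z (adBraid X) = lamSq lam z X := by
  have h : lamSq lam z ∘ₗ adBraid = lamSq lam z := TensorProduct.ext' fun x y => by
    have h1 : ∀ a b : H, lamSq lam z (a ⊗ₜ HopfRep.rightAdj k H b x) =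
        ε b • (lam (z * a) * lam (z * x)) := fun a b => by
      have h2 := hz b x
      rw [lamMul_apply, lamMul_apply] at h2
      rw [lamSq_tmul, h2, smul_eq_mul]
      ring
    rw [LinearMap.comp_apply, adBraid_tmul, map_sumT, sumT_congr h1,
      counit_right (f := fun a => lam (z * a) * lam (z * x)) ⟨fun a b => by
        rw [mul_add, map_add, add_mul], fun c a => by
        rw [mul_smul_comm, map_smul, smul_mul_assoc]⟩, lamSq_tmul, mul_comm]
  exact LinearMap.congr_fun h X

variable [FiniteDimensional k H]

theorem adBraid_mem_V₂_iff (hS : Function.Bijective (HopfAlgebra.antipode k (A := H)))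
    (X : H ⊗[k] H) : adBraid X ∈ V₂ k H ↔ X ∈ V₂ k H := by
  have hinj : Function.Injective (adBraid (k := k) (H := H)) :=
    LinearMap.injective_iff_surjective.mpr (adBraid_surjective hS)
  refine forall_congr' fun h => ?_
  change rightAdj₂ k h (adBraid X) = ε h • adBraid X ↔ rightAdj₂ k h X = ε h • X
  rw [← adBraid_rightAdj₂, ← map_smul, hinj.eq_iff]

variable [RibbonHopfAlgebra k H]

theorem dualMul_apply_of_isAdInvariant {f : Module.Dual k H} (hf : IsAdInvariant f)
    (q : Module.Dual k H) (y : H) :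
    HopfRep.dualMul k H (q ⊗ₜ f) y = sumT (Δ y) fun a b => f a * q b := by
  have h1 : ∀ c d : H, TensorProduct.dualDistrib k H H (q ⊗ₜ f)
      (HopfRep.braidedMap ℜ (c ⊗ₜ[k] d)) = f c * q d := fun c d => by
    have h2 := apply_eq_sumT (TensorProduct.dualDistrib k H H (q ⊗ₜ f) ∘ₗ
      (HopfRep.braidedMap (k := k) (H := H)).flip (c ⊗ₜ[k] d)) ℜ
    refine h2.trans ?_
    have h3 : ∀ a b : H, (TensorProduct.dualDistrib k H H (q ⊗ₜ f) ∘ₗ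
        (HopfRep.braidedMap (k := k) (H := H)).flip (c ⊗ₜ[k] d)) (a ⊗ₜ b) =
        (f c • (q ∘ₗ LinearMap.mulLeft k d)) (ε b • a) := fun a b => by
      change q (d * a) * f (HopfRep.rightAdj k H b c) = f c * q (d * (ε b • a))
      rw [hf, mul_smul_comm, map_smul, smul_eq_mul]
      ring
    rw [sumT_congr h3, ← map_sumT, sumT_R_counit]
    change f c * q (d * 1) = _
    rw [mul_one]
  rw [HopfRep.dualMul_apply]
  refine (apply_eq_sumT (TensorProduct.dualDistrib k H H (q ⊗ₜ f) ∘ₗ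
    HopfRep.braidedMap ℜ) (Δ y)).trans ?_
  exact sumT_congr h1

theorem dualDistrib_lTensor_dualMul {f : Module.Dual k H} (hf : IsAdInvariant f)
    (w : Module.Dual k H ⊗[k] Module.Dual k H) (x y : H) :
    TensorProduct.dualDistrib k H H ((HopfRep.dualMul k H).lTensor (Module.Dual k H)
      (TensorProduct.assoc k _ _ _ (w ⊗ₜ f))) (x ⊗ₜ y) =
      sumT (Δ y) fun a b => f a * TensorProduct.dualDistrib k H H w (x ⊗ₜ b) := by
  induction w with
  | zero => simp [sumT]
  | add p q hp hq =>
    simp only [TensorProduct.add_tmul, map_add, LinearMap.add_apply, hp, hq, mul_add]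
    exact Finset.sum_add_distrib.symm
  | tmul p q =>
    change p x * HopfRep.dualMul k H (q ⊗ₜ f) y = sumT (Δ y) fun a b => f a * (p x * q b)
    rw [dualMul_apply_of_isAdInvariant hf, mul_sumT]
    exact sumT_congr fun a b => mul_left_comm _ _ _

theorem dualDistrib_gammaL {lam : Module.Dual k H} {z : H} (hz : IsAdInvariant (lamMul lam z))
    (X : H ⊗[k] H) :
    TensorProduct.dualDistrib k H H ((HopfRep.dualMul k H).lTensor (Module.Dual k H)
      (TensorProduct.assoc k _ _ _ (HopfRep.dualComul k H (lamMul lam z) ⊗ₜ lamMul lam z))) X =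
      lamSq lam z (slide k H (adBraid X)) := by
  have h : TensorProduct.dualDistrib k H H ((HopfRep.dualMul k H).lTensor (Module.Dual k H)
      (TensorProduct.assoc k _ _ _ (HopfRep.dualComul k H (lamMul lam z) ⊗ₜ lamMul lam z))) =
      lamSq lam z ∘ₗ slide k H ∘ₗ adBraid := TensorProduct.ext' fun x y => by
    rw [dualDistrib_lTensor_dualMul hz, LinearMap.comp_apply, LinearMap.comp_apply,
      slide_adBraid_tmul, map_sumT]
    refine sumT_congr fun a b => ?_
    rw [HopfRep.dualDistrib_dualComul]
    rfl
  exact LinearMap.congr_fun h X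

theorem phi_one (lam : Module.Dual k H) (z : H) : phi lam z 1 = lamMul lam z :=
  one_smul _ _

theorem mem_kirby_iff {lam : Module.Dual k H} (hlam : IsRightIntegral lam) (h0 : lam ≠ 0)
    {ν : H →ₐ[k] k} (hν : IsDistinguished ν) (z : H)
    (α : 𝟙_ (HRep k H) ⟶ (HRep.repCoend k H).A) (hα : α.lin = phi lam z)
    (hz : IsAdInvariant (lamMul lam z)) :
    α ∈ (HRep.repCoend k H).kirby ↔
      (∀ a ∈ Subalgebra.center k H, lam (T ν z * a) = lam (z * a)) ∧
      ∀ X ∈ V₂ k H, lamSq lam z (slide k H X) = lamSq lam z X := by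
  have hS := hlam.antipode_bijective h0
  let β : Module.Dual k H := α.lin (1 : k)
  have h1 : β = lamMul lam z :=
    (LinearMap.congr_fun hα (1 : k)).trans (phi_one lam z)
  refine and_congr ?_ ?_
  · rw [HRep.negligible_iff]
    have h2 : (α ≫ (HRep.repCoend k H).antipode - α).lin (1 : k) =
        HopfRep.dualAntipode k H (lamMul lam z) - lamMul lam z := by
      change HopfRep.dualAntipode k H β - β = _
      rw [h1]
    rw [h2]
    refine (HRep.coadjoint_hom_iff _).trans (forall₂_congr fun a ha => ?_)
    have h3 : HopfRep.dualAntipode k H (lamMul lam z) a =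
        lamMul lam z (HopfRep.antipodeBd k H a) := rfl
    rw [LinearMap.sub_apply, sub_eq_zero, h3, hz.antipodeBd_apply, lamMul_apply, lamMul_apply,
      hlam.antipodeFour_mul_antipode h0 hν z a fun y => (Subalgebra.mem_center_iff.mp ha y).symm]
  · rw [HRep.negligible_iff]
    let γ : Module.Dual k H ⊗[k] Module.Dual k H :=
      (HopfRep.dualMul k H).lTensor (Module.Dual k H)
        (TensorProduct.assoc k _ _ _ (HopfRep.dualComul k H (lamMul lam z) ⊗ₜ lamMul lam z))
    have h2 : ((HRep.repCoend k H).sq α ≫ (HRep.repCoend k H).gammaL -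
        (HRep.repCoend k H).sq α).lin (1 : k) = γ - lamMul lam z ⊗ₜ[k] lamMul lam z := by
      change (HopfRep.dualMul k H).lTensor (Module.Dual k H)
        (TensorProduct.assoc k _ _ _ (HopfRep.dualComul k H β ⊗ₜ[k] β)) - β ⊗ₜ[k] β = _
      rw [h1]
    rw [h2]
    refine (HRep.coadjoint_tensor_hom_iff _).trans ?_
    have h3 : ∀ X, TensorProduct.dualDistrib k H H (γ - lamMul lam z ⊗ₜ[k] lamMul lam z) X = 0 ↔
        lamSq lam z (slide k H (adBraid X)) = lamSq lam z (adBraid X) := fun X => by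
      rw [map_sub, LinearMap.sub_apply, sub_eq_zero, dualDistrib_gammaL hz, lamSq_adBraid hz]
      rfl
    simp only [h3]
    refine ⟨fun h X hX => ?_, fun h X hX => h _ ((adBraid_mem_V₂_iff hS X).mpr hX)⟩
    obtain ⟨Y, rfl⟩ := adBraid_surjective hS X
    exact h Y ((adBraid_mem_V₂_iff hS Y).mp hX)

theorem exists_hom_iff (lam : Module.Dual k H) (z : H) :
    (∃ α : 𝟙_ (HRep k H) ⟶ (HRep.repCoend k H).A, α.lin = phi lam z) ↔
      IsAdInvariant (lamMul lam z) := by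
  refine ⟨fun ⟨α, hα⟩ h x => ?_, fun hz => ⟨⟨phi lam z, fun h (c : k) => ?_⟩, rfl⟩⟩
  · have h1 : α.lin (1 : k) = lamMul lam z :=
      (LinearMap.congr_fun hα (1 : k)).trans (phi_one lam z)
    have h2 : phi lam z (ε h * 1) = HopfRep.coadj k H h (lamMul lam z) :=
      (LinearMap.congr_fun hα _).symm.trans ((α.comm h (1 : k)).trans
        (congrArg (HopfRep.coadj k H h) h1))
    have h3 := LinearMap.congr_fun h2 x
    rw [mul_one] at h3
    exact h3.symm
  · refine LinearMap.ext fun x => ?_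
    change (ε h * c) • lamMul lam z x = c • lamMul lam z (HopfRep.rightAdj k H h x)
    rw [hz, smul_eq_mul, smul_eq_mul]
    ring

theorem thetaPos_ne_zero_iff (lam : Module.Dual k H) (z : H)
    (α : 𝟙_ (HRep k H) ⟶ (HRep.repCoend k H).A) (hα : α.lin = phi lam z) :
    α ≫ (HRep.repCoend k H).thetaPos ≠ 0 ↔ lam (z * (HopfRep.twistElt k H : H)) ≠ 0 := by
  have h1 : α.lin (1 : k) = lamMul lam z :=
    (LinearMap.congr_fun hα (1 : k)).trans (phi_one lam z)
  have h2 : HRep.form (α ≫ (HRep.repCoend k H).thetaPos) (1 : k) =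
      lam (z * (HopfRep.twistElt k H : H)) :=
    congrArg (Module.Dual.eval k H (HopfRep.twistElt k H : H)) h1
  rw [← h2]
  refine not_congr ⟨fun h => by rw [h]; rfl, fun h => HRep.hom_ext (LinearMap.ext_ring h)⟩

theorem thetaNeg_ne_zero_iff (lam : Module.Dual k H) (z : H)
    (α : 𝟙_ (HRep k H) ⟶ (HRep.repCoend k H).A) (hα : α.lin = phi lam z) :
    α ≫ (HRep.repCoend k H).thetaNeg ≠ 0 ↔
      lam (z * ((HopfRep.twistElt k H)⁻¹ : Hˣ)) ≠ 0 := by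
  have h1 : α.lin (1 : k) = lamMul lam z :=
    (LinearMap.congr_fun hα (1 : k)).trans (phi_one lam z)
  have h2 : HRep.form (α ≫ (HRep.repCoend k H).thetaNeg) (1 : k) =
      lam (z * ((HopfRep.twistElt k H)⁻¹ : Hˣ)) :=
    congrArg (Module.Dual.eval k H ((HopfRep.twistElt k H)⁻¹ : Hˣ)) h1
  rw [← h2]
  refine not_congr ⟨fun h => by rw [h]; rfl, fun h => HRep.hom_ext (LinearMap.ext_ring h)⟩

theorem sub_mem_L {ν : H →ₐ[k] k} {z w : H} (hz : z ∈ L ν) (hw : w ∈ L ν) : z - w ∈ L ν :=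
  fun x => by rw [mul_sub, sub_mul, hz, hw]

theorem T_sub_mem_N_iff {lam : Module.Dual k H}
    (hS : Function.Surjective (HopfAlgebra.antipode k (A := H))) {ν : H →ₐ[k] k} {z : H}
    (hz : z ∈ L ν) : T ν z - z ∈ N lam ν ↔
      ∀ a ∈ Subalgebra.center k H, lam (T ν z * a) = lam (z * a) := by
  refine (and_iff_right (sub_mem_L (T_mem_L hS hz) hz)).trans (forall₂_congr fun a _ => ?_)
  rw [sub_mul, map_sub, sub_eq_zero]

theorem kirby_iff {lam : Module.Dual k H} (hlam : IsRightIntegral lam) (h0 : lam ≠ 0)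
    {ν : H →ₐ[k] k} (hν : IsDistinguished ν) (z : H) :
    z ∈ kirby lam ↔ z ∈ L ν ∧ T ν z - z ∈ N lam ν ∧
      ∀ X ∈ V₂ k H, lamSq lam z (slide k H X) = lamSq lam z X := by
  have hS := (hlam.antipode_bijective h0).2
  constructor
  · rintro ⟨α, hα, hα'⟩
    have hz := (exists_hom_iff lam z).mp ⟨α, hα'⟩
    have hL := (mem_L_iff hlam h0 hν z).mpr hz
    exact ⟨hL, by rwa [T_sub_mem_N_iff hS hL, ← mem_kirby_iff hlam h0 hν z α hα' hz]⟩
  · rintro ⟨hL, h⟩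
    have hz := (mem_L_iff hlam h0 hν z).mp hL
    obtain ⟨α, hα⟩ := (exists_hom_iff lam z).mpr hz
    exact ⟨α, by rwa [mem_kirby_iff hlam h0 hν z α hα hz, ← T_sub_mem_N_iff hS hL], hα⟩

theorem lamSq_slide {lam : Module.Dual k H} {z : H}
    (hz : ∀ x : H, TensorProduct.lid k H (TensorProduct.map (lamMul lam z)
      (LinearMap.mulLeft k z) (Coalgebra.comul x)) = lam (z * x) • z) (X : H ⊗[k] H) :
    lamSq lam z (slide k H X) = lamSq lam z X := by
  have h : lamSq lam z ∘ₗ slide k H = lamSq lam z := TensorProduct.ext' fun x y => by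
    have h1 := congrArg (fun t => lam (t * y)) ((apply_eq_sumT
      ((TensorProduct.lid k H).toLinearMap ∘ₗ TensorProduct.map (lamMul lam z)
      (LinearMap.mulLeft k z)) (Δ x)).symm.trans (hz x))
    simp only [sumT_mul, map_sumT, smul_mul_assoc, map_smul, smul_eq_mul] at h1
    rw [LinearMap.comp_apply, slide_tmul, map_sumT, lamSq_tmul, ← h1]
    refine sumT_congr fun a b => ?_
    change lam (z * a) * lam (z * (b * y)) = lam (lam (z * a) • (z * b) * y)
    rw [smul_mul_assoc, map_smul, smul_eq_mul, mul_assoc]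
  exact LinearMap.congr_fun h X

end

end HopfKirby

theorem mainTheorem3 {k H : Type u} [Field k] [Ring H] [HopfAlgebra k H] [FiniteDimensional k H]
    [RibbonHopfAlgebra k H] (lam : Module.Dual k H) (hlam : HopfKirby.IsRightIntegral lam)
    (hlam0 : lam ≠ 0) (ν : H →ₐ[k] k) (hν : HopfKirby.IsDistinguished ν) :
    (∀ z : H, z ∈ HopfKirby.kirby lam ↔
      z ∈ HopfKirby.L ν ∧ HopfKirby.T ν z - z ∈ HopfKirby.N lam ν ∧
        ∀ X ∈ HopfKirby.V₂ k H,
          HopfKirby.lamSq lam z (HopfKirby.slide k H X) = HopfKirby.lamSq lam z X) ∧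
    (∀ z ∈ HopfKirby.L ν, HopfKirby.T ν z - z ∈ HopfKirby.N lam ν ↔
      ∀ a ∈ Subalgebra.center k H, lam (HopfKirby.T ν z * a) = lam (z * a)) ∧
    (∀ z ∈ HopfKirby.L ν, HopfKirby.T ν z = z →
      (∀ x : H, TensorProduct.lid k H (TensorProduct.map (HopfKirby.lamMul lam z)
        (LinearMap.mulLeft k z) (Coalgebra.comul x)) = lam (z * x) • z) →
      z ∈ HopfKirby.kirby lam) ∧
    (∀ z ∈ HopfKirby.kirby lam, z ∈ HopfKirby.kirbyNorm lam ↔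
      lam (z * (HopfRep.twistElt k H : H)) ≠ 0 ∧
      lam (z * ((HopfRep.twistElt k H)⁻¹ : Hˣ)) ≠ 0) := by
  have hS := (hlam.antipode_bijective hlam0).2
  refine ⟨HopfKirby.kirby_iff hlam hlam0 hν, fun z hz => HopfKirby.T_sub_mem_N_iff hS hz,
    fun z hz hT h => ?_, fun z hz => ⟨?_, fun h => ?_⟩⟩
  · refine (HopfKirby.kirby_iff hlam hlam0 hν z).mpr ⟨hz, ?_, fun X _ =>
      HopfKirby.lamSq_slide h X⟩
    exact (HopfKirby.T_sub_mem_N_iff hS hz).mpr fun a _ => by rw [hT]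
  · rintro ⟨α, ⟨-, h1, h2⟩, hα⟩
    exact ⟨(HopfKirby.thetaPos_ne_zero_iff lam z α hα).mp h1,
      (HopfKirby.thetaNeg_ne_zero_iff lam z α hα).mp h2⟩
  · obtain ⟨α, h1, hα⟩ := hz
    exact ⟨α, ⟨h1, (HopfKirby.thetaPos_ne_zero_iff lam z α hα).mpr h.1,
      (HopfKirby.thetaNeg_ne_zero_iff lam z α hα).mpr h.2⟩, hα⟩
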